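/- Let $d,n\ge 1$ be integers, $\alpha\in(0,2]$ and $m\in\mathbb R$. Consider a random flight in $\mathbb R^d$ with $n$ changes of direction: on a measurable space $\Omega$ there are given renewal times $\tau_1,\dots,\tau_n\ge 0$, with $T_k=\tau_1+\dots+\tau_k$ and $T_0=0$, and directions $V_0,\dots,V_n$ with values in the unit sphere $\mathbb S^{d-1}$ (for $d=1$ the directions alternate, $V_k=(-1)^kV_0$). Let $V^n(s)=V_k$ for $T_k\le s<T_{k+1}$, $0\le k<n$, and $V^n(s)=V_n$ for $s\ge T_n$; let $X^n(t)=c\int_0^tV^n(s)\,ds$ be the position at time $t$ for the speed $c$, and let $\mathcal F^n_t$ be the $\sigma$-algebra generated by the events $\{T_k\le s\}\cap\{(V_0,\dots,V_k)\in B\}$, $0\le s\le t$, $0\le k\le n$, $B$ measurable. Put $$\beta=\frac1{d(m-1)+\alpha},\qquad k=\frac{d\,\Gamma(d/2)}{(d(m-1)+\alpha)\,2^\alpha\,\Gamma(1+\frac\alpha2)\,\Gamma(\frac{d+\alpha}2)},\qquad c=k^{-1/\alpha},$$ $$C=\frac{\Gamma(\frac d2+\frac\alpha{2(m-1)}+1)\,k^{d/\alpha}}{\pi^{d/2}\,\Gamma(\frac\alpha{2(m-1)}+1)},\qquad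 u(x,t)=C\,t^{-d\beta}\Bigl(1-k^{2/\alpha}\frac{\|x\|^2}{t^{2\beta}}\Bigr)_+^{\frac{\alpha}{2(m-1)}},$$ and let $Y^n(t)=X^n(t^\beta)$ with this speed $c$ and $\mathcal G^n_t=\mathcal F^n_{t^\beta}$. For $s>0$ let $f_s$ be a density on $$S_n(s)=\{(x_1,\dots,x_n):0<x_j<s-(x_1+\dots+x_{j-1}),\ 1\le j\le n\},$$ and assume one of the following. (i) $d=1$, $f_s=n!/s^n$ on $S_n(s)$, and $m=\frac{\alpha}{n-1}+1$ with $n\ge3$ odd, or $m=\frac{\alpha}{n-2}+1$ with $n\ge4$ even. (ii) $d\ge2$, $d>\frac2n+1$, $m=\frac{\alpha}{n(d-1)-2}+1$, and $f_s$ is the rescaled Dirichlet density with $q=d-1$. (iii) $d\ge3$, $d>\frac2n+2$, $m=\frac{\alpha}{n(d-2)-2}+1$, and $f_s$ is the rescaled Dirichlet density with $q=\frac d2-1$. Here the rescaled Dirichlet density is $f_s(x)=\frac{\Gamma((n+1)q)}{\Gamma(q)^{n+1}}\,s^{1-(n+1)q}\prod_{j=1}^{n+1}x_j^{q-1}$ on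 $S_n(s)$, with $x_{n+1}=s-\sum_{j\le n}x_j$. Then: (a) $m>1$; $(\mathcal G^n_t)_{t\ge0}$ is a filtration, and $Y^n$ is adapted to it and progressively measurable. (b) Let $t>0$, and let $P$ be a probability measure on $\Omega$ under which the directions are uniformly distributed on $\mathbb S^{d-1}$ (and mutually independent if $d\ge2$) and independent of the renewal times, and $(\tau_1,\dots,\tau_n)$ has the density $f_s$ with $s=t^\beta$ (the law of the renewal times when there are $n$ changes of direction up to the time $s$). Then $P(Y^n(t)\in dx)=u(x,t)\,dx$. (c) For all $0<\eta<T<\infty$ the function $w=C^{-1}u$ is a weak solution on $\mathbb R^d\times(\eta,T)$, with initial value $w(\cdot,\eta)$, of the nonlocal porous medium equation $$\partial_t w=\operatorname{div}\bigl(|w|\,\nabla^{\alpha-1}(|w|^{m-2}w)\bigr),$$ where $\nabla^{\alpha-1}$ is the Fourier multiplier with symbol $i\xi\|\xi\|^{\alpha-2}$ (for the convention in which $\nabla$ has symbol $i\xi$). That is: $w\in L^1(\mathbb R^d\times(\eta,T))$; $\nabla^{\alpha-1}(|w|^{m-2}w)$ and $|w|\nabla^{\alpha-1}(|w|^{m-2}w)$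 are in $L^1_{loc}(\mathbb R^d\times(\eta,T))$; and $$\int_{\mathbb R^d}\int_\eta^T\bigl(w\,\partial_t\varphi-|w|\nabla^{\alpha-1}(|w|^{m-2}w)\cdot\nabla\varphi\bigr)\,dt\,dx+\int_{\mathbb R^d}w(x,\eta)\varphi(x,\eta)\,dx=0$$ for all $\varphi\in C^\infty(\mathbb R^d\times(\eta,T))\cap C^1(\mathbb R^d\times[\eta,T])$ that have compact support in $x$ and vanish near $t=T$. -/

import Mathlib

open MeasureTheory ProbabilityTheory Set
open scoped NNReal ENNReal

/-- The Euclidean space `ℝ^d`. -/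
abbrev EucSpace (d : ℕ) : Type := EuclideanSpace ℝ (Fin d)

/-! ### The nonlocal porous medium equation -/

/-- `g` is the fractional gradient `∇^(α-1) v` of the integrable function `v`, that is, the locally
integrable vector field whose Fourier transform, as a distribution, is `i ξ ‖ξ‖^(α-2)` times that
of `v`. With the normalization `𝓕 v ξ = ∫ exp (-2π i ⟪x, ξ⟫) v x` used here the symbol
is `i (2π ξ) ‖2π ξ‖^(α-2)`. For `α = 2` this is the distributional gradient. -/
def IsFractionalGradient {d : ℕ} (α : ℝ) (v : EucSpace d → ℝ) (g : EucSpace d → EucSpace d) :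
    Prop :=
  Integrable v ∧ LocallyIntegrable g ∧
    ∀ (j : Fin d) (ψ : EucSpace d → ℂ), ContDiff ℝ ((⊤ : ℕ∞) : WithTop ℕ∞) ψ → HasCompactSupport ψ →
      ∫ x, ((g x j : ℝ) : ℂ) * ψ x =
        ∫ ξ : EucSpace d,
          (Complex.I * ((2 * Real.pi * ξ j : ℝ) : ℂ) *
              (((2 * Real.pi * ‖ξ‖) ^ (α - 2) : ℝ) : ℂ)) *
            FourierTransform.fourier (fun x => (v x : ℂ)) ξ *
            FourierTransformInv.fourierInv ψ ξ

/-- Test functions on `ℝ^d × (a, b)`: smooth inside, `C^1` up to the boundary, of compact support in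
space, and vanishing near the final time `b`. -/
structure IsSpaceTimeTest {d : ℕ} (a b : ℝ) (φ : EucSpace d × ℝ → ℝ) : Prop where
  smooth : ContDiffOn ℝ ((⊤ : ℕ∞) : WithTop ℕ∞) φ (univ ×ˢ Ioo a b)
  contDiff_closure : ContDiffOn ℝ 1 φ (univ ×ˢ Icc a b)
  compact_space : ∃ K : Set (EucSpace d), IsCompact K ∧ ∀ x ∉ K, ∀ t ∈ Icc a b, φ (x, t) = 0
  vanish_end : ∃ δ > 0, ∀ x, ∀ t ∈ Icc a b, b - δ < t → φ (x, t) = 0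

/-- `u` is a weak solution on `ℝ^d × (a, b)` of
`∂ₜ u = div (|u| ∇^(α-1) (|u|^(m-2) u))` with value `u₀` at the initial time `a`. -/
def IsWeakSolutionNPME {d : ℕ} (α m a b : ℝ) (u : EucSpace d → ℝ → ℝ) (u₀ : EucSpace d → ℝ) :
    Prop :=
  IntegrableOn (fun p : EucSpace d × ℝ => u p.1 p.2) (univ ×ˢ Ioo a b) ∧
  ∃ g : EucSpace d → ℝ → EucSpace d,
    (∀ᵐ t ∂(volume.restrict (Ioo a b)),
      IsFractionalGradient α (fun x => |u x t| ^ (m - 2) * u x t) (fun x => g x t)) ∧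
    LocallyIntegrableOn (fun p : EucSpace d × ℝ => g p.1 p.2) (univ ×ˢ Ioo a b) ∧
    LocallyIntegrableOn (fun p : EucSpace d × ℝ => |u p.1 p.2| • g p.1 p.2) (univ ×ˢ Ioo a b) ∧
    ∀ φ : EucSpace d × ℝ → ℝ, IsSpaceTimeTest a b φ →
      IntegrableOn (fun p : EucSpace d × ℝ =>
        u p.1 p.2 * deriv (fun s => φ (p.1, s)) p.2 -
          |u p.1 p.2| * inner ℝ (g p.1 p.2) (gradient (fun y => φ (y, p.2)) p.1))
        (univ ×ˢ Ioo a b) ∧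
      Integrable (fun x => u₀ x * φ (x, a)) ∧
      (∫ p in (univ : Set (EucSpace d)) ×ˢ Ioo a b,
        (u p.1 p.2 * deriv (fun s => φ (p.1, s)) p.2 -
          |u p.1 p.2| * inner ℝ (g p.1 p.2) (gradient (fun y => φ (y, p.2)) p.1))) +
        ∫ x, u₀ x * φ (x, a) = 0

/-! ### The explicit Barenblatt-type function -/

/-- `β = 1 / (d (m - 1) + α)`. -/
noncomputable def npmeBeta (d : ℕ) (α m : ℝ) : ℝ := 1 / (d * (m - 1) + α)

/-- The constant `k`. -/
noncomputable def npmeK (d : ℕ) (α m : ℝ) : ℝ :=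
  d * Real.Gamma (d / 2) /
    ((d * (m - 1) + α) * 2 ^ α * Real.Gamma (1 + α / 2) * Real.Gamma ((d + α) / 2))

/-- The normalizing constant `C`. -/
noncomputable def npmeC (d : ℕ) (α m : ℝ) : ℝ :=
  Real.Gamma (d / 2 + α / (2 * (m - 1)) + 1) * npmeK d α m ^ (d / α) /
    (Real.pi ^ ((d : ℝ) / 2) * Real.Gamma (α / (2 * (m - 1)) + 1))

/-- The speed `c = 1 / k^(1/α)`. -/
noncomputable def npmeSpeed (d : ℕ) (α m : ℝ) : ℝ := 1 / npmeK d α m ^ (1 / α)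

/-- `u(x,t) = C t^(-dβ) (1 - k^(2/α) ‖x‖² / t^(2β))₊^(α/(2(m-1)))`. -/
noncomputable def npmeDensity (d : ℕ) (α m : ℝ) (x : EucSpace d) (t : ℝ) : ℝ :=
  npmeC d α m * t ^ (-(d * npmeBeta d α m)) *
    (max (1 - npmeK d α m ^ (2 / α) * (‖x‖ ^ 2 / t ^ (2 * npmeBeta d α m))) 0) ^
      (α / (2 * (m - 1)))

/-! ### Random flights -/

/-- The random ingredients of a flight in `ℝ^d` with `n` changes of direction: the renewal times
`τ₁, …, τₙ` (here `renewal j` is `τ_(j+1)`) and the directions `V₀, …, Vₙ`.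
In dimension one the two directions alternate, `V_k = (-1)^k V₀`. -/
structure RandomFlight (d n : ℕ) (Ω : Type*) [MeasurableSpace Ω] where
  renewal : Fin n → Ω → ℝ
  dir : Fin (n + 1) → Ω → Metric.sphere (0 : EucSpace d) 1
  measurable_renewal : ∀ j, Measurable (renewal j)
  measurable_dir : ∀ k, Measurable (dir k)
  renewal_nonneg : ∀ j ω, 0 ≤ renewal j ω
  alternating : d = 1 → ∀ k ω,
    (dir k ω : EucSpace d) = (-1 : ℝ) ^ (k : ℕ) • (dir 0 ω : EucSpace d)

namespace RandomFlight

variable {d n : ℕ} {Ω : Type*} [mΩ : MeasurableSpace Ω] (F : RandomFlight d n Ω)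

/-- The arrival epochs `T_k = τ₁ + ⋯ + τ_k` (so `T₀ = 0`), for `k ≤ n`. -/
def epoch (k : ℕ) (ω : Ω) : ℝ :=
  ∑ j ∈ Finset.univ.filter (fun j : Fin n => (j : ℕ) < k), F.renewal j ω

/-- The jump process `V(s) = V_k` for `T_k ≤ s < T_(k+1)`, `0 ≤ k < n`, and `V(s) = Vₙ` for
`s ≥ Tₙ`. -/
noncomputable def direction (s : ℝ) (ω : Ω) : EucSpace d :=
  ∑ k : Fin (n + 1), (if F.epoch k ω ≤ s ∧ ((k : ℕ) < n → s < F.epoch (k + 1) ω)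
    then (F.dir k ω : EucSpace d) else 0)

/-- The position `X(t) = c ∫₀ᵗ V(s) ds` of the flight with speed `c`. -/
noncomputable def position (c t : ℝ) (ω : Ω) : EucSpace d :=
  c • ∫ s in (0 : ℝ)..t, F.direction s ω

theorem measurable_epoch (k : ℕ) : Measurable (F.epoch k) := by
  unfold epoch
  exact Finset.measurable_fun_sum _ (fun j _ => F.measurable_renewal j)

/-- The history of the flight: the `σ`-algebra at time `t` is generated by the events
`{T_k ≤ s} ∩ {(V₀, …, V_k) ∈ B}` with `s ≤ t`, `0 ≤ k ≤ n` and `B` measurable. -/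
def history : Filtration ℝ≥0 mΩ where
  seq t := MeasurableSpace.generateFrom
    {A | ∃ s : ℝ≥0, s ≤ t ∧ ∃ (k : Fin (n + 1))
      (B : Set (Set.Iic k → Metric.sphere (0 : EucSpace d) 1)), MeasurableSet B ∧
      A = {ω | F.epoch k ω ≤ s ∧ (fun i : Set.Iic k => F.dir i ω) ∈ B}}
  mono' := by
    intro t t' h
    refine MeasurableSpace.generateFrom_mono ?_
    rintro A ⟨s, hs, k, B, hB, rfl⟩
    exact ⟨s, hs.trans h, k, B, hB, rfl⟩
  le' := by
    intro t
    refine MeasurableSpace.generateFrom_le ?_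
    rintro A ⟨s, hs, k, B, hB, rfl⟩
    exact (measurableSet_le (F.measurable_epoch k) measurable_const).inter
      ((measurable_pi_lambda _ (fun i : Set.Iic k => F.measurable_dir i)) hB)

end RandomFlight

/-- The uniform distribution on the unit sphere of `ℝ^d` (normalized surface measure; for `d = 1`
the two unit vectors have probability `1/2` each). -/
noncomputable def sphereUniform (d : ℕ) : Measure (Metric.sphere (0 : EucSpace d) 1) :=
  ((volume : Measure (EucSpace d)).toSphere univ)⁻¹ • (volume : Measure (EucSpace d)).toSphere

/-- Under `P` the directions are uniform on the sphere, independent of each other if `d ≥ 2`, and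
independent of the renewal times. -/
structure RandomFlight.IsIsotropic {d n : ℕ} {Ω : Type*} [MeasurableSpace Ω]
    (F : RandomFlight d n Ω) (P : Measure Ω) : Prop where
  uniform : ∀ k, P.map (F.dir k) = sphereUniform d
  indep_dir : 2 ≤ d → iIndepFun F.dir P
  indep_renewal : IndepFun (fun ω k => F.dir k ω) (fun ω j => F.renewal j ω) P

/-- The set `Sₙ` of admissible renewal times with horizon `t`. -/
def renewalSimplex (n : ℕ) (t : ℝ) : Set (Fin n → ℝ) :=
  {x | ∀ j, 0 < x j ∧ x j < t - ∑ i ∈ Finset.univ.filter (fun i : Fin n => i < j), x i}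

/-- The uniform density `n! / t^n` on the simplex `Sₙ`. -/
noncomputable def uniformRenewalDensity (n : ℕ) (t : ℝ) : (Fin n → ℝ) → ℝ :=
  (renewalSimplex n t).indicator (fun _ => (n.factorial : ℝ) / t ^ n)

/-- The rescaled Dirichlet density with parameters `(q, …, q)` (`n + 1` of them) on the simplex
`Sₙ`; the last factor is the one of `τ_(n+1) = t - (τ₁ + ⋯ + τₙ)`. -/
noncomputable def dirichletRenewalDensity (n : ℕ) (q t : ℝ) : (Fin n → ℝ) → ℝ :=
  (renewalSimplex n t).indicator (fun x =>
    Real.Gamma ((n + 1) * q) / Real.Gamma q ^ (n + 1) * (1 / t ^ ((n + 1) * q - 1)) *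
      ((∏ j, x j ^ (q - 1)) * (t - ∑ j, x j) ^ (q - 1)))

/-- Under `P` the vector `(τ₁, …, τₙ)` of renewal times has density `f`. -/
def RandomFlight.HasRenewalDensity {d n : ℕ} {Ω : Type*} [MeasurableSpace Ω]
    (F : RandomFlight d n Ω) (f : (Fin n → ℝ) → ℝ) (P : Measure Ω) : Prop :=
  P.map (fun ω j => F.renewal j ω) = volume.withDensity (fun x => ENNReal.ofReal (f x))

/-! ### Convolution families of polynomials -/

/-! The law of the flight and the equation for its density are proved separately; they share only
the explicit profile.

Law. Up to time s the path has n + 1 gaps, and its position is c ∑ gap_k V_k. This vector and the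
profile (1 - ‖x‖²/R²)₊^ν are both bounded, so it suffices to compare the moments of ⟨·, ξ⟩
(`Measure.ext_of_moments`). Dirichlet moments are products of rising factorials, hence the
multinomial theorem turns the p-th moment into p! / ((n+1)q)_p times a coefficient of a product of n
+ 1 power series (`integral_sum_gaps_mul_pow`). For d ≥ 2 these series coincide; up to scaling their
coefficients at x^(2p) are `momentCoeff q (d/2) p`. For q = d - 1 the series is (1 - x²)^(-q/2); for
q = d/2 - 1 it is B^q with B = 1 + (x²/4) B². In both families the (n+1)-st power just replaces q by
(n+1)q, and the outcome is again a `momentCoeff`, now with a parameter b. So the moments are (1/2)_r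
/ (b)_r, which are those of the profile with b = d/2 + ν + 1; this is what ties m to d and n. In
dimension one, with q = 1 and alternating signs, the series are 1/(1 - x) and 1/(1 + x). Adaptedness
holds because V_k enters the position only after the epoch T_k.

Equation. The function w^(m-1) is k/t times (ρ² - ‖x‖²)₊^(α/2) with ρ = c t^β. Inside the ball the
fractional gradient of this power is the linear field -κ x, with κ = `contractionRate`, and k κ = β.
Outside the ball it is multiplied by w = 0. So the flux is -w β x / t, and the equation reduces to
the continuity equation for the velocity β x / t, whose characteristics are t ↦ t^β y. In the
variable y the weak form is the fundamental theorem of calculus along characteristics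
(`IsSpaceTimeTest.transport_identity`).

Linearity of the gradient. For α < 2 put a = α/2 and write the fractional gradient as an average,
with Gaussian weight in the direction θ, of integrals of v(x + rθ) - v(x - rθ) against r^(-2a)
(`chordGradient`). That this has the right Fourier symbol follows because the Gaussian is its own
Fourier transform (`integral_chordGradient_mul`). On a single chord the integral is linear in the
slope (`integral_chord`): its derivative in the slope is a sum over two half chords, which two
substitutions reduce to the Beta integral B(1 - a, a), whatever the chord (`lintegral_chord`). For α
= 2 the function is Lipschitz and integration by parts suffices. -/

theorem Polynomial.eq_zero_of_eval_add_one (P : Polynomial ℝ) (h0 : P.eval 0 = 0)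
    (h : ∀ x, P.eval (x + 1) = P.eval x) : P = 0 := by
  refine Polynomial.eq_zero_of_infinite_isRoot P ?_
  have hn : ∀ n : ℕ, P.eval (n : ℝ) = 0 := by
    intro n
    induction n with
    | zero => simpa using h0
    | succ n ih => push_cast; rw [h, ih]
  exact (Set.infinite_range_of_injective (Nat.cast_injective (R := ℝ))).mono
    (by rintro _ ⟨n, rfl⟩; exact hn n)

/-- The model is a series B with B = 1 + δ x B^(1+e): `c p` plays the coefficient of x^p in B^q,
`hs` reads B^(q+1) = B^q + δ x B^(q+1+e), and the conclusion reads B^q B^q' = B^(q+q'). As a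
polynomial in q the defect at level p + 1 vanishes at 0, and its forward difference is δ times the
defect at level p, which is zero by induction. -/
theorem Polynomial.sum_antidiagonal_eval_mul_eval (c : ℕ → Polynomial ℝ) (δ e : ℝ) (h0 : c 0 = 1)
    (hz : ∀ p, (c (p + 1)).eval 0 = 0)
    (hs : ∀ p q, (c (p + 1)).eval (q + 1) = (c (p + 1)).eval q + δ * (c p).eval (q + 1 + e))
    (p : ℕ) (q q' : ℝ) :
    ∑ i ∈ Finset.HasAntidiagonal.antidiagonal p, (c i.1).eval q * (c i.2).eval q' = (c p).eval (q + q') := by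
  induction p generalizing q q' with
  | zero => simp [h0]
  | succ p ih =>
    set D : Polynomial ℝ :=
      ∑ i ∈ Finset.HasAntidiagonal.antidiagonal (p + 1), c i.1 * Polynomial.C ((c i.2).eval q') -
        (c (p + 1)).comp (Polynomial.X + Polynomial.C q') with hD
    have hDe : ∀ x, D.eval x = (c (p + 1)).eval q' +
        ∑ i ∈ Finset.HasAntidiagonal.antidiagonal p, (c (i.1 + 1)).eval x * (c i.2).eval q' -
          (c (p + 1)).eval (x + q') := by
      intro x
      rw [hD, Finset.Nat.antidiagonal_succ]
      simp [Polynomial.eval_finsetSum, h0]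
    have hDz : D = 0 := by
      refine D.eq_zero_of_eval_add_one ?_ ?_
      · rw [hDe]; simp [hz]
      · intro x
        rw [hDe, hDe]
        have h1 : x + 1 + q' = (x + q') + 1 := by ring
        have h2 : (c p).eval (x + q' + 1 + e) = (c p).eval ((x + 1 + e) + q') := by
          congr 1; ring
        rw [h1, hs, h2, ← ih]
        simp only [hs, add_mul, Finset.sum_add_distrib, Finset.mul_sum, mul_assoc]
        ring
    have h3 := hDe q
    rw [hDz] at h3
    rw [Finset.Nat.antidiagonal_succ]
    simp only [Finset.sum_cons, Finset.sum_map, h0]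
    simp only [Polynomial.eval_zero, Polynomial.eval_one, one_mul] at h3 ⊢
    simp only [Function.Embedding.prodMap, Function.Embedding.coeFn_mk, Prod.map,
      Function.Embedding.refl_apply]
    simp at h3 ⊢
    linarith

/-- The polynomials `(q)_p / p!`. -/
noncomputable def risingPoly (p : ℕ) : Polynomial ℝ :=
  Polynomial.C ((p.factorial : ℝ)⁻¹) * ascPochhammer ℝ p

/-- The polynomials `q (q + p + 1)_(p-1) / (4^p p!)`. -/
noncomputable def hagenPoly : ℕ → Polynomial ℝ
  | 0 => 1
  | p + 1 => Polynomial.C (((4 : ℝ) ^ (p + 1) * ((p + 1).factorial : ℝ))⁻¹) * Polynomial.X *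
      (ascPochhammer ℝ p).comp (Polynomial.X + Polynomial.C ((p : ℝ) + 2))

theorem ascPochhammer_eval_succ_left (p : ℕ) (q : ℝ) :
    (ascPochhammer ℝ (p + 1)).eval q = q * (ascPochhammer ℝ p).eval (q + 1) := by
  rw [ascPochhammer_succ_left]; simp

theorem ascPochhammer_eval_succ_right (p : ℕ) (q : ℝ) :
    (ascPochhammer ℝ (p + 1)).eval q = (ascPochhammer ℝ p).eval q * (q + p) := by
  rw [ascPochhammer_succ_right]; simp

theorem ascPochhammer_eval_pos {q : ℝ} (hq : 0 < q) (p : ℕ) : 0 < (ascPochhammer ℝ p).eval q :=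
  ascPochhammer_pos p q hq

theorem ascPochhammer_eval_two_mul (p : ℕ) (q : ℝ) :
    (ascPochhammer ℝ (2 * p)).eval q =
      4 ^ p * ((ascPochhammer ℝ p).eval (q / 2) * (ascPochhammer ℝ p).eval ((q + 1) / 2)) := by
  induction p with
  | zero => simp
  | succ p ih =>
    rw [show 2 * (p + 1) = 2 * p + 1 + 1 by ring, ascPochhammer_eval_succ_right,
      ascPochhammer_eval_succ_right, ih, ascPochhammer_eval_succ_right,
      ascPochhammer_eval_succ_right]
    push_cast
    ring

theorem factorial_two_mul_eq (p : ℕ) :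
    ((2 * p).factorial : ℝ) = 4 ^ p * ((p.factorial : ℝ) * (ascPochhammer ℝ p).eval (1 / 2)) := by
  induction p with
  | zero => simp
  | succ p ih =>
    rw [show 2 * (p + 1) = 2 * p + 1 + 1 by ring, Nat.factorial_succ, Nat.factorial_succ,
      Nat.factorial_succ, ascPochhammer_eval_succ_right]
    push_cast
    rw [ih]; ring

theorem ascPochhammer_eval_add (m n : ℕ) (q : ℝ) :
    (ascPochhammer ℝ (m + n)).eval q =
      (ascPochhammer ℝ m).eval q * (ascPochhammer ℝ n).eval (q + m) := by
  rw [← ascPochhammer_mul]; simp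

theorem Gamma_add_natCast {q : ℝ} (hq : 0 < q) (p : ℕ) :
    Real.Gamma (q + p) = (ascPochhammer ℝ p).eval q * Real.Gamma q := by
  induction p with
  | zero => simp
  | succ p ih =>
    rw [ascPochhammer_eval_succ_right]
    push_cast
    rw [← add_assoc, Real.Gamma_add_one (by positivity), ih]; ring

/-- These are the coefficients of (1 - x)^(-q); the identity is that of Chu and Vandermonde. -/
theorem risingPoly_conv (p : ℕ) (q q' : ℝ) :
    ∑ i ∈ Finset.HasAntidiagonal.antidiagonal p, (risingPoly i.1).eval q * (risingPoly i.2).eval q' =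
      (risingPoly p).eval (q + q') := by
  refine Polynomial.sum_antidiagonal_eval_mul_eval risingPoly 1 0 ?_ ?_ ?_ p q q'
  · simp [risingPoly]
  · intro p; simp [risingPoly]
  · intro p q
    simp only [risingPoly, Polynomial.eval_mul, Polynomial.eval_C, add_zero, one_mul]
    rw [ascPochhammer_eval_succ_left p q, ascPochhammer_eval_succ_right, Nat.factorial_succ]
    have : (p.factorial : ℝ) ≠ 0 := by positivity
    push_cast
    field_simp
    ring

/-- These are the coefficients of B^q for B = 1 + (x/4) B², the Catalan series at x/4; the identity
is of Hagen–Rothe type. -/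
theorem hagenPoly_conv (p : ℕ) (q q' : ℝ) :
    ∑ i ∈ Finset.HasAntidiagonal.antidiagonal p, (hagenPoly i.1).eval q * (hagenPoly i.2).eval q' =
      (hagenPoly p).eval (q + q') := by
  refine Polynomial.sum_antidiagonal_eval_mul_eval hagenPoly (1 / 4) 1 rfl ?_ ?_ p q q'
  · intro p; simp [hagenPoly]
  · intro p q
    rcases p with _ | p
    · simp [hagenPoly]; ring
    · simp only [hagenPoly, Polynomial.eval_mul, Polynomial.eval_C, Polynomial.eval_X,
        Polynomial.eval_comp, Polynomial.eval_add]
      push_cast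
      rw [ascPochhammer_eval_succ_right p (q + 1 + _), ascPochhammer_eval_succ_left p (q + _),
        Nat.factorial_succ (p + 1), show q + 1 + ((p : ℝ) + 1 + 2) = q + p + 4 by ring,
        show q + ((p : ℝ) + 1 + 2) + 1 = q + p + 4 by ring,
        show q + 1 + 1 + ((p : ℝ) + 2) = q + p + 4 by ring]
      have : ((p + 1).factorial : ℝ) ≠ 0 := by positivity
      push_cast
      field_simp
      ring

/-- The normalized even moments: `(q)_(2p) / (2p)! * (1/2)_p / (b)_p`. -/
noncomputable def momentCoeff (q b : ℝ) (p : ℕ) : ℝ :=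
  (ascPochhammer ℝ (2 * p)).eval q / ((2 * p).factorial : ℝ) *
    ((ascPochhammer ℝ p).eval (1 / 2) / (ascPochhammer ℝ p).eval b)

/-- Duplication, (q)_(2p) = 4^p (q/2)_p ((q+1)/2)_p, lets the denominator cancel. With q = d - 1 the
parameter (q+1)/2 is d/2; with (n+1)q in place of q the lemma reads the final moments back. -/
theorem momentCoeff_add_one_half {q : ℝ} (hq : 0 < q) (p : ℕ) :
    momentCoeff q ((q + 1) / 2) p = (risingPoly p).eval (q / 2) := by
  have h1 := ascPochhammer_eval_pos (q := 1 / 2) (by norm_num) p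
  have h2 := ascPochhammer_eval_pos (q := (q + 1) / 2) (by linarith) p
  rw [momentCoeff, ascPochhammer_eval_two_mul, factorial_two_mul_eq]
  simp only [risingPoly, Polynomial.eval_mul, Polynomial.eval_C]
  have : (p.factorial : ℝ) ≠ 0 := by positivity
  field_simp

theorem momentCoeff_half {q : ℝ} (hq : 0 < q) (p : ℕ) :
    momentCoeff q (q / 2) p = (risingPoly p).eval ((q + 1) / 2) := by
  have h1 := ascPochhammer_eval_pos (q := 1 / 2) (by norm_num) p
  have h2 := ascPochhammer_eval_pos (q := q / 2) (by linarith) p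
  rw [momentCoeff, ascPochhammer_eval_two_mul, factorial_two_mul_eq]
  simp only [risingPoly, Polynomial.eval_mul, Polynomial.eval_C]
  have : (p.factorial : ℝ) ≠ 0 := by positivity
  field_simp

/-- For p ≥ 1, (q)_(2p) = q (q+1)_p (q+p+1)_(p-1), and the middle factor cancels. With q = d/2 - 1
the parameter q + 1 is d/2. -/
theorem momentCoeff_add_one {q : ℝ} (hq : 0 < q) (p : ℕ) :
    momentCoeff q (q + 1) p = (hagenPoly p).eval q := by
  rcases p with _ | p
  · simp [momentCoeff, hagenPoly]
  have h1 := ascPochhammer_eval_pos (q := 1 / 2) (by norm_num) (p + 1)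
  have h2 := ascPochhammer_eval_pos (q := q + 1) (by linarith) (p + 1)
  rw [momentCoeff, factorial_two_mul_eq, show 2 * (p + 1) = ((p + 1) + p) + 1 by ring,
    ascPochhammer_eval_succ_left, ascPochhammer_eval_add]
  simp only [hagenPoly, Polynomial.eval_mul, Polynomial.eval_C, Polynomial.eval_X,
    Polynomial.eval_comp, Polynomial.eval_add]
  rw [show q + 1 + ((p + 1 : ℕ) : ℝ) = q + ((p : ℝ) + 2) by push_cast; ring]
  have : ((p + 1).factorial : ℝ) ≠ 0 := by positivity
  field_simp

theorem PowerSeries.mk_pow_eq {c : ℝ → ℕ → ℝ} (h0 : ∀ p, c 0 p = if p = 0 then 1 else 0)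
    (hc : ∀ p q q', ∑ i ∈ Finset.HasAntidiagonal.antidiagonal p, c q i.1 * c q' i.2 = c (q + q') p)
    (q : ℝ) (n : ℕ) : (PowerSeries.mk (c q)) ^ n = PowerSeries.mk (c (n * q)) := by
  induction n with
  | zero => ext p; simp [h0, PowerSeries.coeff_one]
  | succ n ih =>
    rw [pow_succ, ih]
    ext p
    rw [PowerSeries.coeff_mul]
    simp only [PowerSeries.coeff_mk]
    rw [hc]
    congr 1
    push_cast; ring

/-! ### Beta integrals and polar coordinates -/

theorem integrableOn_beta_unit {u v : ℝ} (hu : 0 < u) (hv : 0 < v) :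
    IntegrableOn (fun x : ℝ => x ^ (u - 1) * (1 - x) ^ (v - 1)) (Ioo 0 1) ∧
      ∫ x in Ioo (0 : ℝ) 1, x ^ (u - 1) * (1 - x) ^ (v - 1) = beta u v := by
  have h1 := Complex.betaIntegral_convergent (u := u) (v := v) (by simpa) (by simpa)
  rw [intervalIntegrable_iff_integrableOn_Ioo_of_le zero_le_one] at h1
  have heq : ∀ x ∈ Ioo (0 : ℝ) 1, ((x : ℂ) ^ ((u : ℂ) - 1) * (1 - (x : ℂ)) ^ ((v : ℂ) - 1)) =
      ((x ^ (u - 1) * (1 - x) ^ (v - 1) : ℝ) : ℂ) := by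
    intro x hx
    rw [Complex.ofReal_mul, Complex.ofReal_cpow hx.1.le, Complex.ofReal_cpow (by linarith [hx.2])]
    push_cast; rfl
  have h2 : IntegrableOn (fun x : ℝ => ((x ^ (u - 1) * (1 - x) ^ (v - 1) : ℝ) : ℂ)) (Ioo 0 1) :=
    h1.congr_fun heq measurableSet_Ioo
  refine ⟨by simpa [IntegrableOn] using h2.re, ?_⟩
  rw [beta_eq_betaIntegralReal u v hu hv, Complex.betaIntegral,
    intervalIntegral.integral_of_le zero_le_one, integral_Ioc_eq_integral_Ioo,
    setIntegral_congr_fun measurableSet_Ioo heq, integral_complex_ofReal, Complex.ofReal_re]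

theorem integrableOn_beta {u v s : ℝ} (hu : 0 < u) (hv : 0 < v) (hs : 0 < s) :
    IntegrableOn (fun x : ℝ => x ^ (u - 1) * (s - x) ^ (v - 1)) (Ioo 0 s) ∧
      ∫ x in Ioo (0 : ℝ) s, x ^ (u - 1) * (s - x) ^ (v - 1) = s ^ (u + v - 1) * beta u v := by
  obtain ⟨h1, h2⟩ := integrableOn_beta_unit hu hv
  have heq : ∀ x ∈ Ioo (0 : ℝ) s, s ^ (u + v - 2) * ((s⁻¹ * x) ^ (u - 1) * (1 - s⁻¹ * x) ^ (v - 1)) =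
      x ^ (u - 1) * (s - x) ^ (v - 1) := by
    intro x hx
    have : 1 - s⁻¹ * x = s⁻¹ * (s - x) := by field_simp
    rw [this, Real.mul_rpow (by positivity) hx.1.le, Real.mul_rpow (by positivity)
      (by linarith [hx.2]), Real.inv_rpow hs.le, Real.inv_rpow hs.le,
      show u + v - 2 = (u - 1) + (v - 1) by ring, Real.rpow_add hs]
    have a := Real.rpow_pos_of_pos hs (u - 1)
    have b := Real.rpow_pos_of_pos hs (v - 1)
    field_simp
  have hind : ∀ x : ℝ, (Ioo (0 : ℝ) 1).indicator
      (fun x : ℝ => x ^ (u - 1) * (1 - x) ^ (v - 1)) (s⁻¹ * x) =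
      (Ioo (0 : ℝ) s).indicator
        (fun x => (s⁻¹ * x) ^ (u - 1) * (1 - s⁻¹ * x) ^ (v - 1)) x := by
    intro x
    have : s⁻¹ * x ∈ Ioo (0 : ℝ) 1 ↔ x ∈ Ioo (0 : ℝ) s := by
      simp only [mem_Ioo, inv_mul_lt_iff₀ hs, mul_one]
      refine and_congr_left fun _ => ?_
      constructor
      · intro h; exact pos_of_mul_pos_right h (by positivity)
      · intro h; positivity
    by_cases hx : x ∈ Ioo (0 : ℝ) s
    · rw [indicator_of_mem hx, indicator_of_mem (this.2 hx)]
    · rw [indicator_of_notMem hx, indicator_of_notMem (fun h => hx (this.1 h))]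
  constructor
  · refine IntegrableOn.congr_fun (Integrable.const_mul ?_ (s ^ (u + v - 2))) heq measurableSet_Ioo
    rw [← integrable_indicator_iff measurableSet_Ioo] at h1
    have h3 := h1.comp_mul_left' (inv_ne_zero hs.ne')
    rw [← IntegrableOn, ← integrable_indicator_iff measurableSet_Ioo]
    exact h3.congr (Filter.Eventually.of_forall hind)
  · rw [← setIntegral_congr_fun measurableSet_Ioo heq, integral_const_mul,
      ← integral_indicator measurableSet_Ioo, ← integral_congr_ae (Filter.Eventually.of_forall hind),
      Measure.integral_comp_mul_left, integral_indicator measurableSet_Ioo, h2]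
    rw [inv_inv, abs_of_pos hs, smul_eq_mul, ← mul_assoc, ← Real.rpow_add_one hs.ne']
    ring_nf

section Polar

variable {E : Type*} [NormedAddCommGroup E] [NormedSpace ℝ E] [MeasurableSpace E] [BorelSpace E]
  [FiniteDimensional ℝ E] [Nontrivial E] (μ : Measure E) [μ.IsAddHaarMeasure]

/-- No integrability is assumed: the product formula for Bochner integrals also covers the case
where an integral takes the default value 0. This spares the applications an integrability check. -/
theorem integral_polar_mul (f : ℝ → ℝ) (g : Metric.sphere (0 : E) 1 → ℝ) (h : E → ℝ)
    (hh : ∀ r : ℝ, 0 < r → ∀ θ : Metric.sphere (0 : E) 1, h (r • (θ : E)) = f r * g θ) :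
    ∫ x, h x ∂μ =
      (∫ θ, g θ ∂μ.toSphere) * ∫ r in Ioi (0 : ℝ), r ^ (Module.finrank ℝ E - 1) * f r := by
  have key : ∀ x : ({(0)}ᶜ : Set E),
      h x.1 = (fun p : Metric.sphere (0 : E) 1 × Ioi (0 : ℝ) => g p.1 * f p.2.1)
        (homeomorphUnitSphereProd E x) := by
    intro x
    have h1 := hh (homeomorphUnitSphereProd E x).2.1 (homeomorphUnitSphereProd E x).2.2
      (homeomorphUnitSphereProd E x).1
    have h2 : (homeomorphUnitSphereProd E x).2.1 • ((homeomorphUnitSphereProd E x).1 : E) = x := by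
      have h3 := congrArg Subtype.val ((homeomorphUnitSphereProd E).symm_apply_apply x)
      rw [homeomorphUnitSphereProd_symm_apply_coe] at h3
      exact h3
    rw [h2] at h1
    rw [h1]; ring
  calc
    ∫ x, h x ∂μ = ∫ x : ({(0)}ᶜ : Set E), h x.1 ∂(μ.comap (↑)) := by
      rw [integral_subtype_comap (measurableSet_singleton _).compl fun x ↦ h x,
        restrict_compl_singleton]
    _ = ∫ p, g p.1 * f p.2.1 ∂μ.toSphere.prod (.volumeIoiPow (Module.finrank ℝ E - 1)) := by
      rw [← μ.measurePreserving_homeomorphUnitSphereProd.integral_comp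
        (Homeomorph.measurableEmbedding _)]
      exact integral_congr_ae (Filter.Eventually.of_forall key)
    _ = (∫ θ, g θ ∂μ.toSphere) *
        ∫ x : Ioi (0 : ℝ), f x ∂.volumeIoiPow (Module.finrank ℝ E - 1) :=
      integral_prod_mul g (fun x : Ioi (0 : ℝ) => f x)
    _ = _ := by
      congr 1
      simp only [Measure.volumeIoiPow, ENNReal.ofReal]
      rw [integral_withDensity_eq_integral_smul,
        integral_subtype_comap measurableSet_Ioi fun a ↦
          Real.toNNReal (a ^ (Module.finrank ℝ E - 1)) • f a]
      · refine setIntegral_congr_fun measurableSet_Ioi fun x hx => ?_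
        simp only [NNReal.smul_def, smul_eq_mul]
        rw [Real.coe_toNNReal _ (pow_nonneg (le_of_lt hx) _)]
      · exact (measurable_subtype_coe.pow_const _).real_toNNReal

end Polar

theorem integral_pow_mul_exp_neg_sq (p : ℕ) :
    ∫ r in Ioi (0 : ℝ), r ^ p * Real.exp (-r ^ 2) = Real.Gamma (((p : ℝ) + 1) / 2) / 2 := by
  have h := integral_rpow_mul_exp_neg_mul_rpow (p := 2) (q := p) (b := 1) two_pos
    (by linarith [(Nat.cast_nonneg p : (0 : ℝ) ≤ p)]) one_pos
  rw [Real.one_rpow] at h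
  rw [show Real.Gamma (((p : ℝ) + 1) / 2) / 2 = 1 * (1 / 2) * Real.Gamma (((p : ℝ) + 1) / 2) by ring,
    ← h]
  refine setIntegral_congr_fun measurableSet_Ioi fun x hx => ?_
  simp

theorem integral_pow_mul_exp_neg_sq_univ (p : ℕ) :
    ∫ r : ℝ, r ^ (2 * p) * Real.exp (-r ^ 2) = Real.Gamma ((p : ℝ) + 1 / 2) := by
  have h := integral_comp_abs (f := fun r => r ^ (2 * p) * Real.exp (-r ^ 2))
  simp only [sq_abs, pow_mul] at h
  simp only [pow_mul]
  rw [h]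
  simp only [← pow_mul]
  rw [integral_pow_mul_exp_neg_sq]
  push_cast
  rw [show ((2 : ℝ) * p + 1) / 2 = p + 1 / 2 by ring]; ring

instance (d : ℕ) [NeZero d] : Nontrivial (EucSpace d) := by
  have : Nonempty (Fin d) := ⟨0⟩
  infer_instance

/-- By rotation invariance ξ may be turned into a multiple of the coordinate vector of index 0, and
the integral splits into one-dimensional factors. -/
theorem integral_gaussian_mul_inner_pow (d : ℕ) [NeZero d] (p : ℕ) (ξ : EucSpace d) :
    ∫ x : EucSpace d, Real.exp (-‖x‖ ^ 2) * inner ℝ x ξ ^ (2 * p) =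
      ‖ξ‖ ^ (2 * p) * (Real.Gamma ((p : ℝ) + 1 / 2) * √Real.pi ^ (d - 1)) := by
  obtain ⟨e, he, hξ⟩ : ∃ e : EucSpace d, ‖e‖ = 1 ∧ ξ = ‖ξ‖ • e := by
    by_cases h : ξ = 0
    · obtain ⟨e, he⟩ := exists_norm_eq (EucSpace d) (zero_le_one (α := ℝ))
      exact ⟨e, he, by simp [h]⟩
    · refine ⟨‖ξ‖⁻¹ • ξ, norm_smul_inv_norm h, ?_⟩
      rw [smul_smul, mul_inv_cancel₀ (norm_ne_zero_iff.2 h), one_smul]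
  obtain ⟨b, hb⟩ := Orthonormal.exists_orthonormalBasis_extension_of_card_eq (𝕜 := ℝ)
    (E := EucSpace d) (ι := Fin d) (by simp) (v := fun _ => e) (s := {0})
    (by
      constructor
      · intro i; simpa using he
      · intro i j hij; exact absurd (Subsingleton.elim i j) hij)
  have hb0 : b 0 = e := hb 0 (by simp)
  have h1 : ∀ x : EucSpace d, Real.exp (-‖x‖ ^ 2) * inner ℝ x ξ ^ (2 * p) =
      (fun y : EucSpace d => ‖ξ‖ ^ (2 * p) * (Real.exp (-‖y‖ ^ 2) * y 0 ^ (2 * p))) (b.repr x) := by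
    intro x
    simp only [LinearIsometryEquiv.norm_map]
    rw [b.repr_apply_apply, hb0]
    conv_lhs => rw [hξ]
    rw [real_inner_smul_right, real_inner_comm, mul_pow]; ring
  rw [integral_congr_ae (Filter.Eventually.of_forall h1),
    (b.measurePreserving_repr).integral_comp (b.repr.toHomeomorph.measurableEmbedding)
      (fun y : EucSpace d => ‖ξ‖ ^ (2 * p) * (Real.exp (-‖y‖ ^ 2) * y 0 ^ (2 * p))),
    integral_const_mul]
  congr 1
  have h2 : ∀ y : EucSpace d, Real.exp (-‖y‖ ^ 2) * y 0 ^ (2 * p) =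
      (fun z : Fin d → ℝ => ∏ i, (if i = 0 then z i ^ (2 * p) else 1) * Real.exp (- z i ^ 2))
        (WithLp.ofLp y) := by
    intro y
    simp only [Finset.prod_mul_distrib, Finset.prod_ite_eq', Finset.mem_univ, if_true]
    rw [← Real.exp_sum, Finset.sum_neg_distrib, EuclideanSpace.real_norm_sq_eq]
    ring
  rw [integral_congr_ae (Filter.Eventually.of_forall h2),
    (PiLp.volume_preserving_ofLp (Fin d)).integral_comp
      (MeasurableEquiv.toLp 2 (Fin d → ℝ)).symm.measurableEmbedding
      (fun z : Fin d → ℝ => ∏ i, (if i = 0 then z i ^ (2 * p) else 1) * Real.exp (- z i ^ 2)),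
    integral_fintype_prod_volume_eq_prod
      (fun i (z : ℝ) => (if i = 0 then z ^ (2 * p) else 1) * Real.exp (- z ^ 2)),
    ← Finset.mul_prod_erase _ _ (Finset.mem_univ (0 : Fin d))]
  simp only [if_true]
  rw [integral_pow_mul_exp_neg_sq_univ]
  congr 1
  rw [Finset.prod_congr rfl (g := fun _ => √Real.pi)]
  · simp
  · intro i hi
    have := integral_gaussian 1
    simp only [neg_mul, one_mul, div_one] at this
    simp [Finset.ne_of_mem_erase hi, this]

/-! ### Moments determine compactly supported measures -/

/-- The exponential series may be integrated term by term because its p-th term is bounded by the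
constant (R‖ξ‖)^p / p!. -/
theorem hasSum_charFun_of_bounded {E : Type*} [NormedAddCommGroup E] [InnerProductSpace ℝ E]
    [MeasurableSpace E] [BorelSpace E] [SecondCountableTopology E] (μ : Measure E)
    [IsFiniteMeasure μ] {R : ℝ} (hR : ∀ᵐ x ∂μ, ‖x‖ ≤ R) (ξ : E) :
    HasSum (fun p : ℕ => (Complex.I ^ p / (p.factorial : ℂ)) * ((∫ x, inner ℝ x ξ ^ p ∂μ : ℝ) : ℂ))
      (charFun μ ξ) := by
  rw [charFun_apply]
  have hterm : ∀ p : ℕ, (Complex.I ^ p / (p.factorial : ℂ)) *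
      ((∫ x, inner ℝ x ξ ^ p ∂μ : ℝ) : ℂ) =
      ∫ x, (((inner ℝ x ξ : ℝ) : ℂ) * Complex.I) ^ p / (p.factorial : ℂ) ∂μ := by
    intro p
    rw [← integral_complex_ofReal, ← integral_const_mul]
    refine integral_congr_ae (Filter.Eventually.of_forall fun x => ?_)
    simp only [mul_pow]
    push_cast
    ring
  simp_rw [hterm]
  refine hasSum_integral_of_dominated_convergence
    (fun p _ => (R * ‖ξ‖) ^ p / (p.factorial : ℝ)) ?_ ?_ ?_ ?_ ?_
  · intro p
    refine Measurable.aestronglyMeasurable ?_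
    fun_prop
  · intro p
    filter_upwards [hR] with x hx
    rw [norm_div, norm_pow, norm_mul, Complex.norm_I, mul_one, Complex.norm_real,
      Complex.norm_natCast]
    gcongr
    exact (norm_inner_le_norm x ξ).trans (by gcongr)
  · exact Filter.Eventually.of_forall fun _ => Real.summable_pow_div_factorial _
  · exact integrable_const _
  · refine Filter.Eventually.of_forall fun x => ?_
    rw [Complex.exp_eq_exp_ℂ]
    exact NormedSpace.expSeries_div_hasSum_exp _

theorem MeasureTheory.Measure.ext_of_moments {E : Type*} [NormedAddCommGroup E]
    [InnerProductSpace ℝ E] [MeasurableSpace E] [BorelSpace E] [SecondCountableTopology E]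
    [CompleteSpace E] (μ ν : Measure E) [IsFiniteMeasure μ] [IsFiniteMeasure ν] {R R' : ℝ}
    (hR : ∀ᵐ x ∂μ, ‖x‖ ≤ R) (hR' : ∀ᵐ x ∂ν, ‖x‖ ≤ R')
    (h : ∀ (ξ : E) (p : ℕ), ∫ x, inner ℝ x ξ ^ p ∂μ = ∫ x, inner ℝ x ξ ^ p ∂ν) : μ = ν := by
  refine Measure.ext_of_charFun (funext fun ξ => ?_)
  have h1 := hasSum_charFun_of_bounded μ hR ξ
  simp_rw [h] at h1
  exact h1.unique (hasSum_charFun_of_bounded ν hR' ξ)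

/-! ### Moments of the uniform distribution on the sphere -/

/-- The Gaussian integral of ⟨x, ξ⟩^(2p) is computed in Cartesian and in polar coordinates; the
spherical moment is what the comparison leaves. -/
theorem integral_toSphere_inner_pow_even (d : ℕ) [NeZero d] (p : ℕ) (ξ : EucSpace d) :
    (∫ θ : Metric.sphere (0 : EucSpace d) 1, inner ℝ (θ : EucSpace d) ξ ^ (2 * p)
      ∂(volume : Measure (EucSpace d)).toSphere) * (Real.Gamma ((d : ℝ) / 2 + p) / 2) =
      ‖ξ‖ ^ (2 * p) * (Real.Gamma ((p : ℝ) + 1 / 2) * √Real.pi ^ (d - 1)) := by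
  rw [← integral_gaussian_mul_inner_pow, integral_polar_mul (volume : Measure (EucSpace d))
    (fun r => Real.exp (-r ^ 2) * r ^ (2 * p))
    (fun θ => inner ℝ (θ : EucSpace d) ξ ^ (2 * p))]
  · congr 1
    have hd : 1 ≤ d := NeZero.one_le
    rw [finrank_euclideanSpace_fin]
    have h := integral_pow_mul_exp_neg_sq (d - 1 + 2 * p)
    rw [show (((d - 1 + 2 * p : ℕ) : ℝ) + 1) / 2 = (d : ℝ) / 2 + p by
      push_cast [Nat.cast_sub hd]; ring] at h
    rw [← h]
    refine setIntegral_congr_fun measurableSet_Ioi fun x hx => ?_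
    simp only [pow_add]; ring
  · intro r hr θ
    rw [norm_smul, norm_eq_of_mem_sphere θ, real_inner_smul_left, Real.norm_of_nonneg hr.le]
    ring_nf

/-- Reflection kills the Gaussian integral, and in its polar form the radial factor is positive. -/
theorem integral_toSphere_inner_pow_odd (d : ℕ) [NeZero d] (p : ℕ) (hp : Odd p)
    (ξ : EucSpace d) :
    ∫ θ : Metric.sphere (0 : EucSpace d) 1, inner ℝ (θ : EucSpace d) ξ ^ p
      ∂(volume : Measure (EucSpace d)).toSphere = 0 := by
  have hd : 1 ≤ d := NeZero.one_le
  have h1 := integral_polar_mul (volume : Measure (EucSpace d))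
    (fun r => Real.exp (-r ^ 2) * r ^ p)
    (fun θ => inner ℝ (θ : EucSpace d) ξ ^ p)
    (fun x => Real.exp (-‖x‖ ^ 2) * inner ℝ x ξ ^ p) (by
      intro r hr θ
      rw [norm_smul, norm_eq_of_mem_sphere θ, real_inner_smul_left, Real.norm_of_nonneg hr.le]
      ring_nf)
  have h2 : ∫ x : EucSpace d, Real.exp (-‖x‖ ^ 2) * inner ℝ x ξ ^ p = 0 := by
    have h3 := integral_neg_eq_self (fun x : EucSpace d => Real.exp (-‖x‖ ^ 2) * inner ℝ x ξ ^ p)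
      volume
    simp only [norm_neg, inner_neg_left, hp.neg_pow, mul_neg, integral_neg] at h3
    linarith
  rw [h2, finrank_euclideanSpace_fin] at h1
  have h3 := integral_pow_mul_exp_neg_sq (d - 1 + p)
  have h4 : ∫ r in Ioi (0 : ℝ), r ^ (d - 1) * (Real.exp (-r ^ 2) * r ^ p) ≠ 0 := by
    rw [setIntegral_congr_fun (g := fun r => r ^ (d - 1 + p) * Real.exp (-r ^ 2))
      measurableSet_Ioi (fun x _ => by simp only [pow_add]; ring), h3]
    have : 0 < Real.Gamma ((((d - 1 + p : ℕ) : ℝ) + 1) / 2) :=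
      Real.Gamma_pos_of_pos (by positivity)
    positivity
  exact (mul_eq_zero.1 h1.symm).resolve_right h4

theorem toSphere_real_univ (d : ℕ) [NeZero d] :
    (volume : Measure (EucSpace d)).toSphere.real univ * (Real.Gamma ((d : ℝ) / 2) / 2) =
      Real.pi ^ ((d : ℝ) / 2) := by
  have hd : 1 ≤ d := NeZero.one_le
  have h := integral_toSphere_inner_pow_even d 0 0
  simp only [mul_zero, pow_zero, Nat.cast_zero, add_zero, zero_add, one_mul, integral_const,
    smul_eq_mul, mul_one, Real.Gamma_one_half_eq] at h
  rw [h, ← pow_succ', Nat.sub_add_cancel hd, Real.sqrt_eq_rpow, ← Real.rpow_mul_natCast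
    Real.pi_pos.le]
  congr 1; ring

theorem toSphere_real_univ_pos (d : ℕ) [NeZero d] :
    0 < (volume : Measure (EucSpace d)).toSphere.real univ := by
  have h := toSphere_real_univ d
  have hd : (0 : ℝ) < d := by exact_mod_cast (NeZero.pos d)
  have : 0 < Real.Gamma ((d : ℝ) / 2) := Real.Gamma_pos_of_pos (by positivity)
  have h2 : 0 < Real.pi ^ ((d : ℝ) / 2) := by positivity
  rw [← h] at h2
  exact pos_of_mul_pos_left h2 (by positivity)

instance (d : ℕ) [NeZero d] : IsProbabilityMeasure (sphereUniform d) := by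
  constructor
  rw [sphereUniform, Measure.smul_apply, smul_eq_mul]
  refine ENNReal.inv_mul_cancel ?_ (measure_ne_top _ _)
  intro h
  have := toSphere_real_univ_pos d
  simp [Measure.real, h] at this

theorem integral_sphereUniform (d : ℕ) (f : Metric.sphere (0 : EucSpace d) 1 → ℝ) :
    ∫ θ, f θ ∂sphereUniform d = ((volume : Measure (EucSpace d)).toSphere.real univ)⁻¹ *
      ∫ θ, f θ ∂(volume : Measure (EucSpace d)).toSphere := by
  rw [sphereUniform, integral_smul_measure, smul_eq_mul, ENNReal.toReal_inv]
  rfl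

theorem integral_sphereUniform_inner_pow_even (d : ℕ) [NeZero d] (p : ℕ) (ξ : EucSpace d) :
    ∫ θ, inner ℝ (θ : EucSpace d) ξ ^ (2 * p) ∂sphereUniform d =
      ‖ξ‖ ^ (2 * p) *
        ((ascPochhammer ℝ p).eval (1 / 2) / (ascPochhammer ℝ p).eval ((d : ℝ) / 2)) := by
  have hd : (0 : ℝ) < (d : ℝ) / 2 := by
    have : (0 : ℝ) < d := by exact_mod_cast (NeZero.pos d)
    positivity
  rw [integral_sphereUniform]
  have h1 := integral_toSphere_inner_pow_even d p ξ
  have h0 := integral_toSphere_inner_pow_even d 0 0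
  have h3 := toSphere_real_univ_pos d
  simp only [mul_zero, pow_zero, Nat.cast_zero, add_zero, zero_add, one_mul, integral_const,
    smul_eq_mul, mul_one] at h0
  have h5 : Real.Gamma ((p : ℝ) + 1 / 2) =
      (ascPochhammer ℝ p).eval (1 / 2) * Real.Gamma (1 / 2) := by
    rw [← Gamma_add_natCast (by norm_num), add_comm]
  rw [Gamma_add_natCast hd, h5] at h1
  have h6 := ascPochhammer_eval_pos hd p
  have h7 : 0 < Real.Gamma ((d : ℝ) / 2) := Real.Gamma_pos_of_pos hd
  have h8 : (∫ θ : Metric.sphere (0 : EucSpace d) 1, inner ℝ (θ : EucSpace d) ξ ^ (2 * p)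
      ∂(volume : Measure (EucSpace d)).toSphere) * (ascPochhammer ℝ p).eval ((d : ℝ) / 2) =
      ‖ξ‖ ^ (2 * p) * (ascPochhammer ℝ p).eval (1 / 2) *
        (volume : Measure (EucSpace d)).toSphere.real univ := by
    have h9 : Real.Gamma ((d : ℝ) / 2) / 2 ≠ 0 := by positivity
    apply mul_right_cancel₀ h9
    rw [mul_assoc, mul_assoc, h0]
    linear_combination h1
  field_simp
  linear_combination h8

theorem integral_sphereUniform_inner_pow_odd (d : ℕ) [NeZero d] (p : ℕ) (hp : Odd p)
    (ξ : EucSpace d) : ∫ θ, inner ℝ (θ : EucSpace d) ξ ^ p ∂sphereUniform d = 0 := by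
  rw [integral_sphereUniform, integral_toSphere_inner_pow_odd d p hp, mul_zero]

/-! ### Moments of the Barenblatt profile -/

/-- The substitution y = r² produces a Beta integral on (0, R²). -/
theorem integral_pow_mul_profile {u ν R : ℝ} (hu : 0 < u) (hν : 0 < ν) (hR : 0 < R) :
    ∫ r in Ioi (0 : ℝ), r ^ (2 * u - 1) * (max (1 - r ^ 2 / R ^ 2) 0) ^ ν =
      R ^ (2 * u) * beta u (ν + 1) / 2 := by
  have h1 := integral_comp_rpow_Ioi_of_pos (p := 2) two_pos
    (g := fun y : ℝ => 1 / 2 * (y ^ (u - 1) * (max (1 - y / R ^ 2) 0) ^ ν))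
  have h2 : ∫ r in Ioi (0 : ℝ), r ^ (2 * u - 1) * (max (1 - r ^ 2 / R ^ 2) 0) ^ ν =
      ∫ x in Ioi (0 : ℝ), (2 * x ^ ((2 : ℝ) - 1)) •
        (1 / 2 * ((x ^ (2 : ℝ)) ^ (u - 1) * (max (1 - x ^ (2 : ℝ) / R ^ 2) 0) ^ ν)) := by
    refine setIntegral_congr_fun measurableSet_Ioi fun x (hx : 0 < x) => ?_
    simp only [smul_eq_mul]
    rw [← Real.rpow_mul hx.le, Real.rpow_two, show 2 * u - 1 = (2 - 1) + 2 * (u - 1) by ring,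
      Real.rpow_add hx]
    ring
  rw [h2, h1, integral_const_mul]
  have hR2 : 0 < R ^ 2 := by positivity
  obtain ⟨_, h3⟩ := integrableOn_beta (u := u) (v := ν + 1) hu (by linarith) hR2
  have h4 : ∫ y in Ioi (0 : ℝ), y ^ (u - 1) * (max (1 - y / R ^ 2) 0) ^ ν =
      ∫ y in Ioo 0 (R ^ 2), (R ^ 2) ^ (-ν) * (y ^ (u - 1) * (R ^ 2 - y) ^ (ν + 1 - 1)) := by
    rw [setIntegral_eq_of_subset_of_forall_sdiff_eq_zero measurableSet_Ioi
      (s := Ioo 0 (R ^ 2)) (fun x hx => hx.1)]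
    · refine setIntegral_congr_fun measurableSet_Ioo fun y hy => ?_
      have h5 : 1 - y / R ^ 2 = (R ^ 2)⁻¹ * (R ^ 2 - y) := by field_simp
      rw [max_eq_left (by rw [h5]; exact mul_nonneg (by positivity) (by linarith [hy.2])), h5,
        Real.mul_rpow (by positivity) (by linarith [hy.2]), Real.inv_rpow hR2.le,
        Real.rpow_neg hR2.le, add_sub_cancel_right]
      ring
    · intro y hy
      have h6 : R ^ 2 ≤ y := by
        by_contra h
        exact hy.2 ⟨hy.1, not_le.1 h⟩
      rw [max_eq_right (by rw [sub_nonpos, one_le_div hR2]; exact h6), Real.zero_rpow hν.ne',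
        mul_zero]
  rw [h4, integral_const_mul, h3, ← mul_assoc ((R ^ 2) ^ (-ν)), ← Real.rpow_add hR2,
    ← Real.rpow_two, ← Real.rpow_mul hR.le]
  rw [show 2 * (-ν + (u + (ν + 1) - 1)) = 2 * u by ring]
  ring

/-- The profile `K (1 - ‖x‖² / R²)₊^ν`. -/
noncomputable def ballProfile {d : ℕ} (K ν R : ℝ) (x : EucSpace d) : ℝ :=
  K * (max (1 - ‖x‖ ^ 2 / R ^ 2) 0) ^ ν

section BallProfile

variable {d : ℕ} {K ν R : ℝ}

theorem continuous_ballProfile (hν : 0 < ν) : Continuous (ballProfile (d := d) K ν R) := by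
  unfold ballProfile
  refine continuous_const.mul (Continuous.rpow_const (by fun_prop) fun x => Or.inr hν.le)

theorem ballProfile_nonneg (hK : 0 ≤ K) (x : EucSpace d) : 0 ≤ ballProfile K ν R x :=
  mul_nonneg hK (Real.rpow_nonneg (le_max_right _ _) _)

theorem ballProfile_eq_zero (hν : 0 < ν) (hR : 0 < R) {x : EucSpace d} (hx : R ≤ ‖x‖) :
    ballProfile K ν R x = 0 := by
  rw [ballProfile, max_eq_right, Real.zero_rpow hν.ne', mul_zero]
  rw [sub_nonpos, one_le_div (by positivity)]
  gcongr

theorem hasCompactSupport_ballProfile (hν : 0 < ν) (hR : 0 < R) :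
    HasCompactSupport (ballProfile (d := d) K ν R) :=
  HasCompactSupport.intro (isCompact_closedBall 0 R) fun x hx => by
    refine ballProfile_eq_zero hν hR ?_
    simp only [Metric.mem_closedBall, dist_zero_right, not_le] at hx
    exact hx.le

theorem integrable_ballProfile (hν : 0 < ν) (hR : 0 < R) :
    Integrable (ballProfile (d := d) K ν R) :=
  (continuous_ballProfile hν).integrable_of_hasCompactSupport (hasCompactSupport_ballProfile hν hR)

/-- The measure on `ℝ^d` with density `ballProfile K ν R`. -/
noncomputable def ballMeasure (d : ℕ) (K ν R : ℝ) : Measure (EucSpace d) :=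
  volume.withDensity (fun x => ENNReal.ofReal (ballProfile K ν R x))

theorem isFiniteMeasure_ballMeasure (hν : 0 < ν) (hR : 0 < R) :
    IsFiniteMeasure (ballMeasure d K ν R) :=
  isFiniteMeasure_withDensity_ofReal (integrable_ballProfile hν hR).2

theorem norm_le_ae_ballMeasure (hν : 0 < ν) (hR : 0 < R) :
    ∀ᵐ x ∂ballMeasure d K ν R, ‖x‖ ≤ R := by
  rw [ballMeasure, ae_withDensity_iff (continuous_ballProfile hν).measurable.ennreal_ofReal]
  refine Filter.Eventually.of_forall fun x hx => ?_
  by_contra h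
  exact hx (by rw [ballProfile_eq_zero hν hR (not_le.1 h).le, ENNReal.ofReal_zero])

theorem integral_ballMeasure (hK : 0 ≤ K) (hν : 0 < ν) (f : EucSpace d → ℝ) :
    ∫ x, f x ∂ballMeasure d K ν R = ∫ x, ballProfile K ν R x * f x := by
  rw [ballMeasure, integral_withDensity_eq_integral_toReal_smul
    (continuous_ballProfile hν).measurable.ennreal_ofReal
    (Filter.Eventually.of_forall fun _ => ENNReal.ofReal_lt_top)]
  refine integral_congr_ae (Filter.Eventually.of_forall fun x => ?_)
  simp only [smul_eq_mul]
  rw [ENNReal.toReal_ofReal (ballProfile_nonneg hK x)]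

theorem integral_ballProfile_mul_inner_pow [NeZero d] (ξ : EucSpace d) (p : ℕ) :
    ∫ x : EucSpace d, ballProfile K ν R x * inner ℝ x ξ ^ p =
      (∫ θ : Metric.sphere (0 : EucSpace d) 1, inner ℝ (θ : EucSpace d) ξ ^ p
        ∂(volume : Measure (EucSpace d)).toSphere) *
      (K * ∫ r in Ioi (0 : ℝ), r ^ (2 * ((d : ℝ) / 2 + p / 2) - 1) *
        (max (1 - r ^ 2 / R ^ 2) 0) ^ ν) := by
  have hd : 1 ≤ d := NeZero.one_le
  rw [integral_polar_mul (volume : Measure (EucSpace d))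
    (fun r => K * (max (1 - r ^ 2 / R ^ 2) 0) ^ ν * r ^ p)
    (fun θ => inner ℝ (θ : EucSpace d) ξ ^ p)]
  · congr 1
    rw [finrank_euclideanSpace_fin, ← integral_const_mul]
    refine setIntegral_congr_fun measurableSet_Ioi fun x hx => ?_
    rw [show 2 * ((d : ℝ) / 2 + p / 2) - 1 = ((d - 1 + p : ℕ) : ℝ) by
      push_cast [Nat.cast_sub hd]; ring, Real.rpow_natCast, pow_add]
    ring
  · intro r hr θ
    rw [ballProfile, norm_smul, norm_eq_of_mem_sphere θ, real_inner_smul_left,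
      Real.norm_of_nonneg hr.le, mul_one]
    ring

theorem integral_ballMeasure_inner_pow_odd [NeZero d] (hK : 0 ≤ K) (hν : 0 < ν)
    (ξ : EucSpace d) {p : ℕ} (hp : Odd p) :
    ∫ x, inner ℝ x ξ ^ p ∂ballMeasure d K ν R = 0 := by
  rw [integral_ballMeasure hK hν, integral_ballProfile_mul_inner_pow ξ p,
    integral_toSphere_inner_pow_odd d p hp, zero_mul]

/-- The radial Beta integral contributes Γ(d/2 + p) / Γ(d/2 + ν + 1 + p), and Γ(d/2 + p) cancels
against the spherical moment. Only the rising factorial of d/2 + ν + 1 survives; this is the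
parameter b that the flight has to reproduce. -/
theorem integral_ballMeasure_inner_pow_even [NeZero d] (hν : 0 < ν) (hR : 0 < R)
    (hK : K = Real.Gamma ((d : ℝ) / 2 + ν + 1) /
      (Real.pi ^ ((d : ℝ) / 2) * Real.Gamma (ν + 1) * R ^ d)) (ξ : EucSpace d) (p : ℕ) :
    ∫ x, inner ℝ x ξ ^ (2 * p) ∂ballMeasure d K ν R =
      (R * ‖ξ‖) ^ (2 * p) * ((ascPochhammer ℝ p).eval (1 / 2) /
        (ascPochhammer ℝ p).eval ((d : ℝ) / 2 + ν + 1)) := by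
  have hd : (0 : ℝ) < d := by exact_mod_cast (NeZero.pos d)
  have g1 : 0 < Real.Gamma ((d : ℝ) / 2 + ν + 1) := Real.Gamma_pos_of_pos (by positivity)
  have g2 : 0 < Real.Gamma (ν + 1) := Real.Gamma_pos_of_pos (by positivity)
  have g3 : 0 < Real.Gamma ((d : ℝ) / 2) := Real.Gamma_pos_of_pos (by positivity)
  have hK0 : 0 ≤ K := by rw [hK]; positivity
  rw [integral_ballMeasure hK0 hν, integral_ballProfile_mul_inner_pow ξ _]
  have e1 : (((2 * p : ℕ) : ℝ)) / 2 = p := by push_cast; ring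
  rw [e1, integral_pow_mul_profile (by positivity) hν hR]
  have h1 := integral_toSphere_inner_pow_even d p ξ
  have h5 : Real.Gamma ((p : ℝ) + 1 / 2) =
      (ascPochhammer ℝ p).eval (1 / 2) * √Real.pi := by
    rw [← Real.Gamma_one_half_eq, ← Gamma_add_natCast (by norm_num), add_comm]
  have hpi : √Real.pi * √Real.pi ^ (d - 1) = Real.pi ^ ((d : ℝ) / 2) := by
    rw [← pow_succ', Nat.sub_add_cancel NeZero.one_le, Real.sqrt_eq_rpow,
      ← Real.rpow_mul_natCast Real.pi_pos.le]
    ring_nf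
  have e2 : (d : ℝ) / 2 + p + (ν + 1) = ((d : ℝ) / 2 + ν + 1) + p := by ring
  have e3 : R ^ (2 * ((d : ℝ) / 2 + p)) = R ^ d * R ^ (2 * p) := by
    rw [← pow_add, ← Real.rpow_natCast]
    congr 1
    push_cast; ring
  rw [beta, e2, e3, Gamma_add_natCast (q := (d : ℝ) / 2 + ν + 1) (by positivity), hK]
  rw [h5, mul_assoc _ (√Real.pi), hpi] at h1
  have h6 := ascPochhammer_eval_pos (q := (d : ℝ) / 2 + ν + 1) (by positivity) p
  have h7 : 0 < Real.pi ^ ((d : ℝ) / 2) := by positivity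
  have h8 : 0 < Real.Gamma ((d : ℝ) / 2 + p) := Real.Gamma_pos_of_pos (by positivity)
  have hRd : R ^ d ≠ 0 := by positivity
  set I := ∫ θ : Metric.sphere (0 : EucSpace d) 1, inner ℝ (θ : EucSpace d) ξ ^ (2 * p)
      ∂(volume : Measure (EucSpace d)).toSphere
  rw [mul_pow]
  generalize (ascPochhammer ℝ p).eval ((d : ℝ) / 2 + ν + 1) = A at *
  generalize Real.Gamma ((d : ℝ) / 2 + ν + 1) = B at *
  generalize Real.Gamma ((d : ℝ) / 2 + p) = B' at *
  field_simp
  linear_combination h1 * 2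

end BallProfile

/-! ### Dirichlet integrals -/

theorem cons_mem_renewalSimplex {n : ℕ} {s x₀ : ℝ} {x : Fin n → ℝ} :
    (Fin.cons x₀ x : Fin (n + 1) → ℝ) ∈ renewalSimplex (n + 1) s ↔
      x₀ ∈ Ioo 0 s ∧ x ∈ renewalSimplex n (s - x₀) := by
  simp only [renewalSimplex, mem_ofPred_eq, Fin.forall_fin_succ, Finset.sum_filter,
    Fin.sum_univ_succ, Fin.cons_zero, Fin.cons_succ, mem_Ioo]
  simp [Fin.succ_lt_succ_iff, sub_sub]

theorem measurableSet_renewalSimplex (n : ℕ) (s : ℝ) : MeasurableSet (renewalSimplex n s) := by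
  simp only [renewalSimplex, ofPred_forall]
  refine MeasurableSet.iInter fun j => ?_
  refine (measurableSet_lt measurable_const (measurable_pi_apply j)).inter
    (measurableSet_lt (measurable_pi_apply j) ?_)
  fun_prop

/-- The unnormalized Dirichlet density with exponents `q`. -/
noncomputable def dirichletKernel (n : ℕ) (q : Fin (n + 1) → ℝ) (s : ℝ) : (Fin n → ℝ) → ℝ :=
  (renewalSimplex n s).indicator fun x =>
    (∏ j, x j ^ (q j.castSucc - 1)) * (s - ∑ j, x j) ^ (q (Fin.last n) - 1)

theorem dirichletKernel_cons {n : ℕ} (q : Fin (n + 2) → ℝ) (s x₀ : ℝ) (x : Fin n → ℝ) :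
    dirichletKernel (n + 1) q s (Fin.cons x₀ x) =
      (Ioo 0 s).indicator (fun y => y ^ (q 0 - 1)) x₀ *
        dirichletKernel n (Fin.tail q) (s - x₀) x := by
  by_cases h0 : x₀ ∈ Ioo 0 s
  · by_cases h1 : x ∈ renewalSimplex n (s - x₀)
    · rw [dirichletKernel, dirichletKernel, indicator_of_mem (cons_mem_renewalSimplex.2 ⟨h0, h1⟩),
        indicator_of_mem h0, indicator_of_mem h1]
      simp only [Fin.prod_univ_succ, Fin.sum_univ_succ, Fin.cons_zero, Fin.cons_succ, Fin.tail,
        Fin.castSucc_zero, Fin.succ_castSucc, Fin.succ_last, sub_sub]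
      ring
    · rw [dirichletKernel, dirichletKernel, indicator_of_notMem
        (fun h => h1 (cons_mem_renewalSimplex.1 h).2), indicator_of_notMem h1, mul_zero]
  · rw [dirichletKernel, indicator_of_notMem
        (fun h => h0 (cons_mem_renewalSimplex.1 h).1), indicator_of_notMem h0, zero_mul]

theorem measurable_dirichletKernel (n : ℕ) (q : Fin (n + 1) → ℝ) (s : ℝ) :
    Measurable (dirichletKernel n q s) := by
  refine Measurable.indicator ?_ (measurableSet_renewalSimplex n s)
  fun_prop

theorem sum_lt_of_mem_renewalSimplex {n : ℕ} {s : ℝ} {x : Fin n → ℝ} (hs : 0 < s)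
    (hx : x ∈ renewalSimplex n s) : ∑ j, x j < s := by
  rcases n with _ | n
  · simpa using hs
  · have h := (hx (Fin.last n)).2
    rw [Fin.sum_univ_castSucc]
    have : ∑ i ∈ Finset.univ.filter (fun i : Fin (n + 1) => i < Fin.last n), x i =
        ∑ i : Fin n, x i.castSucc := by
      rw [Finset.sum_filter, Fin.sum_univ_castSucc]
      simp [Fin.castSucc_lt_last]
    rw [this] at h
    linarith

theorem dirichletKernel_nonneg {n : ℕ} (q : Fin (n + 1) → ℝ) {s : ℝ} (hs : 0 < s)
    (x : Fin n → ℝ) : 0 ≤ dirichletKernel n q s x := by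
  refine indicator_nonneg (fun x hx => ?_) x
  have h1 := sum_lt_of_mem_renewalSimplex hs hx
  exact mul_nonneg (Finset.prod_nonneg fun j _ => Real.rpow_nonneg (hx j).1.le _)
    (Real.rpow_nonneg (by linarith) _)

/-- Peeling off the first coordinate leaves a kernel with horizon s - x₀, and then a Beta integral
in x₀. The exponents may differ from one another because a monomial in the gaps shifts each of them
separately. -/
theorem integral_dirichletKernel (n : ℕ) (q : Fin (n + 1) → ℝ) (hq : ∀ i, 0 < q i) {s : ℝ}
    (hs : 0 < s) :
    Integrable (dirichletKernel n q s) ∧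
      ∫ x, dirichletKernel n q s x =
        s ^ (∑ i, q i - 1) * ((∏ i, Real.Gamma (q i)) / Real.Gamma (∑ i, q i)) := by
  induction n generalizing s with
  | zero =>
    have h1 : dirichletKernel 0 q s = fun _ => s ^ (q 0 - 1) := by
      ext x
      rw [dirichletKernel, indicator_of_mem (by intro j; exact j.elim0)]
      simp
    have : IsProbabilityMeasure (volume : Measure (Fin 0 → ℝ)) := by
      constructor; simp [volume_pi]
    rw [h1]
    refine ⟨integrable_const _, ?_⟩
    have := (Real.Gamma_pos_of_pos (hq 0)).ne'
    simp [this]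
  | succ n ih =>
    have hq' : ∀ i, 0 < Fin.tail q i := fun i => hq i.succ
    have mp := (volume_preserving_piFinSuccAbove (fun _ : Fin (n + 1) => ℝ) 0).symm
    set e := (MeasurableEquiv.piFinSuccAbove (fun _ : Fin (n + 1) => ℝ) 0).symm
    have he : ∀ z : ℝ × (Fin n → ℝ), dirichletKernel (n + 1) q s (e z) =
        (Ioo 0 s).indicator (fun y => y ^ (q 0 - 1)) z.1 *
          dirichletKernel n (Fin.tail q) (s - z.1) z.2 := by
      intro z
      rw [← dirichletKernel_cons]
      congr 1
      simp [e, MeasurableEquiv.piFinSuccAbove, Fin.consEquiv]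
    set Q := ∑ i, Fin.tail q i with hQ
    have hQpos : 0 < Q := Finset.sum_pos (fun i _ => hq' i) Finset.univ_nonempty
    set c := (∏ i, Real.Gamma (Fin.tail q i)) / Real.Gamma Q with hc
    have inner_eq : ∀ y : ℝ, ∫ x, (Ioo 0 s).indicator (fun y => y ^ (q 0 - 1)) y *
        dirichletKernel n (Fin.tail q) (s - y) x =
        (Ioo 0 s).indicator (fun y => (y ^ (q 0 - 1) * (s - y) ^ (Q - 1)) * c) y := by
      intro y
      by_cases hy : y ∈ Ioo 0 s
      · rw [integral_const_mul, (ih (Fin.tail q) hq' (by linarith [hy.2])).2,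
          indicator_of_mem hy, indicator_of_mem hy]
        ring
      · simp [indicator_of_notMem hy]
    obtain ⟨hb1, hb2⟩ := integrableOn_beta (hq 0) hQpos hs
    have hmeas : Measurable fun z : ℝ × (Fin n → ℝ) =>
        (Ioo 0 s).indicator (fun y => y ^ (q 0 - 1)) z.1 *
          dirichletKernel n (Fin.tail q) (s - z.1) z.2 := by
      have h := (measurable_dirichletKernel (n + 1) q s).comp e.measurable
      rwa [show dirichletKernel (n + 1) q s ∘ e = _ from funext he] at h
    have hnonneg : ∀ z : ℝ × (Fin n → ℝ), 0 ≤
        (Ioo 0 s).indicator (fun y => y ^ (q 0 - 1)) z.1 *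
          dirichletKernel n (Fin.tail q) (s - z.1) z.2 := fun z => by
      rw [← he]; exact dirichletKernel_nonneg q hs _
    have hint : Integrable (fun z : ℝ × (Fin n → ℝ) =>
        (Ioo 0 s).indicator (fun y => y ^ (q 0 - 1)) z.1 *
          dirichletKernel n (Fin.tail q) (s - z.1) z.2) := by
      rw [Measure.volume_eq_prod, integrable_prod_iff hmeas.aestronglyMeasurable]
      constructor
      · refine Filter.Eventually.of_forall fun y => ?_
        by_cases hy : y ∈ Ioo 0 s
        · exact (ih (Fin.tail q) hq' (sub_pos.2 hy.2)).1.const_mul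
            ((Ioo 0 s).indicator (fun y => y ^ (q 0 - 1)) y)
        · simp [indicator_of_notMem hy]
      · simp_rw [Real.norm_of_nonneg (hnonneg (_, _)), inner_eq]
        rw [integrable_indicator_iff measurableSet_Ioo]
        exact hb1.mul_const c
    constructor
    · rw [← mp.integrable_comp_emb e.measurableEmbedding]
      exact hint.congr (Filter.Eventually.of_forall fun z => (he z).symm)
    · rw [← mp.integral_comp e.measurableEmbedding]
      simp_rw [he]
      rw [Measure.volume_eq_prod, integral_prod _ hint]
      simp_rw [inner_eq]
      rw [integral_indicator measurableSet_Ioo, integral_mul_const, hb2, beta, hc,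
        Fin.sum_univ_succ, Fin.prod_univ_succ (fun i => Real.Gamma (q i))]
      have h1 : ∑ i : Fin (n + 1), q i.succ = Q := rfl
      have h2 : ∏ i : Fin (n + 1), Real.Gamma (q i.succ) =
        ∏ i, Real.Gamma (Fin.tail q i) := rfl
      rw [h1, h2]
      have := (Real.Gamma_pos_of_pos hQpos).ne'
      field_simp

/-! ### The position of a random flight -/

theorem intervalIntegral_ite_Ico {E : Type*} [NormedAddCommGroup E] [NormedSpace ℝ E]
    [CompleteSpace E] {a b t : ℝ} (ha : 0 ≤ a) (hab : a ≤ b) (ht : 0 ≤ t) (v : E) :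
    ∫ s in (0 : ℝ)..t, (if a ≤ s ∧ s < b then v else 0) = (min b t - min a t) • v := by
  have h1 : (fun s : ℝ => if a ≤ s ∧ s < b then v else 0) = (Ico a b).indicator fun _ => v := by
    ext s; simp [indicator, mem_Ico]
  rw [h1, intervalIntegral.integral_of_le ht, integral_indicator measurableSet_Ico,
    Measure.restrict_restrict measurableSet_Ico,
    Measure.restrict_congr_set (Ico_ae_eq_Ioc.inter (ae_eq_refl (Ioc 0 t))), Ioc_inter_Ioc,
    setIntegral_const, Real.volume_real_Ioc, sup_eq_left.2 ha]
  congr 1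
  change max (min b t - a) 0 = min b t - min a t
  rcases le_total a t with h | h
  · rw [min_eq_left h, max_eq_left (by rw [sub_nonneg]; exact le_min hab h)]
  · rw [min_eq_right h, min_eq_right (h.trans hab), max_eq_right (by linarith), sub_self]

theorem intervalIntegral_ite_Ici {E : Type*} [NormedAddCommGroup E] [NormedSpace ℝ E]
    [CompleteSpace E] {a t : ℝ} (ha : 0 ≤ a) (ht : 0 ≤ t) (v : E) :
    ∫ s in (0 : ℝ)..t, (if a ≤ s then v else 0) = (t - min a t) • v := by
  -- A right endpoint beyond `t` has no effect on the integral; `max a t + 1` lies beyond both `a`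
  -- and `t`.
  have h := intervalIntegral_ite_Ico (b := max a t + 1) ha
    ((le_max_left a t).trans (by linarith)) ht v
  rw [min_eq_right ((le_max_right a t).trans (by linarith))] at h
  rw [← h, intervalIntegral.integral_of_le ht, intervalIntegral.integral_of_le ht]
  refine setIntegral_congr_fun measurableSet_Ioc fun s hs => ?_
  have : s < max a t + 1 := by linarith [hs.2, le_max_right a t]
  simp [this]

namespace RandomFlight

variable {d n : ℕ} {Ω : Type*} [mΩ : MeasurableSpace Ω] (F : RandomFlight d n Ω)

theorem epoch_nonneg (k : ℕ) (ω : Ω) : 0 ≤ F.epoch k ω :=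
  Finset.sum_nonneg fun j _ => F.renewal_nonneg j ω

theorem epoch_mono (ω : Ω) {k l : ℕ} (h : k ≤ l) : F.epoch k ω ≤ F.epoch l ω := by
  refine Finset.sum_le_sum_of_subset_of_nonneg ?_ fun j _ _ => F.renewal_nonneg j ω
  intro j hj
  simp only [Finset.mem_filter, Finset.mem_univ, true_and] at hj ⊢
  omega

/-- The time spent in the direction `V_k` up to time `t`. -/
noncomputable def sojourn (k : Fin (n + 1)) (t : ℝ) (ω : Ω) : ℝ :=
  (if (k : ℕ) < n then min (F.epoch (k + 1) ω) t else t) - min (F.epoch k ω) t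

theorem position_eq (c : ℝ) {t : ℝ} (ht : 0 ≤ t) (ω : Ω) :
    F.position c t ω = c • ∑ k, F.sojourn k t ω • (F.dir k ω : EucSpace d) := by
  rw [position]
  congr 1
  simp only [direction]
  rw [intervalIntegral.integral_finsetSum]
  · refine Finset.sum_congr rfl fun k _ => ?_
    by_cases hk : (k : ℕ) < n
    · simp only [hk, true_imp_iff, sojourn, if_true]
      exact intervalIntegral_ite_Ico (F.epoch_nonneg _ _) (F.epoch_mono ω (Nat.le_succ _)) ht _
    · simp only [hk, false_imp_iff, and_true, sojourn, if_false]
      exact intervalIntegral_ite_Ici (F.epoch_nonneg _ _) ht _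
  · intro k _
    have hm : MeasurableSet {s : ℝ | F.epoch k ω ≤ s ∧ ((k : ℕ) < n → s < F.epoch (k + 1) ω)} := by
      by_cases hk : (k : ℕ) < n
      · simp only [hk, true_imp_iff]; exact measurableSet_Ico
      · simp only [hk, false_imp_iff, and_true]; exact measurableSet_Ici
    rw [intervalIntegrable_iff]
    have : IsFiniteMeasure (volume.restrict (uIoc 0 t)) := ⟨by simp [uIoc]⟩
    have h := (integrable_const (μ := volume.restrict (uIoc 0 t))
      (F.dir k ω : EucSpace d)).indicator hm
    exact h.congr (Filter.Eventually.of_forall fun s => by simp [indicator])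

theorem continuous_sojourn (k : Fin (n + 1)) (ω : Ω) : Continuous fun t => F.sojourn k t ω := by
  unfold sojourn
  by_cases hk : (k : ℕ) < n
  · simp only [hk, if_true]; fun_prop
  · simp only [hk, if_false]; fun_prop

theorem measurableSet_history (s r : ℝ≥0) (hr : r ≤ s) (k : Fin (n + 1))
    {B : Set (Metric.sphere (0 : EucSpace d) 1)} (hB : MeasurableSet B) :
    MeasurableSet[F.history s] {ω | F.epoch k ω ≤ r ∧ F.dir k ω ∈ B} := by
  refine MeasurableSpace.measurableSet_generateFrom ⟨r, hr, k, {v | v ⟨k, le_refl k⟩ ∈ B}, ?_, rfl⟩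
  exact measurable_pi_apply (⟨k, le_refl k⟩ : Set.Iic k) hB

/-- Truncation at `s` is essential: sublevel sets at a level r ≥ s are everything, so only events
{T_k ≤ r} with r < s occur, and these belong to the history at `s`. -/
theorem measurable_min_epoch (s : ℝ≥0) (k : Fin (n + 1)) :
    Measurable[F.history s] fun ω => min (F.epoch k ω) s := by
  refine measurable_of_Iic fun r => ?_
  rcases le_or_gt (s : ℝ) r with h | h
  · have : (fun ω => min (F.epoch k ω) (s : ℝ)) ⁻¹' Iic r = univ := by
      ext ω; simp [h]
    rw [this]; exact @MeasurableSet.univ _ (F.history s)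
  rcases lt_or_ge r 0 with h0 | h0
  · have : (fun ω => min (F.epoch k ω) (s : ℝ)) ⁻¹' Iic r = ∅ := by
      ext ω
      have := F.epoch_nonneg k ω
      simp only [mem_preimage, mem_Iic, min_le_iff, mem_empty_iff_false, iff_false, not_or, not_le]
      exact ⟨by linarith, h⟩
    rw [this]; exact @MeasurableSet.empty _ (F.history s)
  · have h2 := F.measurableSet_history s ⟨r, h0⟩ (by exact_mod_cast h.le) k MeasurableSet.univ
    have : (fun ω => min (F.epoch k ω) (s : ℝ)) ⁻¹' Iic r =
        {ω | F.epoch k ω ≤ r ∧ F.dir k ω ∈ univ} := by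
      ext ω; simp [h.not_ge]
    rw [this]; exact h2

theorem measurable_ite_dir (s : ℝ≥0) (k : Fin (n + 1)) :
    Measurable[F.history s] fun ω =>
      if F.epoch k ω ≤ s then (F.dir k ω : EucSpace d) else 0 := by
  intro B hB
  have h1 := F.measurableSet_history s s le_rfl k (measurable_subtype_coe hB)
  have h2 := F.measurableSet_history s s le_rfl k MeasurableSet.univ
  by_cases h0 : (0 : EucSpace d) ∈ B
  · convert h1.union h2.compl using 1
    ext ω
    by_cases h : F.epoch k ω ≤ s <;> simp [h, h0]
  · convert h1 using 1
    ext ω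
    by_cases h : F.epoch k ω ≤ s <;> simp [h, h0]

theorem measurable_sojourn (s : ℝ≥0) (k : Fin (n + 1)) :
    Measurable[F.history s] fun ω => F.sojourn k s ω := by
  unfold sojourn
  by_cases hk : (k : ℕ) < n
  · simp only [hk, if_true]
    exact (F.measurable_min_epoch s ⟨k + 1, by omega⟩).sub (F.measurable_min_epoch s k)
  · simp only [hk, if_false]
    exact measurable_const.sub (F.measurable_min_epoch s k)

/-- Directions not yet taken must not enter. On {T_k > s} the sojourn time in V_k is zero, so V_k
may be replaced there by 0, and the replaced vector is measurable for the history. -/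
theorem measurable_position (c : ℝ) (s : ℝ≥0) :
    Measurable[F.history s] (F.position c s) := by
  have h : F.position c s = fun ω => c • ∑ k, F.sojourn k s ω •
      (if F.epoch k ω ≤ s then (F.dir k ω : EucSpace d) else 0) := by
    ext1 ω
    rw [F.position_eq c (NNReal.coe_nonneg s)]
    congr 1
    refine Finset.sum_congr rfl fun k _ => ?_
    by_cases hk : F.epoch k ω ≤ s
    · simp [hk]
    · have h1 : F.sojourn k s ω = 0 := by
        have h2 := F.epoch_mono ω (Nat.le_succ k)
        rw [not_le] at hk
        rw [sojourn, min_eq_right hk.le, min_eq_right (hk.le.trans h2)]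
        simp
      simp [h1]
  rw [h]
  refine Measurable.const_smul ?_ c
  exact Finset.measurable_fun_sum _ fun k _ => (F.measurable_sojourn s k).smul
    (F.measurable_ite_dir s k)

/-- The time change t ↦ t^β is increasing, so it preserves filtrations. Progressive measurability
follows from adaptedness because the paths are continuous. -/
theorem exists_filtration_isProgressive (c β : ℝ) (hβ : 0 < β) :
    ∃ G : Filtration ℝ≥0 mΩ, (∀ t : ℝ≥0, G t = F.history (t ^ β)) ∧
      Adapted G (fun t : ℝ≥0 => F.position c ((t : ℝ) ^ β)) ∧
      IsProgressive G (fun t : ℝ≥0 => F.position c ((t : ℝ) ^ β)) := by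
  let G : Filtration ℝ≥0 mΩ :=
    { seq := fun t => F.history (t ^ β)
      mono' := fun t t' h => F.history.mono (NNReal.rpow_le_rpow h hβ.le)
      le' := fun t => F.history.le _ }
  have hA : Adapted G (fun t : ℝ≥0 => F.position c ((t : ℝ) ^ β)) := by
    intro t
    have := F.measurable_position c (t ^ β)
    rwa [NNReal.coe_rpow] at this
  refine ⟨G, fun t => rfl, hA, ?_⟩
  have hS : StronglyAdapted G (fun t : ℝ≥0 => F.position c ((t : ℝ) ^ β)) := fun t =>
    (hA t).stronglyMeasurable
  refine (hS.isStronglyProgressive_of_continuous fun ω => ?_).isProgressive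
  have h : (fun t : ℝ≥0 => F.position c ((t : ℝ) ^ β) ω) = fun t : ℝ≥0 =>
      c • ∑ k, F.sojourn k ((t : ℝ) ^ β) ω • (F.dir k ω : EucSpace d) := by
    ext1 t
    exact F.position_eq c (Real.rpow_nonneg t.2 _) ω
  rw [h]
  refine Continuous.const_smul (continuous_finsetSum _ fun k _ => ?_) c
  exact ((F.continuous_sojourn k ω).comp
    (NNReal.continuous_coe.rpow_const fun _ => Or.inr hβ.le)).smul continuous_const

end RandomFlight

/-! ### Moments of a flight with Dirichlet renewal times -/

/-- The `n + 1` lengths of the intervals between the renewal times, up to the horizon `s`. -/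
noncomputable def gaps (n : ℕ) (s : ℝ) (x : Fin n → ℝ) : Fin (n + 1) → ℝ :=
  Fin.snoc (α := fun _ => ℝ) x (s - ∑ j, x j)

theorem gaps_castSucc {n : ℕ} (s : ℝ) (x : Fin n → ℝ) (j : Fin n) : gaps n s x j.castSucc = x j := by
  rw [gaps, Fin.snoc_castSucc]

theorem gaps_last {n : ℕ} (s : ℝ) (x : Fin n → ℝ) : gaps n s x (Fin.last n) = s - ∑ j, x j := by
  rw [gaps, Fin.snoc_last]

theorem measurable_gaps {n : ℕ} (s : ℝ) (k : Fin (n + 1)) : Measurable fun x => gaps n s x k := by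
  refine Fin.lastCases ?_ (fun j => ?_) k
  · simp only [gaps_last]; fun_prop
  · simp only [gaps_castSucc]; fun_prop

theorem gaps_pos {n : ℕ} {s : ℝ} (hs : 0 < s) {x : Fin n → ℝ} (hx : x ∈ renewalSimplex n s)
    (k : Fin (n + 1)) : 0 < gaps n s x k := by
  refine Fin.lastCases ?_ (fun j => ?_) k
  · rw [gaps_last]; linarith [sum_lt_of_mem_renewalSimplex hs hx]
  · rw [gaps_castSucc]; exact (hx j).1

theorem sum_gaps {n : ℕ} (s : ℝ) (x : Fin n → ℝ) : ∑ k, gaps n s x k = s := by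
  rw [Fin.sum_univ_castSucc]
  simp only [gaps_last, gaps_castSucc]
  ring

theorem gaps_le {n : ℕ} {s : ℝ} (hs : 0 < s) {x : Fin n → ℝ} (hx : x ∈ renewalSimplex n s)
    (k : Fin (n + 1)) : gaps n s x k ≤ s := by
  conv_rhs => rw [← sum_gaps s x]
  exact Finset.single_le_sum (fun i _ => (gaps_pos hs hx i).le) (Finset.mem_univ k)

theorem dirichletKernel_eq_gaps {n : ℕ} (q : Fin (n + 1) → ℝ) (s : ℝ) :
    dirichletKernel n q s = (renewalSimplex n s).indicator fun x => ∏ k, gaps n s x k ^ (q k - 1) := by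
  unfold dirichletKernel
  congr 1
  ext x
  rw [Fin.prod_univ_castSucc]
  simp only [gaps_last, gaps_castSucc]

theorem dirichletRenewalDensity_eq (n : ℕ) (q s : ℝ) (x : Fin n → ℝ) :
    dirichletRenewalDensity n q s x =
      Real.Gamma ((n + 1) * q) / Real.Gamma q ^ (n + 1) * (1 / s ^ ((n + 1) * q - 1)) *
        dirichletKernel n (fun _ => q) s x := by
  rw [dirichletRenewalDensity, dirichletKernel]
  by_cases h : x ∈ renewalSimplex n s
  · rw [indicator_of_mem h, indicator_of_mem h]
  · rw [indicator_of_notMem h, indicator_of_notMem h, mul_zero]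

theorem uniformRenewalDensity_eq (n : ℕ) (s : ℝ) :
    uniformRenewalDensity n s = dirichletRenewalDensity n 1 s := by
  unfold uniformRenewalDensity dirichletRenewalDensity
  congr 1
  ext x
  simp only [mul_one, sub_self, Real.rpow_zero, Finset.prod_const_one, Real.Gamma_one, one_pow,
    div_one, add_sub_cancel_right, Real.rpow_natCast, Real.Gamma_nat_eq_factorial]
  ring

/-- A monomial in the gaps shifts the Dirichlet exponents from q to q + π k, so the moment is a
quotient of two normalizing constants. -/
theorem integral_gaps_pow_mul_density (n : ℕ) {q s : ℝ} (hq : 0 < q) (hs : 0 < s)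
    (π : Fin (n + 1) → ℕ) :
    ∫ x, dirichletRenewalDensity n q s x * ∏ k, gaps n s x k ^ π k =
      s ^ (∑ k, π k) * ((∏ k, (ascPochhammer ℝ (π k)).eval q) /
        (ascPochhammer ℝ (∑ k, π k)).eval ((n + 1) * q)) := by
  have h1 : ∀ x, dirichletRenewalDensity n q s x * ∏ k, gaps n s x k ^ π k =
      Real.Gamma ((n + 1) * q) / Real.Gamma q ^ (n + 1) * (1 / s ^ ((n + 1) * q - 1)) *
        dirichletKernel n (fun k => q + π k) s x := by
    intro x
    rw [dirichletRenewalDensity_eq, mul_assoc, dirichletKernel_eq_gaps, dirichletKernel_eq_gaps]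
    congr 1
    by_cases h : x ∈ renewalSimplex n s
    · rw [indicator_of_mem h, indicator_of_mem h, ← Finset.prod_mul_distrib]
      refine Finset.prod_congr rfl fun k _ => ?_
      rw [show q + (π k : ℝ) - 1 = (q - 1) + π k by ring, Real.rpow_add (gaps_pos hs h k),
        Real.rpow_natCast]
    · rw [indicator_of_notMem h, indicator_of_notMem h, zero_mul]
  simp_rw [h1]
  rw [integral_const_mul, (integral_dirichletKernel n _ (fun k => by positivity) hs).2]
  have hsum : ∑ k, (q + (π k : ℝ)) = (n + 1) * q + ((∑ k, π k : ℕ) : ℝ) := by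
    rw [Finset.sum_add_distrib]; simp
  have hQ : 0 < ((n : ℝ) + 1) * q := by positivity
  rw [hsum, Gamma_add_natCast hQ]
  simp_rw [Gamma_add_natCast hq]
  rw [Finset.prod_mul_distrib, Finset.prod_const, Finset.card_univ, Fintype.card_fin,
    show (n + 1) * q + ((∑ k, π k : ℕ) : ℝ) - 1 = ((n + 1) * q - 1) + ((∑ k, π k : ℕ) : ℝ) by ring,
    Real.rpow_add hs, Real.rpow_natCast]
  have g1 := (Real.Gamma_pos_of_pos hQ).ne'
  have g2 := (Real.Gamma_pos_of_pos hq).ne'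
  have g3 := (Real.rpow_pos_of_pos hs (((n : ℝ) + 1) * q - 1)).ne'
  have g4 := (ascPochhammer_eval_pos hQ (∑ k, π k)).ne'
  field_simp

theorem dirichletRenewalDensity_nonneg {n : ℕ} {q s : ℝ} (hq : 0 < q) (hs : 0 < s)
    (x : Fin n → ℝ) : 0 ≤ dirichletRenewalDensity n q s x := by
  rw [dirichletRenewalDensity_eq]
  have hQ : 0 < ((n : ℝ) + 1) * q := by positivity
  have g1 := Real.Gamma_pos_of_pos hQ
  have g2 := Real.Gamma_pos_of_pos hq
  have := dirichletKernel_nonneg (fun _ => q) hs x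
  positivity

theorem measurable_dirichletRenewalDensity (n : ℕ) (q s : ℝ) :
    Measurable (dirichletRenewalDensity n q s) := by
  rw [funext (dirichletRenewalDensity_eq n q s)]
  exact (measurable_dirichletKernel _ _ _).const_mul _

theorem coeff_prod_mk_eq {ι : Type*} [Fintype ι] [DecidableEq ι] (A : ι → ℕ → ℝ) (p : ℕ) :
    PowerSeries.coeff p (∏ k, PowerSeries.mk (A k)) =
      ∑ π ∈ Finset.piAntidiag Finset.univ p, ∏ k, A k (π k) := by
  rw [PowerSeries.coeff_prod]
  refine Finset.sum_bij (fun l _ => ⇑l) ?_ ?_ ?_ ?_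
  · intro l hl
    rw [Finset.mem_finsuppAntidiag] at hl
    rw [Finset.mem_piAntidiag]
    exact ⟨hl.1, fun i _ => Finset.mem_univ i⟩
  · intro l _ l' _ h
    exact DFunLike.coe_injective h
  · intro π hπ
    rw [Finset.mem_piAntidiag] at hπ
    exact ⟨Finsupp.equivFunOnFinite.symm π, by
      rw [Finset.mem_finsuppAntidiag]; exact ⟨hπ.1, Finset.subset_univ _⟩, rfl⟩
  · intro l _
    simp

namespace RandomFlight

variable {d n : ℕ} {Ω : Type*} [mΩ : MeasurableSpace Ω] (F : RandomFlight d n Ω)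

theorem epoch_succ_eq {k : ℕ} (hk : k < n) (ω : Ω) :
    F.epoch (k + 1) ω = F.epoch k ω + F.renewal ⟨k, hk⟩ ω := by
  have : (Finset.univ.filter fun j : Fin n => (j : ℕ) < k + 1) =
      insert ⟨k, hk⟩ (Finset.univ.filter fun j : Fin n => (j : ℕ) < k) := by
    ext j
    simp only [Finset.mem_filter, Finset.mem_univ, true_and, Finset.mem_insert, Fin.ext_iff]
    omega
  rw [epoch, this, Finset.sum_insert (by simp), add_comm]
  rfl

theorem epoch_last (ω : Ω) : F.epoch n ω = ∑ j, F.renewal j ω := by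
  simp [epoch]

theorem sojourn_eq_gaps {s : ℝ} {ω : Ω} (h : ∑ j, F.renewal j ω ≤ s) (k : Fin (n + 1)) :
    F.sojourn k s ω = gaps n s (fun j => F.renewal j ω) k := by
  have hle : ∀ l ≤ n, F.epoch l ω ≤ s := fun l hl =>
    (F.epoch_mono ω hl).trans (by rw [epoch_last]; exact h)
  refine Fin.lastCases ?_ (fun j => ?_) k
  · rw [gaps_last, sojourn]
    simp only [Fin.val_last, lt_irrefl, if_false]
    rw [min_eq_left (hle n le_rfl), epoch_last]
  · rw [gaps_castSucc, sojourn]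
    simp only [Fin.val_castSucc, j.2, if_true]
    rw [min_eq_left (hle _ j.2), min_eq_left (hle _ j.2.le), epoch_succ_eq F j.2]
    simp

variable {P : Measure Ω} {q s : ℝ}

theorem renewal_mem_ae (hP : F.HasRenewalDensity (dirichletRenewalDensity n q s) P) :
    ∀ᵐ ω ∂P, (fun j => F.renewal j ω) ∈ renewalSimplex n s := by
  have hm : Measurable fun ω => fun j => F.renewal j ω :=
    measurable_pi_lambda _ F.measurable_renewal
  have h : ∀ᵐ x ∂(P.map fun ω j => F.renewal j ω), x ∈ renewalSimplex n s := by
    rw [hP, ae_withDensity_iff (measurable_dirichletRenewalDensity n q s).ennreal_ofReal]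
    refine Filter.Eventually.of_forall fun x hx => ?_
    by_contra h
    exact hx (by rw [dirichletRenewalDensity, indicator_of_notMem h, ENNReal.ofReal_zero])
  exact ae_of_ae_map hm.aemeasurable h

theorem integral_gaps_pow (hq : 0 < q) (hs : 0 < s)
    (hP : F.HasRenewalDensity (dirichletRenewalDensity n q s) P) (π : Fin (n + 1) → ℕ) :
    ∫ ω, ∏ k, gaps n s (fun j => F.renewal j ω) k ^ π k ∂P =
      s ^ (∑ k, π k) * ((∏ k, (ascPochhammer ℝ (π k)).eval q) /
        (ascPochhammer ℝ (∑ k, π k)).eval ((n + 1) * q)) := by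
  have hm : Measurable fun ω => fun j => F.renewal j ω :=
    measurable_pi_lambda _ F.measurable_renewal
  have hg : Measurable fun x => ∏ k, gaps n s x k ^ π k :=
    Finset.measurable_fun_prod _ fun k _ => (measurable_gaps s k).pow_const _
  rw [← integral_gaps_pow_mul_density n hq hs, ← integral_map (f := fun x => ∏ k, gaps n s x k ^ π k)
    hm.aemeasurable hg.aestronglyMeasurable, hP, integral_withDensity_eq_integral_toReal_smul
    (measurable_dirichletRenewalDensity n q s).ennreal_ofReal
    (Filter.Eventually.of_forall fun _ => ENNReal.ofReal_lt_top)]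
  refine integral_congr_ae (Filter.Eventually.of_forall fun x => ?_)
  simp only [smul_eq_mul]
  rw [ENNReal.toReal_ofReal (dirichletRenewalDensity_nonneg hq hs x)]

/-- The multinomial coefficient p! / ∏ (π k)! is distributed over the gaps: each gap then carries
(q)_j / j! times the moment of its weight, and the sum over π is a coefficient of a product of
series. The factor `e₀` is 1 for independent directions; in dimension one it is the moment of V₀,
and `μ` records the signs. -/
theorem integral_sum_gaps_mul_pow [IsProbabilityMeasure P] (hq : 0 < q) (hs : 0 < s)
    (hP : F.HasRenewalDensity (dirichletRenewalDensity n q s) P)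
    (W : Fin (n + 1) → Ω → ℝ) (hW : ∀ k, Measurable (W k)) {b : ℝ} (hb : ∀ k ω, |W k ω| ≤ b)
    (hind : IndepFun (fun ω k => W k ω) (fun ω j => F.renewal j ω) P) (p : ℕ) {e₀ : ℝ}
    (μ : Fin (n + 1) → ℕ → ℝ)
    (he : ∀ π : Fin (n + 1) → ℕ, ∑ k, π k = p → ∫ ω, ∏ k, W k ω ^ π k ∂P = e₀ * ∏ k, μ k (π k)) :
    ∫ ω, (∑ k, gaps n s (fun j => F.renewal j ω) k * W k ω) ^ p ∂P =
      e₀ * (s ^ p * ((p.factorial : ℝ) / (ascPochhammer ℝ p).eval ((n + 1) * q)) *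
        PowerSeries.coeff p (∏ k, PowerSeries.mk fun j =>
          (ascPochhammer ℝ j).eval q / (j.factorial : ℝ) * μ k j)) := by
  have hm : Measurable fun ω => fun j => F.renewal j ω :=
    measurable_pi_lambda _ F.measurable_renewal
  have hgm : ∀ k, Measurable fun ω => gaps n s (fun j => F.renewal j ω) k :=
    fun k => (measurable_gaps s k).comp hm
  rw [coeff_prod_mk_eq]
  simp_rw [Finset.sum_pow_eq_sum_piAntidiag, mul_pow, Finset.prod_mul_distrib]
  have hb0 : 0 ≤ b := by
    obtain ⟨ω⟩ := P.nonempty_of_neZero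
    exact (abs_nonneg _).trans (hb 0 ω)
  rw [integral_finsetSum]
  · rw [Finset.mul_sum, Finset.mul_sum]
    refine Finset.sum_congr rfl fun π hπ => ?_
    have hπp : ∑ k, π k = p := (Finset.mem_piAntidiag.1 hπ).1
    have hg : Measurable fun x => ∏ k, gaps n s x k ^ π k :=
      Finset.measurable_fun_prod _ fun k _ => (measurable_gaps s k).pow_const _
    have hw : Measurable fun x : Fin (n + 1) → ℝ => ∏ k, x k ^ π k := by fun_prop
    have hindep := hind.symm.comp hg hw
    have h1 := hindep.integral_fun_mul_eq_mul_integral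
      (hg.comp hm).aestronglyMeasurable
      (hw.comp (measurable_pi_lambda _ hW)).aestronglyMeasurable
    simp only [Function.comp_def] at h1
    rw [integral_const_mul, h1, F.integral_gaps_pow hq hs hP, he π hπp, hπp]
    have hmul : (Nat.multinomial Finset.univ π : ℝ) =
        (p.factorial : ℝ) * ∏ k, ((π k).factorial : ℝ)⁻¹ := by
      have h2 := Nat.multinomial_spec (s := Finset.univ) π
      rw [hπp] at h2
      have h3 : (∏ k, ((π k).factorial : ℝ)) * (Nat.multinomial Finset.univ π : ℝ) =
        (p.factorial : ℝ) := by exact_mod_cast h2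
      have h4 : (∏ k, ((π k).factorial : ℝ)) ≠ 0 :=
        Finset.prod_ne_zero_iff.2 fun k _ => by positivity
      rw [Finset.prod_inv_distrib, ← h3]
      field_simp
    rw [hmul]
    simp only [div_eq_mul_inv, Finset.prod_mul_distrib]
    ring
  · intro π _
    refine Integrable.const_mul ?_ _
    refine Integrable.of_bound (C := (∏ k, s ^ π k) * ∏ k, b ^ π k) ?_ ?_
    · refine Measurable.aestronglyMeasurable ?_
      exact (Finset.measurable_fun_prod _ fun k _ => (hgm k).pow_const _).mul
        (Finset.measurable_fun_prod _ fun k _ => (hW k).pow_const _)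
    · filter_upwards [F.renewal_mem_ae hP] with ω hω
      rw [norm_mul, norm_prod, norm_prod]
      refine mul_le_mul (Finset.prod_le_prod (fun _ _ => norm_nonneg _) fun k _ => ?_)
        (Finset.prod_le_prod (fun _ _ => norm_nonneg _) fun k _ => ?_)
        (Finset.prod_nonneg fun _ _ => norm_nonneg _)
        (Finset.prod_nonneg fun _ _ => pow_nonneg hs.le _)
      · rw [norm_pow, Real.norm_of_nonneg (gaps_pos hs hω k).le]
        exact pow_le_pow_left₀ (gaps_pos hs hω k).le (gaps_le hs hω k) _
      · rw [norm_pow, Real.norm_eq_abs]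
        exact pow_le_pow_left₀ (abs_nonneg _) (hb k ω) _

end RandomFlight

/-! ### The law of the position -/

theorem PowerSeries.expand_two_mk_eq (A : ℕ → ℝ) (B : ℕ → ℝ) (he : ∀ p, B (2 * p) = A p)
    (ho : ∀ p, Odd p → B p = 0) :
    PowerSeries.mk B = PowerSeries.expand 2 two_ne_zero (PowerSeries.mk A) := by
  ext p
  rw [PowerSeries.coeff_expand, PowerSeries.coeff_mk]
  rcases Nat.even_or_odd' p with ⟨r, rfl | rfl⟩
  · rw [if_pos (Dvd.intro r rfl), PowerSeries.coeff_mk, he, Nat.mul_div_cancel_left r two_pos]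
  · rw [if_neg (by omega), ho _ ⟨r, rfl⟩]

theorem coeff_expand_two_mk_even (A : ℕ → ℝ) (r : ℕ) :
    PowerSeries.coeff (2 * r) (PowerSeries.expand 2 two_ne_zero (PowerSeries.mk A)) = A r := by
  rw [PowerSeries.coeff_expand, if_pos (Dvd.intro r rfl), PowerSeries.coeff_mk,
    Nat.mul_div_cancel_left r two_pos]

theorem coeff_expand_two_odd (A : PowerSeries ℝ) {p : ℕ} (hp : Odd p) :
    PowerSeries.coeff p (PowerSeries.expand 2 two_ne_zero A) = 0 := by
  rw [PowerSeries.coeff_expand, if_neg]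
  rw [← even_iff_two_dvd, Nat.not_even_iff_odd]
  exact hp

theorem mk_risingPoly_pow (x y : ℝ) (N : ℕ) :
    (PowerSeries.mk fun p => x ^ p * (risingPoly p).eval y) ^ N =
      PowerSeries.mk fun p => x ^ p * (risingPoly p).eval (N * y) := by
  refine PowerSeries.mk_pow_eq (c := fun y p => x ^ p * (risingPoly p).eval y) ?_ ?_ y N
  · intro p
    rcases p with _ | p
    · simp [risingPoly]
    · simp [risingPoly]
  · intro p y y'
    rw [← risingPoly_conv, Finset.mul_sum]
    refine Finset.sum_congr rfl fun i hi => ?_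
    rw [← Finset.HasAntidiagonal.mem_antidiagonal.1 hi, pow_add]
    ring

theorem mk_hagenPoly_pow (x y : ℝ) (N : ℕ) :
    (PowerSeries.mk fun p => x ^ p * (hagenPoly p).eval y) ^ N =
      PowerSeries.mk fun p => x ^ p * (hagenPoly p).eval (N * y) := by
  refine PowerSeries.mk_pow_eq (c := fun y p => x ^ p * (hagenPoly p).eval y) ?_ ?_ y N
  · intro p
    rcases p with _ | p
    · simp [hagenPoly]
    · simp [hagenPoly]
  · intro p y y'
    rw [← hagenPoly_conv, Finset.mul_sum]
    refine Finset.sum_congr rfl fun i hi => ?_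
    rw [← Finset.HasAntidiagonal.mem_antidiagonal.1 hi, pow_add]
    ring

theorem momentCoeff_mul {Q : ℝ} (hQ : 0 < Q) (b : ℝ) (r : ℕ) :
    ((2 * r).factorial : ℝ) / (ascPochhammer ℝ (2 * r)).eval Q * momentCoeff Q b r =
      (ascPochhammer ℝ r).eval (1 / 2) / (ascPochhammer ℝ r).eval b := by
  have h1 := (ascPochhammer_eval_pos hQ (2 * r)).ne'
  have h2 : ((2 * r).factorial : ℝ) ≠ 0 := by positivity
  rw [momentCoeff]
  generalize (ascPochhammer ℝ r).eval b = B
  field_simp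

theorem mk_neg_one_pow_mul :
    (PowerSeries.mk fun j => (-1 : ℝ) ^ j) * (1 + PowerSeries.X) = 1 := by
  ext p
  rcases p with _ | p
  · simp [mul_add]
  · simp [mul_add, PowerSeries.coeff_succ_mul_X, PowerSeries.coeff_one, pow_succ]

/-- (1 - x)⁻¹ (1 + x)⁻¹ = (1 - x²)⁻¹, and the coefficients of `risingPoly` at 1 are all 1. -/
theorem mk_alternating_pair :
    (PowerSeries.mk fun j => (1 : ℝ) ^ j) * (PowerSeries.mk fun j => (-1 : ℝ) ^ j) =
      PowerSeries.expand 2 two_ne_zero (PowerSeries.mk fun p => 1 ^ p * (risingPoly p).eval 1) := by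
  have h0 : (fun p => (1 : ℝ) ^ p * (risingPoly p).eval 1) = fun _ => 1 := by
    ext p
    have : (p.factorial : ℝ) ≠ 0 := by positivity
    simp [risingPoly, ascPochhammer_eval_one, this]
  have h1 : (PowerSeries.mk fun j => (1 : ℝ) ^ j) * (1 - PowerSeries.X) = 1 := by
    simp only [one_pow]
    exact PowerSeries.mk_one_mul_one_sub_eq_one ℝ
  have h2 := mk_neg_one_pow_mul
  have h3 : PowerSeries.expand 2 two_ne_zero (PowerSeries.mk fun _ => (1 : ℝ)) *
      (1 - PowerSeries.X ^ 2) = 1 := by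
    rw [← PowerSeries.expand_X 2 two_ne_zero,
      ← map_one (PowerSeries.expand (R := ℝ) 2 two_ne_zero), ← map_sub, ← map_mul]
    exact congrArg _ (PowerSeries.mk_one_mul_one_sub_eq_one ℝ)
  rw [h0]
  generalize (PowerSeries.mk fun j => (1 : ℝ) ^ j) = a at *
  generalize (PowerSeries.mk fun j => (-1 : ℝ) ^ j) = b at *
  generalize PowerSeries.expand 2 two_ne_zero (PowerSeries.mk fun _ => (1 : ℝ)) = e at *
  -- Each series is known only through its inverse: a (1 - X) = b (1 + X) = e (1 - X²) = 1, which
  -- forces a b = e.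
  linear_combination (-a * b) * h3 + e * h1 + e * a * (1 - PowerSeries.X) * h2

theorem prod_alternating (g : ℝ → PowerSeries ℝ) (j : ℕ) :
    ∏ k ∈ Finset.range (2 * j), g ((-1) ^ k) = (g 1 * g (-1)) ^ j := by
  induction j with
  | zero => simp
  | succ j ih =>
    rw [show 2 * (j + 1) = 2 * j + 1 + 1 by ring, Finset.prod_range_succ, Finset.prod_range_succ, ih]
    simp [pow_succ, pow_mul]
    ring

/-- For odd n the n + 1 factors pair off to (1 - x²)^(-(n+1)/2). For even n a factor (1 - x)⁻¹ = (1
+ x)(1 - x²)⁻¹ is left over, so the product is (1 + x)(1 - x²)^(-(n/2+1)), and the summand x affects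
odd coefficients only. -/
theorem coeff_prod_alternating {n : ℕ} {b : ℝ}
    (h : (Odd n ∧ b = ((n : ℝ) + 2) / 2) ∨ (Even n ∧ b = ((n : ℝ) + 1) / 2)) (r : ℕ) :
    PowerSeries.coeff (2 * r)
      (∏ k : Fin (n + 1), PowerSeries.mk fun j => ((-1 : ℝ) ^ (k : ℕ)) ^ j) =
      momentCoeff ((n + 1 : ℝ) * 1) b r := by
  rw [Fin.prod_univ_eq_prod_range (fun k => PowerSeries.mk fun j => ((-1 : ℝ) ^ k) ^ j)]
  have hn : (0 : ℝ) < (n + 1 : ℝ) * 1 := by positivity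
  rcases h with ⟨⟨i, rfl⟩, rfl⟩ | ⟨⟨i, rfl⟩, rfl⟩
  · rw [show 2 * i + 1 + 1 = 2 * (i + 1) by ring,
      prod_alternating (fun x => PowerSeries.mk fun j => x ^ j),
      mk_alternating_pair, ← map_pow, mk_risingPoly_pow, coeff_expand_two_mk_even]
    rw [show (((2 * i + 1 : ℕ) : ℝ) + 2) / 2 = ((((2 * i + 1 : ℕ) : ℝ) + 1) * 1 + 1) / 2 by ring,
      momentCoeff_add_one_half hn]
    push_cast
    rw [one_pow, one_mul]
    congr 1; ring
  · have h2 : PowerSeries.mk (fun j => ((-1 : ℝ) ^ (i + i)) ^ j) =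
        (1 + PowerSeries.X) * ((PowerSeries.mk fun j => (1 : ℝ) ^ j) *
          (PowerSeries.mk fun j => (-1 : ℝ) ^ j)) := by
      rw [← two_mul, pow_mul, neg_one_sq, one_pow]
      linear_combination -(PowerSeries.mk fun j => (1 : ℝ) ^ j) * mk_neg_one_pow_mul
    rw [← two_mul] at hn h2 ⊢
    rw [Finset.prod_range_succ, h2,
      prod_alternating (fun x => PowerSeries.mk fun j => x ^ j),
      mul_left_comm, ← pow_succ, mk_alternating_pair, ← map_pow, mk_risingPoly_pow, add_mul,
      one_mul, map_add, coeff_expand_two_mk_even]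
    have h3 : ∀ A : PowerSeries ℝ, PowerSeries.coeff (2 * r)
        (PowerSeries.X * PowerSeries.expand 2 two_ne_zero A) = 0 := by
      intro A
      rcases r with _ | r
      · simp
      · rw [show 2 * (r + 1) = 2 * r + 1 + 1 by ring, PowerSeries.coeff_succ_X_mul]
        exact coeff_expand_two_odd A ⟨r, rfl⟩
    rw [h3, add_zero]
    rw [show (((2 * i : ℕ) : ℝ) + 1) / 2 = ((((2 * i : ℕ) : ℝ) + 1) * 1) / 2 by ring,
      momentCoeff_half hn]
    push_cast
    rw [one_pow, one_mul]
    congr 1; ring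

namespace RandomFlight

variable {d n : ℕ} {Ω : Type*} [mΩ : MeasurableSpace Ω] (F : RandomFlight d n Ω)
variable {P : Measure Ω} {q s : ℝ}

theorem integral_dir_inner_pow (hP : F.IsIsotropic P) (k : Fin (n + 1)) (ξ : EucSpace d) (p : ℕ) :
    ∫ ω, inner ℝ (F.dir k ω : EucSpace d) ξ ^ p ∂P =
      ∫ θ, inner ℝ (θ : EucSpace d) ξ ^ p ∂sphereUniform d := by
  rw [← hP.uniform k, integral_map (F.measurable_dir k).aemeasurable]
  refine Measurable.aestronglyMeasurable ?_
  fun_prop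

theorem measurable_dir_inner (k : Fin (n + 1)) (ξ : EucSpace d) :
    Measurable fun ω => inner ℝ (F.dir k ω : EucSpace d) ξ := by
  have := F.measurable_dir k
  fun_prop

theorem abs_dir_inner_le (k : Fin (n + 1)) (ξ : EucSpace d) (ω : Ω) :
    |inner ℝ (F.dir k ω : EucSpace d) ξ| ≤ ‖ξ‖ := by
  have h := abs_real_inner_le_norm (F.dir k ω : EucSpace d) ξ
  rwa [norm_eq_of_mem_sphere, one_mul] at h

theorem indepFun_dir_inner (hP : F.IsIsotropic P) (ξ : EucSpace d) :
    IndepFun (fun ω k => inner ℝ (F.dir k ω : EucSpace d) ξ) (fun ω j => F.renewal j ω) P := by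
  have h1 : Measurable fun v : Fin (n + 1) → Metric.sphere (0 : EucSpace d) 1 =>
      fun k => inner ℝ (v k : EucSpace d) ξ := by fun_prop
  exact hP.indep_renewal.comp h1 measurable_id

/-- The moments of the flight at time `s` with unit speed agree with those of the profile. -/
def HasProfileMoments (F : RandomFlight d n Ω) (P : Measure Ω) (s b : ℝ) : Prop :=
  ∀ (ξ : EucSpace d),
    (∀ r : ℕ, ∫ ω, (∑ k, gaps n s (fun j => F.renewal j ω) k *
      inner ℝ (F.dir k ω : EucSpace d) ξ) ^ (2 * r) ∂P = (s * ‖ξ‖) ^ (2 * r) *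
        ((ascPochhammer ℝ r).eval (1 / 2) / (ascPochhammer ℝ r).eval b)) ∧
    ∀ p : ℕ, Odd p → ∫ ω, (∑ k, gaps n s (fun j => F.renewal j ω) k *
      inner ℝ (F.dir k ω : EucSpace d) ξ) ^ p ∂P = 0

/-- Odd spherical moments vanish, so the n + 1 equal series are series in x². The hypothesis `hfam`,
applied at ‖ξ‖², is the closure of the family under powers; it is the only point where the renewal
parameter q has to fit the dimension. -/
theorem hasProfileMoments_of_family [NeZero d] [IsProbabilityMeasure P] (hd : 2 ≤ d) (hq : 0 < q)
    (hs : 0 < s) (hP : F.IsIsotropic P)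
    (hR : F.HasRenewalDensity (dirichletRenewalDensity n q s) P) {b : ℝ}
    (hfam : ∀ x : ℝ, (PowerSeries.mk fun p => x ^ p * momentCoeff q ((d : ℝ) / 2) p) ^ (n + 1) =
      PowerSeries.mk fun p => x ^ p * momentCoeff ((n + 1) * q) b p) :
    F.HasProfileMoments P s b := by
  intro ξ
  have hQ : 0 < ((n : ℝ) + 1) * q := by positivity
  have hkey := fun p => F.integral_sum_gaps_mul_pow hq hs hR
    (fun k ω => inner ℝ (F.dir k ω : EucSpace d) ξ) (fun k => F.measurable_dir_inner k ξ)
    (fun k ω => F.abs_dir_inner_le k ξ ω) (F.indepFun_dir_inner hP ξ) p (e₀ := 1)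
    (fun _ j => ∫ θ, inner ℝ (θ : EucSpace d) ξ ^ j ∂sphereUniform d) (by
      intro π _
      have h1 : iIndepFun (fun k ω => inner ℝ (F.dir k ω : EucSpace d) ξ ^ π k) P :=
        (hP.indep_dir hd).comp (fun k θ => inner ℝ (θ : EucSpace d) ξ ^ π k)
          (fun k => by fun_prop)
      rw [h1.integral_fun_prod_eq_prod_integral
        (fun k => ((F.measurable_dir_inner k ξ).pow_const _).aestronglyMeasurable), one_mul]
      exact Finset.prod_congr rfl fun k _ => F.integral_dir_inner_pow hP k ξ _)
  have hmk : (PowerSeries.mk fun j => (ascPochhammer ℝ j).eval q / (j.factorial : ℝ) *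
      ∫ θ, inner ℝ (θ : EucSpace d) ξ ^ j ∂sphereUniform d) =
      PowerSeries.expand 2 two_ne_zero
        (PowerSeries.mk fun p => (‖ξ‖ ^ 2) ^ p * momentCoeff q ((d : ℝ) / 2) p) := by
    refine PowerSeries.expand_two_mk_eq _ _ (fun p => ?_) fun p hp => ?_
    · rw [integral_sphereUniform_inner_pow_even, momentCoeff, pow_mul]
      ring
    · rw [integral_sphereUniform_inner_pow_odd d p hp, mul_zero]
  simp only [hmk, Finset.prod_const, Finset.card_univ, Fintype.card_fin, ← map_pow, hfam,
    one_mul] at hkey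
  constructor
  · intro r
    rw [hkey, coeff_expand_two_mk_even, ← momentCoeff_mul hQ]
    rw [mul_pow, ← pow_mul]
    ring
  · intro p hp
    rw [hkey, coeff_expand_two_odd _ hp, mul_zero]

theorem hasProfileMoments_sub_one [NeZero d] [IsProbabilityMeasure P] (hd : 2 ≤ d) (hs : 0 < s)
    (hP : F.IsIsotropic P)
    (hR : F.HasRenewalDensity (dirichletRenewalDensity n ((d : ℝ) - 1) s) P) :
    F.HasProfileMoments P s (((n + 1) * ((d : ℝ) - 1) + 1) / 2) := by
  have hd' : (2 : ℝ) ≤ d := by exact_mod_cast hd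
  have hq : 0 < (d : ℝ) - 1 := by linarith
  have hQ : 0 < ((n : ℝ) + 1) * ((d : ℝ) - 1) := by positivity
  refine F.hasProfileMoments_of_family hd hq hs hP hR fun x => ?_
  have h1 : (d : ℝ) / 2 = ((d : ℝ) - 1 + 1) / 2 := by ring
  simp_rw [h1, momentCoeff_add_one_half hq, momentCoeff_add_one_half hQ]
  rw [mk_risingPoly_pow]
  push_cast
  simp_rw [mul_div_assoc]

theorem hasProfileMoments_half_sub_one [NeZero d] [IsProbabilityMeasure P] (hd : 3 ≤ d)
    (hs : 0 < s) (hP : F.IsIsotropic P)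
    (hR : F.HasRenewalDensity (dirichletRenewalDensity n ((d : ℝ) / 2 - 1) s) P) :
    F.HasProfileMoments P s ((n + 1) * ((d : ℝ) / 2 - 1) + 1) := by
  have hd' : (3 : ℝ) ≤ d := by exact_mod_cast hd
  have hq : 0 < (d : ℝ) / 2 - 1 := by linarith
  have hQ : 0 < ((n : ℝ) + 1) * ((d : ℝ) / 2 - 1) := by positivity
  refine F.hasProfileMoments_of_family (by omega) hq hs hP hR fun x => ?_
  have h1 : momentCoeff ((d : ℝ) / 2 - 1) ((d : ℝ) / 2) =
      momentCoeff ((d : ℝ) / 2 - 1) ((d : ℝ) / 2 - 1 + 1) := by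
    congr 1; ring
  simp_rw [h1, momentCoeff_add_one hq, momentCoeff_add_one hQ]
  rw [mk_hagenPoly_pow]
  push_cast
  rfl

/-- All directions are ±V₀, so the randomness of the direction factors out as one moment of V₀,
whose ratio (1/2)_r / (d/2)_r is 1. For q = 1 the weights (1)_j / j! are 1, and geometric series
remain. -/
theorem hasProfileMoments_one [IsProbabilityMeasure P] (hd : d = 1) (hs : 0 < s)
    (hP : F.IsIsotropic P) (hR : F.HasRenewalDensity (dirichletRenewalDensity n 1 s) P) {b : ℝ}
    (hb : (Odd n ∧ b = ((n : ℝ) + 2) / 2) ∨ (Even n ∧ b = ((n : ℝ) + 1) / 2)) :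
    F.HasProfileMoments P s b := by
  subst hd
  intro ξ
  have hQ : 0 < ((n : ℝ) + 1) * 1 := by positivity
  have hkey := fun p => F.integral_sum_gaps_mul_pow one_pos hs hR
    (fun k ω => inner ℝ (F.dir k ω : EucSpace 1) ξ) (fun k => F.measurable_dir_inner k ξ)
    (fun k ω => F.abs_dir_inner_le k ξ ω) (F.indepFun_dir_inner hP ξ) p
    (e₀ := ∫ θ, inner ℝ (θ : EucSpace 1) ξ ^ p ∂sphereUniform 1)
    (fun k j => ((-1 : ℝ) ^ (k : ℕ)) ^ j) (by
      intro π hπ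
      rw [← F.integral_dir_inner_pow hP 0, ← integral_mul_const]
      refine integral_congr_ae (Filter.Eventually.of_forall fun ω => ?_)
      simp only
      rw [← hπ, ← Finset.prod_pow_eq_pow_sum, ← Finset.prod_mul_distrib]
      refine Finset.prod_congr rfl fun k _ => ?_
      rw [F.alternating rfl k ω, real_inner_smul_left]
      ring)
  have h1 : ∀ j : ℕ, (ascPochhammer ℝ j).eval (1 : ℝ) / (j.factorial : ℝ) = 1 := by
    intro j
    rw [ascPochhammer_eval_one]
    exact div_self (by positivity)
  simp only [h1, one_mul] at hkey
  constructor
  · intro r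
    rw [hkey, coeff_prod_alternating hb, integral_sphereUniform_inner_pow_even,
      ← momentCoeff_mul hQ b]
    have h2 := (ascPochhammer_eval_pos (q := 1 / 2) (by norm_num) r).ne'
    rw [Nat.cast_one, div_self h2, mul_pow]
    ring
  · intro p hp
    rw [hkey, integral_sphereUniform_inner_pow_odd 1 p hp, zero_mul]

/-- Almost surely the renewal times sum to less than `s`, so the sojourn times are exactly the gaps
and the moments in `hM` are those of the position. Boundedness of the support is all that is needed
besides, and the crude radius c (n + 1) s serves. -/
theorem map_position_eq [NeZero d] [IsProbabilityMeasure P] (hs : 0 < s)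
    (hR : F.HasRenewalDensity (dirichletRenewalDensity n q s) P) {ν c K : ℝ} (hν : 0 < ν)
    (hc : 0 < c) (hK : K = Real.Gamma ((d : ℝ) / 2 + ν + 1) /
      (Real.pi ^ ((d : ℝ) / 2) * Real.Gamma (ν + 1) * (c * s) ^ d))
    (hM : F.HasProfileMoments P s ((d : ℝ) / 2 + ν + 1)) :
    P.map (F.position c s) = ballMeasure d K ν (c * s) := by
  have hcs : 0 < c * s := by positivity
  have hK0 : 0 ≤ K := by
    have g1 : 0 < Real.Gamma ((d : ℝ) / 2 + ν + 1) := Real.Gamma_pos_of_pos (by positivity)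
    have g2 : 0 < Real.Gamma (ν + 1) := Real.Gamma_pos_of_pos (by positivity)
    rw [hK]; positivity
  have hmeas : Measurable (F.position c s) := by
    have h := (F.measurable_position c ⟨s, hs.le⟩).mono (F.history.le _) le_rfl
    exact h
  have hpos : ∀ᵐ ω ∂P, F.position c s ω =
      c • ∑ k, gaps n s (fun j => F.renewal j ω) k • (F.dir k ω : EucSpace d) := by
    filter_upwards [F.renewal_mem_ae hR] with ω hω
    rw [F.position_eq c hs.le]
    simp_rw [F.sojourn_eq_gaps (sum_lt_of_mem_renewalSimplex hs hω).le]
  have hinner : ∀ (ξ : EucSpace d) (p : ℕ), ∫ x, inner ℝ x ξ ^ p ∂(P.map (F.position c s)) =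
      c ^ p * ∫ ω, (∑ k, gaps n s (fun j => F.renewal j ω) k *
        inner ℝ (F.dir k ω : EucSpace d) ξ) ^ p ∂P := by
    intro ξ p
    rw [integral_map hmeas.aemeasurable
      (Measurable.aestronglyMeasurable (by fun_prop)), ← integral_const_mul]
    refine integral_congr_ae ?_
    filter_upwards [hpos] with ω hω
    rw [hω, real_inner_smul_left, mul_pow, sum_inner]
    simp_rw [real_inner_smul_left]
  have := isFiniteMeasure_ballMeasure (d := d) (K := K) hν hcs
  have := Measure.isProbabilityMeasure_map (μ := P) hmeas.aemeasurable
  refine Measure.ext_of_moments _ _ (R := c * ∑ _k : Fin (n + 1), s) (R' := c * s) ?_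
    (norm_le_ae_ballMeasure hν hcs) fun ξ p => ?_
  · rw [ae_map_iff hmeas.aemeasurable (measurableSet_le (by fun_prop) measurable_const)]
    filter_upwards [hpos, F.renewal_mem_ae hR] with ω hω hω'
    rw [hω, norm_smul, Real.norm_of_nonneg hc.le]
    refine mul_le_mul_of_nonneg_left ((norm_sum_le _ _).trans (Finset.sum_le_sum fun k _ => ?_)) hc.le
    rw [norm_smul, norm_eq_of_mem_sphere, mul_one, Real.norm_of_nonneg (gaps_pos hs hω' k).le]
    exact gaps_le hs hω' k
  · rw [hinner]
    rcases Nat.even_or_odd' p with ⟨r, rfl | rfl⟩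
    · rw [(hM ξ).1, integral_ballMeasure_inner_pow_even hν hcs hK]
      ring
    · rw [(hM ξ).2 _ ⟨r, rfl⟩, integral_ballMeasure_inner_pow_odd hK0 hν ξ ⟨r, rfl⟩, mul_zero]

end RandomFlight

/-! ### The Barenblatt function as a profile -/

section Constants

variable {d : ℕ} {α m : ℝ}

theorem npmeBeta_pos (hα : 0 < α) (hm : 1 < m) : 0 < npmeBeta d α m := by
  have : 0 < m - 1 := by linarith
  unfold npmeBeta
  positivity

theorem npmeK_pos [NeZero d] (hα : 0 < α) (hm : 1 < m) : 0 < npmeK d α m := by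
  have : 0 < m - 1 := by linarith
  have hd : (0 : ℝ) < d := by exact_mod_cast (NeZero.pos d)
  have g1 : 0 < Real.Gamma ((d : ℝ) / 2) := Real.Gamma_pos_of_pos (by positivity)
  have g2 : 0 < Real.Gamma (1 + α / 2) := Real.Gamma_pos_of_pos (by positivity)
  have g3 : 0 < Real.Gamma (((d : ℝ) + α) / 2) := Real.Gamma_pos_of_pos (by positivity)
  unfold npmeK
  positivity

theorem npmeSpeed_pos [NeZero d] (hα : 0 < α) (hm : 1 < m) : 0 < npmeSpeed d α m := by
  have := npmeK_pos (d := d) hα hm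
  unfold npmeSpeed
  positivity

theorem npmeC_pos [NeZero d] (hα : 0 < α) (hm : 1 < m) : 0 < npmeC d α m := by
  have hk := npmeK_pos (d := d) hα hm
  have hν : 0 < α / (2 * (m - 1)) := div_pos hα (by linarith)
  have g1 : 0 < Real.Gamma ((d : ℝ) / 2 + α / (2 * (m - 1)) + 1) :=
    Real.Gamma_pos_of_pos (by positivity)
  have g2 : 0 < Real.Gamma (α / (2 * (m - 1)) + 1) := Real.Gamma_pos_of_pos (by positivity)
  unfold npmeC
  positivity

theorem npmeSpeed_mul_sq [NeZero d] (hα : 0 < α) (hm : 1 < m) {t : ℝ} (ht : 0 < t) :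
    (npmeSpeed d α m * t ^ npmeBeta d α m) ^ 2 =
      t ^ (2 * npmeBeta d α m) / npmeK d α m ^ (2 / α) := by
  have hk := npmeK_pos (d := d) hα hm
  rw [mul_pow, npmeSpeed, div_pow, one_pow, ← Real.rpow_mul_natCast hk.le,
    ← Real.rpow_mul_natCast ht.le]
  push_cast
  rw [show 1 / α * 2 = 2 / α by ring, mul_comm (npmeBeta d α m)]
  ring

theorem npmeDensity_eq_ballProfile [NeZero d] (hα : 0 < α) (hm : 1 < m) {t : ℝ} (ht : 0 < t)
    (x : EucSpace d) :
    npmeDensity d α m x t = ballProfile (npmeC d α m * t ^ (-(d * npmeBeta d α m)))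
      (α / (2 * (m - 1))) (npmeSpeed d α m * t ^ npmeBeta d α m) x := by
  have hk := npmeK_pos (d := d) hα hm
  rw [npmeDensity, ballProfile, npmeSpeed_mul_sq hα hm ht]
  congr 4
  field_simp

theorem npmeC_mul_rpow [NeZero d] (hα : 0 < α) (hm : 1 < m) {t : ℝ} (ht : 0 < t) :
    npmeC d α m * t ^ (-(d * npmeBeta d α m)) =
      Real.Gamma ((d : ℝ) / 2 + α / (2 * (m - 1)) + 1) / (Real.pi ^ ((d : ℝ) / 2) *
        Real.Gamma (α / (2 * (m - 1)) + 1) * (npmeSpeed d α m * t ^ npmeBeta d α m) ^ d) := by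
  have hk := npmeK_pos (d := d) hα hm
  have h1 : (npmeSpeed d α m * t ^ npmeBeta d α m) ^ d =
      t ^ (d * npmeBeta d α m) / npmeK d α m ^ (d / α) := by
    rw [mul_pow, npmeSpeed, div_pow, one_pow, ← Real.rpow_mul_natCast hk.le,
      ← Real.rpow_mul_natCast ht.le, mul_comm (npmeBeta d α m), one_div_mul_eq_div]
    ring_nf
  rw [h1, npmeC, Real.rpow_neg ht.le]
  have h2 := (Real.rpow_pos_of_pos hk (d / α)).ne'
  have h3 := (Real.rpow_pos_of_pos ht (d * npmeBeta d α m)).ne'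
  field_simp

end Constants

/-! ### The law of the flight in the three linked cases. -/

theorem RandomFlight.map_position_npme {Ω : Type*} [MeasurableSpace Ω] {d n : ℕ} [NeZero d]
    {α m q t : ℝ} (hα : 0 < α) (hm : 1 < m) (F : RandomFlight d n Ω) (ht : 0 < t)
    (P : Measure Ω) [IsProbabilityMeasure P]
    (hR : F.HasRenewalDensity (dirichletRenewalDensity n q (t ^ npmeBeta d α m)) P)
    (hM : F.HasProfileMoments P (t ^ npmeBeta d α m) ((d : ℝ) / 2 + α / (2 * (m - 1)) + 1)) :
    P.map (F.position (npmeSpeed d α m) (t ^ npmeBeta d α m)) =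
      volume.withDensity (fun x => ENNReal.ofReal (npmeDensity d α m x t)) := by
  have hν : 0 < α / (2 * (m - 1)) := div_pos hα (by linarith)
  rw [F.map_position_eq (Real.rpow_pos_of_pos ht _) hR hν (npmeSpeed_pos hα hm)
    (npmeC_mul_rpow hα hm ht) hM, ballMeasure]
  simp_rw [npmeDensity_eq_ballProfile hα hm ht]

theorem RandomFlight.map_position_of_link {Ω : Type*} [MeasurableSpace Ω] (d n : ℕ) (hn : 1 ≤ n)
    (α m : ℝ) (hα : 0 < α) (f : ℝ → (Fin n → ℝ) → ℝ)
    (hlink :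
      (d = 1 ∧ f = uniformRenewalDensity n ∧
        ((Odd n ∧ 3 ≤ n ∧ m = α / ((n : ℝ) - 1) + 1) ∨
          (Even n ∧ 4 ≤ n ∧ m = α / ((n : ℝ) - 2) + 1))) ∨
      (2 ≤ d ∧ f = dirichletRenewalDensity n ((d : ℝ) - 1) ∧
        (d : ℝ) > 2 / n + 1 ∧ m = α / (n * ((d : ℝ) - 1) - 2) + 1) ∨
      (3 ≤ d ∧ f = dirichletRenewalDensity n ((d : ℝ) / 2 - 1) ∧
        (d : ℝ) > 2 / n + 2 ∧ m = α / (n * ((d : ℝ) - 2) - 2) + 1))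
    (F : RandomFlight d n Ω) :
    d ≠ 0 ∧ 1 < m ∧ ∀ t : ℝ, 0 < t → ∀ (P : Measure Ω) [IsProbabilityMeasure P],
      F.IsIsotropic P → F.HasRenewalDensity (f (t ^ npmeBeta d α m)) P →
      P.map (F.position (npmeSpeed d α m) (t ^ npmeBeta d α m)) =
        volume.withDensity (fun x => ENNReal.ofReal (npmeDensity d α m x t)) := by
  have hn0 : (0 : ℝ) < n := by exact_mod_cast hn
  -- With D = α / (m - 1) the exponent of the profile is ν = D / 2. The restrictions on d and n in
  -- the three cases amount to D > 0.
  have key : ∀ D : ℝ, 0 < D → m = α / D + 1 → 1 < m ∧ α / (2 * (m - 1)) = D / 2 := by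
    intro D hD h
    have : 0 < α / D := by positivity
    refine ⟨by linarith, ?_⟩
    rw [h, add_sub_cancel_right]
    field_simp
  rcases hlink with ⟨hd, hf, hcase⟩ | ⟨hd, hf, hdn, hm⟩ | ⟨hd, hf, hdn, hm⟩
  · have : NeZero d := ⟨by omega⟩
    obtain ⟨D, hD, hm, hb⟩ : ∃ D : ℝ, 0 < D ∧ m = α / D + 1 ∧
        ((Odd n ∧ (d : ℝ) / 2 + D / 2 + 1 = ((n : ℝ) + 2) / 2) ∨
          (Even n ∧ (d : ℝ) / 2 + D / 2 + 1 = ((n : ℝ) + 1) / 2)) := by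
      rw [hd]
      rcases hcase with ⟨ho, h3, hm⟩ | ⟨he, h4, hm⟩
      · have : (3 : ℝ) ≤ n := by exact_mod_cast h3
        exact ⟨_, by linarith, hm, Or.inl ⟨ho, by push_cast; ring⟩⟩
      · have : (4 : ℝ) ≤ n := by exact_mod_cast h4
        exact ⟨_, by linarith, hm, Or.inr ⟨he, by push_cast; ring⟩⟩
    obtain ⟨hm1, hν⟩ := key D hD hm
    refine ⟨by omega, hm1, fun t ht P _ hP hR => ?_⟩
    have hs := Real.rpow_pos_of_pos ht (npmeBeta d α m)
    rw [hf, uniformRenewalDensity_eq] at hR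
    refine F.map_position_npme hα hm1 ht P hR ?_
    rw [hν]
    exact F.hasProfileMoments_one hd hs hP hR hb
  · have : NeZero d := ⟨by omega⟩
    have hD : 0 < n * ((d : ℝ) - 1) - 2 := by
      have h : 2 / (n : ℝ) < d - 1 := by linarith
      rw [div_lt_iff₀ hn0] at h
      linarith
    obtain ⟨hm1, hν⟩ := key _ hD hm
    refine ⟨by omega, hm1, fun t ht P _ hP hR => ?_⟩
    have hs := Real.rpow_pos_of_pos ht (npmeBeta d α m)
    rw [hf] at hR
    refine F.map_position_npme hα hm1 ht P hR ?_
    rw [hν]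
    have h := F.hasProfileMoments_sub_one hd hs hP hR
    convert h using 1
    ring
  · have : NeZero d := ⟨by omega⟩
    have hD : 0 < n * ((d : ℝ) - 2) - 2 := by
      have h : 2 / (n : ℝ) < d - 2 := by linarith
      rw [div_lt_iff₀ hn0] at h
      linarith
    obtain ⟨hm1, hν⟩ := key _ hD hm
    refine ⟨by omega, hm1, fun t ht P _ hP hR => ?_⟩
    have hs := Real.rpow_pos_of_pos ht (npmeBeta d α m)
    rw [hf] at hR
    refine F.map_position_npme hα hm1 ht P hR ?_
    rw [hν]
    have h := F.hasProfileMoments_half_sub_one hd hs hP hR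
    convert h using 1
    ring

/-! ### A Riesz-type integral on a chord -/

theorem image_Ioo_of_inverse {f g : ℝ → ℝ} {a b c d : ℝ} (hf : ∀ x ∈ Ioo a b, f x ∈ Ioo c d)
    (hg : ∀ y ∈ Ioo c d, g y ∈ Ioo a b) (hfg : ∀ y ∈ Ioo c d, f (g y) = y) :
    f '' Ioo a b = Ioo c d := by
  refine Subset.antisymm (by rintro _ ⟨x, hx, rfl⟩; exact hf x hx) fun y hy => ?_
  exact ⟨g y, hg y hy, hfg y hy⟩

/-- The kernel that appears after the first Möbius substitution. -/
noncomputable def mobiusKernel (a p m s : ℝ) : ℝ :=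
  (p * m) ^ (1 - a) * (p + m) ^ (2 * a - 1) * 2 ^ (2 - 2 * a) *
    ((1 - s ^ 2) ^ (a - 1) * s ^ (1 - 2 * a)) * (1 / ((p + m) - (p - m) * s))

theorem mobius_denominator_pos {p m s : ℝ} (hp : 0 < p) (hm : 0 < m) (hs : s ∈ Ioo (0 : ℝ) 1) :
    0 < (p + m) - (p - m) * s := by
  nlinarith [hs.1, hs.2, mul_pos hp (sub_pos.2 hs.2), mul_pos hm hs.1]

theorem mobius_rpow_identity (a : ℝ) {q P S D s c : ℝ} (hq : 0 < q) (hP : 0 < P) (hS : 0 < S)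
    (hD : 0 < D) (hs : 0 < s) (hc : 0 < c) :
    q * c * P / D ^ 2 * ((q * P ^ 2 * S / D ^ 2) ^ (a - 1) * (q * c * s / D) ^ (1 - 2 * a)) =
      q ^ (1 - a) * P ^ (2 * a - 1) * c ^ (2 - 2 * a) * (S ^ (a - 1) * s ^ (1 - 2 * a)) *
        (1 / D) := by
  -- Every base is written as an exponential, so that an identity of real powers becomes a
  -- polynomial identity of exponents.
  obtain ⟨q, rfl⟩ : ∃ u, Real.exp u = q := ⟨_, Real.exp_log hq⟩
  obtain ⟨P, rfl⟩ : ∃ u, Real.exp u = P := ⟨_, Real.exp_log hP⟩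
  obtain ⟨S, rfl⟩ : ∃ u, Real.exp u = S := ⟨_, Real.exp_log hS⟩
  obtain ⟨D, rfl⟩ : ∃ u, Real.exp u = D := ⟨_, Real.exp_log hD⟩
  obtain ⟨s, rfl⟩ : ∃ u, Real.exp u = s := ⟨_, Real.exp_log hs⟩
  obtain ⟨c, rfl⟩ : ∃ u, Real.exp u = c := ⟨_, Real.exp_log hc⟩
  simp only [← Real.exp_nat_mul, ← Real.exp_add, ← Real.exp_sub, ← Real.exp_mul, one_div,
    ← Real.exp_neg]
  congr 1
  push_cast
  ring

theorem mobius_rpow_identity' (a : ℝ) {q P S E s c : ℝ} (hq : 0 < q) (hP : 0 < P) (hS : 0 < S)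
    (hE : 0 < E) (hs : 0 < s) (hc : 0 < c) :
    c ^ 3 * q * P ^ 2 * s / E ^ 2 *
      ((c ^ 2 * q * s ^ 2 / E) ^ (-a) * (P ^ 2 * S / E) ^ (a - 1)) =
      q ^ (1 - a) * P ^ (2 * a - 1) * c ^ (2 - 2 * a) * (S ^ (a - 1) * s ^ (1 - 2 * a)) *
        (c * P / E) := by
  obtain ⟨q, rfl⟩ : ∃ u, Real.exp u = q := ⟨_, Real.exp_log hq⟩
  obtain ⟨P, rfl⟩ : ∃ u, Real.exp u = P := ⟨_, Real.exp_log hP⟩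
  obtain ⟨S, rfl⟩ : ∃ u, Real.exp u = S := ⟨_, Real.exp_log hS⟩
  obtain ⟨E, rfl⟩ : ∃ u, Real.exp u = E := ⟨_, Real.exp_log hE⟩
  obtain ⟨s, rfl⟩ : ∃ u, Real.exp u = s := ⟨_, Real.exp_log hs⟩
  obtain ⟨c, rfl⟩ : ∃ u, Real.exp u = c := ⟨_, Real.exp_log hc⟩
  simp only [← Real.exp_nat_mul, ← Real.exp_add, ← Real.exp_sub, ← Real.exp_mul]
  congr 1
  push_cast
  ring

/-- The Möbius map `f` sends 0, 1, -1 to 0, p, -m. Hence p - r and r + m become multiples of 1 - s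
and 1 + s over a common denominator, and apart from the factor 1 / ((p + m) - (p - m) s) the new
integrand is symmetric in p and m. -/
theorem lintegral_half_chord {a p m : ℝ} (hp : 0 < p) (hm : 0 < m) :
    ∫⁻ r in Ioo 0 p, ENNReal.ofReal (((p - r) * (r + m)) ^ (a - 1) * r ^ (1 - 2 * a)) =
      ∫⁻ s in Ioo (0 : ℝ) 1, ENNReal.ofReal (mobiusKernel a p m s) := by
  have hpm : 0 < p + m := by positivity
  set f : ℝ → ℝ := fun s => 2 * p * m * s / ((p + m) - (p - m) * s) with hf
  set f' : ℝ → ℝ := fun s => 2 * p * m * (p + m) / ((p + m) - (p - m) * s) ^ 2 with hf'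
  have e1 : ∀ s ∈ Ioo (0 : ℝ) 1, p - f s = p * (p + m) * (1 - s) / ((p + m) - (p - m) * s) := by
    intro s hs
    have h := (mobius_denominator_pos hp hm hs).ne'
    simp only [hf]
    obtain ⟨D, hD⟩ : ∃ D, D = (p + m) - (p - m) * s := ⟨_, rfl⟩
    rw [← hD] at h ⊢
    field_simp
    rw [hD]; ring
  have e2 : ∀ s ∈ Ioo (0 : ℝ) 1, f s + m = m * (p + m) * (1 + s) / ((p + m) - (p - m) * s) := by
    intro s hs
    have h := (mobius_denominator_pos hp hm hs).ne'
    simp only [hf]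
    obtain ⟨D, hD⟩ : ∃ D, D = (p + m) - (p - m) * s := ⟨_, rfl⟩
    rw [← hD] at h ⊢
    field_simp
    rw [hD]; ring
  have hfpos : ∀ s ∈ Ioo (0 : ℝ) 1, 0 < f s := fun s hs => by
    have := mobius_denominator_pos hp hm hs
    have := hs.1
    simp only [hf]; positivity
  have himg : f '' Ioo 0 1 = Ioo 0 p := by
    refine image_Ioo_of_inverse (g := fun r => (p + m) * r / (2 * p * m + (p - m) * r)) ?_ ?_ ?_
    · intro s hs
      refine ⟨hfpos s hs, ?_⟩
      have h := e1 s hs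
      have := mobius_denominator_pos hp hm hs
      have h1 := sub_pos.2 hs.2
      have : 0 < p - f s := by rw [h]; positivity
      linarith
    · intro r hr
      have h1 : 0 < 2 * p * m + (p - m) * r := by
        nlinarith [hr.1, hr.2, mul_pos hp hr.1, mul_pos hm (sub_pos.2 hr.2), mul_pos hp hm]
      have := hr.1
      refine ⟨by positivity, ?_⟩
      rw [div_lt_one h1]
      nlinarith [mul_pos hm (sub_pos.2 hr.2)]
    · intro r hr
      have h1 : 0 < 2 * p * m + (p - m) * r := by
        nlinarith [hr.1, hr.2, mul_pos hp hr.1, mul_pos hm (sub_pos.2 hr.2), mul_pos hp hm]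
      have h2 : (p + m) - (p - m) * ((p + m) * r / (2 * p * m + (p - m) * r)) =
          (p + m) * (2 * p * m) / (2 * p * m + (p - m) * r) := by
        obtain ⟨D, hD⟩ : ∃ D, D = 2 * p * m + (p - m) * r := ⟨_, rfl⟩
        rw [← hD] at h1 ⊢
        field_simp
        rw [hD]; ring
      simp only [hf]
      rw [h2]
      generalize 2 * p * m + (p - m) * r = X at *
      field_simp
  have hderiv : ∀ s ∈ Ioo (0 : ℝ) 1, HasDerivWithinAt f (f' s) (Ioo 0 1) s := by
    intro s hs
    have hD := (mobius_denominator_pos hp hm hs).ne'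
    have h1 : HasDerivAt (fun s : ℝ => 2 * p * m * s) (2 * p * m * 1) s :=
      (hasDerivAt_id s).const_mul _
    have h2 : HasDerivAt (fun s : ℝ => (p + m) - (p - m) * s) (-((p - m) * 1)) s :=
      ((hasDerivAt_id s).const_mul _).const_sub _
    have h3 := (h1.div h2 hD).hasDerivWithinAt (s := Ioo 0 1)
    refine h3.congr_deriv ?_
    simp only [hf']
    congr 1
    ring
  have hinj : InjOn f (Ioo 0 1) := by
    intro s hs s' hs' h
    have hD := mobius_denominator_pos hp hm hs
    have hD' := mobius_denominator_pos hp hm hs'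
    simp only [hf] at h
    rw [div_eq_div_iff hD.ne' hD'.ne'] at h
    have h0 : (2 * p * m * (p + m)) * (s - s') = 0 := by linear_combination h
    have h1 : 2 * p * m * (p + m) ≠ 0 := by positivity
    linarith [(mul_eq_zero.1 h0).resolve_left h1]
  rw [← himg, lintegral_image_eq_lintegral_abs_deriv_mul measurableSet_Ioo hderiv hinj]
  refine setLIntegral_congr_fun measurableSet_Ioo fun s hs => ?_
  have hD := mobius_denominator_pos hp hm hs
  have hs0 := hs.1
  have h1 : 0 < 1 - s ^ 2 := by nlinarith [hs.1, hs.2]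
  rw [← ENNReal.ofReal_mul (abs_nonneg _), abs_of_pos (by simp only [hf']; positivity), e1 s hs,
    e2 s hs, mobiusKernel]
  congr 1
  simp only [hf, hf']
  generalize (p + m) - (p - m) * s = D at *
  have e3 : p * (p + m) * (1 - s) / D * (m * (p + m) * (1 + s) / D) =
      p * m * (p + m) ^ 2 * (1 - s ^ 2) / D ^ 2 := by field_simp; ring
  rw [e3, ← mobius_rpow_identity a (by positivity) hpm h1 hD hs0 two_pos]
  ring_nf

/-- In the sum of the two half chords, 1 / ((p + m) - (p - m) s) + 1 / ((p + m) + (p - m) s) is a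
function of s², and T = 4 p m s² / ((p + m)² - (p - m)² s²) turns the whole into ∫ T^(-a) (1 -
T)^(a-1) dT. Both p and m have disappeared; this is the source of the linearity of the fractional
gradient. -/
theorem lintegral_chord {a p m : ℝ} (ha : 0 < a) (ha1 : a < 1) (hp : 0 < p) (hm : 0 < m) :
    (∫⁻ r in Ioo 0 p, ENNReal.ofReal (((p - r) * (r + m)) ^ (a - 1) * r ^ (1 - 2 * a))) +
      (∫⁻ r in Ioo 0 m, ENNReal.ofReal (((m - r) * (r + p)) ^ (a - 1) * r ^ (1 - 2 * a))) =
      ENNReal.ofReal (Real.Gamma a * Real.Gamma (1 - a)) := by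
  have hpm : 0 < p + m := by positivity
  have hE : ∀ s ∈ Ioo (0 : ℝ) 1, 0 < (p + m) ^ 2 - (p - m) ^ 2 * s ^ 2 := by
    intro s hs
    have h1 := mobius_denominator_pos hp hm hs
    have h2 := mobius_denominator_pos hm hp hs
    nlinarith [mul_pos h1 h2]
  obtain ⟨hb1, hb2⟩ := integrableOn_beta_unit (u := 1 - a) (v := a) (by linarith) ha
  have hB : ∫⁻ T in Ioo (0 : ℝ) 1, ENNReal.ofReal (T ^ (-a) * (1 - T) ^ (a - 1)) =
      ENNReal.ofReal (Real.Gamma a * Real.Gamma (1 - a)) := by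
    have h1 : beta (1 - a) a = Real.Gamma a * Real.Gamma (1 - a) := by
      rw [beta, sub_add_cancel, Real.Gamma_one, div_one, mul_comm]
    rw [← h1, ← hb2, ofReal_integral_eq_lintegral_ofReal hb1]
    · rw [show 1 - a - 1 = -a by ring]
    · refine (ae_restrict_iff' measurableSet_Ioo).2 (Filter.Eventually.of_forall fun x hx => ?_)
      exact mul_nonneg (Real.rpow_nonneg hx.1.le _) (Real.rpow_nonneg (by linarith [hx.2]) _)
  set f : ℝ → ℝ := fun s => 4 * p * m * s ^ 2 / ((p + m) ^ 2 - (p - m) ^ 2 * s ^ 2) with hf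
  set f' : ℝ → ℝ := fun s => 8 * p * m * (p + m) ^ 2 * s /
    ((p + m) ^ 2 - (p - m) ^ 2 * s ^ 2) ^ 2 with hf'
  have e1 : ∀ s ∈ Ioo (0 : ℝ) 1,
      1 - f s = (p + m) ^ 2 * (1 - s ^ 2) / ((p + m) ^ 2 - (p - m) ^ 2 * s ^ 2) := by
    intro s hs
    have h := (hE s hs).ne'
    simp only [hf]
    rw [eq_div_iff h, sub_mul, div_mul_cancel₀ _ h]
    ring
  have himg : f '' Ioo 0 1 = Ioo 0 1 := by
    refine image_Ioo_of_inverse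
      (g := fun T => √((p + m) ^ 2 * T / (4 * p * m + (p - m) ^ 2 * T))) ?_ ?_ ?_
    · intro s hs
      have := hE s hs
      have hs0 := hs.1
      have h1 : 0 < 1 - s ^ 2 := by nlinarith [hs.1, hs.2]
      have h2 : 0 < 1 - f s := by rw [e1 s hs]; positivity
      exact ⟨by simp only [hf]; positivity, by linarith⟩
    · intro T hT
      have := hT.1
      have h1 : 0 < 4 * p * m + (p - m) ^ 2 * T := by positivity
      refine ⟨Real.sqrt_pos.2 (by positivity), ?_⟩
      rw [Real.sqrt_lt' one_pos, one_pow, div_lt_one h1]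
      nlinarith [mul_pos (mul_pos hp hm) (sub_pos.2 hT.2)]
    · intro T hT
      have := hT.1
      have h1 : 0 < 4 * p * m + (p - m) ^ 2 * T := by positivity
      simp only [hf]
      rw [Real.sq_sqrt (by positivity)]
      have h2 : (p + m) ^ 2 - (p - m) ^ 2 * ((p + m) ^ 2 * T / (4 * p * m + (p - m) ^ 2 * T)) =
          (p + m) ^ 2 * (4 * p * m) / (4 * p * m + (p - m) ^ 2 * T) := by
        obtain ⟨D, hD⟩ : ∃ D, D = 4 * p * m + (p - m) ^ 2 * T := ⟨_, rfl⟩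
        rw [← hD] at h1 ⊢
        field_simp
        rw [hD]; ring
      rw [h2]
      generalize 4 * p * m + (p - m) ^ 2 * T = X at *
      field_simp
  have hderiv : ∀ s ∈ Ioo (0 : ℝ) 1, HasDerivWithinAt f (f' s) (Ioo 0 1) s := by
    intro s hs
    have hD := (hE s hs).ne'
    have h1 : HasDerivAt (fun s : ℝ => 4 * p * m * s ^ 2) (4 * p * m * (2 * s)) s := by
      simpa using (hasDerivAt_pow 2 s).const_mul (4 * p * m)
    have h2 : HasDerivAt (fun s : ℝ => (p + m) ^ 2 - (p - m) ^ 2 * s ^ 2)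
        (-((p - m) ^ 2 * (2 * s))) s := by
      simpa using ((hasDerivAt_pow 2 s).const_mul ((p - m) ^ 2)).const_sub ((p + m) ^ 2)
    have h3 := (h1.div h2 hD).hasDerivWithinAt (s := Ioo 0 1)
    refine h3.congr_deriv ?_
    simp only [hf']
    congr 1
    ring
  have hinj : InjOn f (Ioo 0 1) := by
    intro s hs s' hs' h
    simp only [hf] at h
    rw [div_eq_div_iff (hE s hs).ne' (hE s' hs').ne'] at h
    have h0 : (4 * p * m * (p + m) ^ 2 * (s + s')) * (s - s') = 0 := by linear_combination h
    have := hs.1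
    have := hs'.1
    have h1 : 4 * p * m * (p + m) ^ 2 * (s + s') ≠ 0 := by positivity
    linarith [(mul_eq_zero.1 h0).resolve_left h1]
  rw [lintegral_half_chord hp hm, lintegral_half_chord hm hp, ← hB]
  conv_rhs => rw [← himg]
  rw [lintegral_image_eq_lintegral_abs_deriv_mul measurableSet_Ioo hderiv hinj,
    ← lintegral_add_left (by unfold mobiusKernel; fun_prop)]
  refine setLIntegral_congr_fun measurableSet_Ioo fun s hs => ?_
  have hD := mobius_denominator_pos hp hm hs
  have hD' := mobius_denominator_pos hm hp hs
  have hEs := hE s hs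
  have hs0 := hs.1
  have h1 : 0 < 1 - s ^ 2 := by nlinarith [hs.1, hs.2]
  have hk : ∀ p m : ℝ, 0 < p → 0 < m → 0 ≤ mobiusKernel a p m s := by
    intro p m hp hm
    have := mobius_denominator_pos hp hm hs
    unfold mobiusKernel
    positivity
  rw [← ENNReal.ofReal_mul (abs_nonneg _), abs_of_pos (by simp only [hf']; positivity), e1 s hs,
    ← ENNReal.ofReal_add (hk p m hp hm) (hk m p hm hp), mobiusKernel, mobiusKernel]
  congr 1
  simp only [hf, hf']
  rw [mul_comm m p, add_comm m p, ← mul_add]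
  have e5 : 1 / ((p + m) - (p - m) * s) + 1 / ((p + m) - (m - p) * s) =
      2 * (p + m) / ((p + m) ^ 2 - (p - m) ^ 2 * s ^ 2) := by
    rw [add_comm m p] at hD'
    obtain ⟨D, h2⟩ : ∃ D, D = (p + m) - (p - m) * s := ⟨_, rfl⟩
    obtain ⟨D', h3⟩ : ∃ D', D' = (p + m) - (m - p) * s := ⟨_, rfl⟩
    have h4 : (p + m) ^ 2 - (p - m) ^ 2 * s ^ 2 = D * D' := by rw [h2, h3]; ring
    rw [h4, ← h2, ← h3]
    rw [← h2] at hD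
    rw [← h3] at hD'
    field_simp
    rw [h2, h3]; ring
  rw [e5]
  generalize (p + m) ^ 2 - (p - m) ^ 2 * s ^ 2 = E at *
  rw [← mobius_rpow_identity' a (by positivity) hpm h1 hEs hs0 two_pos]
  ring_nf

theorem intervalIntegral_max_rpow {a : ℝ} (ha : 0 < a) (ha1 : a < 1) (u : ℝ) :
    IntervalIntegrable (fun x : ℝ => (max x 0) ^ (a - 1)) volume 0 u ∧
      ∫ x in (0 : ℝ)..u, (max x 0) ^ (a - 1) = (max u 0) ^ a / a := by
  rcases le_or_gt 0 u with h | h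
  · have heq : ∀ x ∈ uIcc 0 u, x ^ (a - 1) = (max x 0) ^ (a - 1) := by
      intro x hx
      rw [uIcc_of_le h] at hx
      rw [max_eq_left hx.1]
    constructor
    · exact (intervalIntegral.intervalIntegrable_rpow' (by linarith)).congr
        (fun x hx => heq x (uIoc_subset_uIcc hx))
    · rw [← intervalIntegral.integral_congr heq, integral_rpow (Or.inl (by linarith)),
        sub_add_cancel, Real.zero_rpow ha.ne', sub_zero, max_eq_left h]
  · have heq : ∀ x ∈ uIcc 0 u, (0 : ℝ) = (max x 0) ^ (a - 1) := by
      intro x hx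
      rw [uIcc_of_ge h.le] at hx
      rw [max_eq_right hx.2, Real.zero_rpow (by linarith)]
    constructor
    · exact (intervalIntegrable_const (c := (0 : ℝ))).congr
        (fun x hx => heq x (uIoc_subset_uIcc hx))
    · rw [← intervalIntegral.integral_congr heq, max_eq_right h.le, Real.zero_rpow ha.ne']
      simp

/-- The fundamental theorem of calculus in the slope τ. It turns a difference of powers into an
integral of nonnegative functions, to which Tonelli applies. -/
theorem lintegral_max_rpow_affine {a : ℝ} (ha : 0 < a) (ha1 : a < 1) {B r e : ℝ} (hr : 0 < r)
    (he : 0 ≤ e) :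
    ENNReal.ofReal ((max (B + 2 * e * r) 0) ^ a - (max (B - 2 * e * r) 0) ^ a) =
      ENNReal.ofReal (2 * a * r) *
        ∫⁻ τ in Ioo (-e) e, ENNReal.ofReal ((max (B + 2 * τ * r) 0) ^ (a - 1)) := by
  have hi : ∀ u v : ℝ, IntervalIntegrable (fun x : ℝ => (max x 0) ^ (a - 1)) volume u v :=
    fun u v => (intervalIntegral_max_rpow ha ha1 u).1.symm.trans (intervalIntegral_max_rpow ha ha1 v).1
  have h2r : (2 * r) ≠ 0 := by positivity
  have h1 : ∫ τ in (-e)..e, (max (B + (2 * r) * τ) 0) ^ (a - 1) = (2 * r)⁻¹ *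
      (((max (B + 2 * e * r) 0) ^ a - (max (B - 2 * e * r) 0) ^ a) / a) := by
    rw [intervalIntegral.integral_comp_add_mul (fun x => (max x 0) ^ (a - 1)) h2r B,
      ← intervalIntegral.integral_interval_sub_left (hi 0 _) (hi 0 _),
      (intervalIntegral_max_rpow ha ha1 _).2, (intervalIntegral_max_rpow ha ha1 _).2, smul_eq_mul,
      show B + 2 * r * e = B + 2 * e * r by ring, show B + 2 * r * -e = B - 2 * e * r by ring]
    ring
  have h2 : IntegrableOn (fun τ => (max (B + 2 * τ * r) 0) ^ (a - 1)) (Ioo (-e) e) := by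
    have h3 := ((hi (B + (2 * r) * (-e)) (B + (2 * r) * e)).comp_add_left B).comp_mul_left (c := 2 * r)
    have h4 : IntervalIntegrable (fun τ => (max (B + (2 * r) * τ) 0) ^ (a - 1)) volume (-e) e := by
      have h6 : -(2 * r * e) / (2 * r) = -e := by field_simp
      simpa [h2r, h6] using h3
    rw [intervalIntegrable_iff_integrableOn_Ioo_of_le (by linarith)] at h4
    refine h4.congr_fun (fun τ _ => ?_) measurableSet_Ioo
    ring_nf
  rw [← ofReal_integral_eq_lintegral_ofReal h2 (Filter.Eventually.of_forall fun τ =>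
      Real.rpow_nonneg (le_max_right _ _) _), ← ENNReal.ofReal_mul (by positivity)]
  congr 1
  rw [← integral_Ioc_eq_integral_Ioo, ← intervalIntegral.integral_of_le (by linarith)]
  have h5 : ∀ τ : ℝ, B + 2 * τ * r = B + (2 * r) * τ := fun τ => by ring
  simp_rw [h5]
  rw [h1]
  field_simp

/-- With R = √(A + τ²) the quadratic is ((R + τ) - r)(r + (R - τ)), and changing the sign of τ
exchanges p = R + τ with m = R - τ. So the two integrals are the two half chords. -/
theorem lintegral_Ioi_chord {a A : ℝ} (ha : 0 < a) (ha1 : a < 1) (hA : 0 < A) (τ : ℝ) :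
    (∫⁻ r in Ioi (0 : ℝ), ENNReal.ofReal ((max (A - r ^ 2 + 2 * τ * r) 0) ^ (a - 1) *
        r ^ (1 - 2 * a))) +
      (∫⁻ r in Ioi (0 : ℝ), ENNReal.ofReal ((max (A - r ^ 2 + 2 * (-τ) * r) 0) ^ (a - 1) *
        r ^ (1 - 2 * a))) = ENNReal.ofReal (Real.Gamma a * Real.Gamma (1 - a)) := by
  set R := √(A + τ ^ 2) with hR
  have hRsq : R ^ 2 = A + τ ^ 2 := Real.sq_sqrt (by positivity)
  have habs : |τ| < R := by
    rw [← Real.sqrt_sq_eq_abs]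
    exact Real.sqrt_lt_sqrt (sq_nonneg _) (by linarith)
  obtain ⟨h1, h2⟩ := abs_lt.1 habs
  have key : ∀ σ : ℝ, R ^ 2 = A + σ ^ 2 → -R < σ → σ < R →
      ∫⁻ r in Ioi (0 : ℝ), ENNReal.ofReal ((max (A - r ^ 2 + 2 * σ * r) 0) ^ (a - 1) *
        r ^ (1 - 2 * a)) =
      ∫⁻ r in Ioo 0 (R + σ), ENNReal.ofReal ((((R + σ) - r) * (r + (R - σ))) ^ (a - 1) *
        r ^ (1 - 2 * a)) := by
    intro σ hσ h1 h2
    have hfac : ∀ r, A - r ^ 2 + 2 * σ * r = ((R + σ) - r) * (r + (R - σ)) := fun r => by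
      linear_combination -hσ
    rw [← lintegral_indicator measurableSet_Ioi, ← lintegral_indicator measurableSet_Ioo]
    congr 1
    ext r
    by_cases h0 : 0 < r
    · rw [indicator_of_mem (mem_Ioi.2 h0), hfac]
      by_cases h3 : r < R + σ
      · rw [indicator_of_mem (show r ∈ Ioo 0 (R + σ) from ⟨h0, h3⟩), max_eq_left]
        exact mul_nonneg (by linarith) (by linarith)
      -- The exponent a - 1 is negative, yet `0 ^ (a - 1) = 0` for real powers because a ≠ 1; so the
      -- truncated power vanishes off the chord.
      · rw [indicator_of_notMem (show r ∉ Ioo 0 (R + σ) from fun h => h3 h.2), max_eq_right, Real.zero_rpow (by linarith),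
          zero_mul, ENNReal.ofReal_zero]
        exact mul_nonpos_of_nonpos_of_nonneg (by linarith) (by linarith)
    · rw [indicator_of_notMem (show r ∉ Ioi (0 : ℝ) from h0),
        indicator_of_notMem (show r ∉ Ioo 0 (R + σ) from fun h => h0 h.1)]
  rw [key τ hRsq h1 h2, key (-τ) (by rw [hRsq]; ring) (by linarith) (by linarith),
    show R - -τ = R + τ by ring, show R + -τ = R - τ by ring]
  exact lintegral_chord ha ha1 (by linarith) (by linarith)

/-- The difference is an integral over slopes τ in (-e, e). After exchanging the integrals only ∫
L(τ) dτ is left, and since L(τ) + L(-τ) is constant this is e times that constant. In `ℝ≥0∞` the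
exchange needs no integrability. -/
theorem integral_chord_of_nonneg {a A e : ℝ} (ha : 0 < a) (ha1 : a < 1) (hA : 0 < A) (he : 0 ≤ e) :
    ∫ r in Ioi (0 : ℝ), ((max (A - r ^ 2 + 2 * e * r) 0) ^ a -
      (max (A - r ^ 2 - 2 * e * r) 0) ^ a) * r ^ (-(2 * a)) =
      2 * Real.Gamma (1 + a) * Real.Gamma (1 - a) * e := by
  have g1 := Real.Gamma_pos_of_pos ha
  have g2 : 0 < Real.Gamma (1 - a) := Real.Gamma_pos_of_pos (by linarith)
  set L : ℝ → ℝ≥0∞ := fun τ => ∫⁻ r in Ioi (0 : ℝ),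
    ENNReal.ofReal ((max (A - r ^ 2 + 2 * τ * r) 0) ^ (a - 1) * r ^ (1 - 2 * a)) with hL
  have hLsum : ∀ τ, L τ + L (-τ) = ENNReal.ofReal (Real.Gamma a * Real.Gamma (1 - a)) :=
    fun τ => lintegral_Ioi_chord ha ha1 hA τ
  have hmeas : Measurable (fun z : ℝ × ℝ =>
      ENNReal.ofReal ((max (A - z.1 ^ 2 + 2 * z.2 * z.1) 0) ^ (a - 1) * z.1 ^ (1 - 2 * a))) := by
    fun_prop
  have hLm : Measurable L := (hmeas.comp measurable_swap).lintegral_prod_right'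
  have hLint : ∫⁻ τ in Ioo (-e) e, L τ =
      ENNReal.ofReal (e * (Real.Gamma a * Real.Gamma (1 - a))) := by
    have h1 : ∫⁻ τ in Ioo (-e) e, L (-τ) = ∫⁻ τ in Ioo (-e) e, L τ := by
      have h := (Measure.measurePreserving_neg (volume : Measure ℝ)).setLIntegral_comp_preimage
        (s := Ioo (-e) e) measurableSet_Ioo hLm
      rw [← h]
      congr 2
      ext τ
      simp only [mem_Ioo, mem_preimage]
      constructor <;> rintro ⟨h1, h2⟩ <;> constructor <;> linarith
    have h2 : 2 * ∫⁻ τ in Ioo (-e) e, L τ =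
        2 * ENNReal.ofReal (e * (Real.Gamma a * Real.Gamma (1 - a))) := by
      rw [two_mul]
      conv_lhs => rw [← h1]
      rw [h1]
      nth_rewrite 2 [← h1]
      rw [← lintegral_add_left hLm]
      simp_rw [hLsum]
      rw [setLIntegral_const, Real.volume_Ioo, ← ENNReal.ofReal_mul (by positivity),
        ← ENNReal.ofReal_ofNat, ← ENNReal.ofReal_mul (by positivity)]
      congr 1; ring
    exact (ENNReal.mul_right_inj two_ne_zero ENNReal.ofNat_ne_top).1 h2
  have hnn : ∀ r ∈ Ioi (0 : ℝ), 0 ≤ ((max (A - r ^ 2 + 2 * e * r) 0) ^ a -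
      (max (A - r ^ 2 - 2 * e * r) 0) ^ a) * r ^ (-(2 * a)) := by
    intro r hr
    have hr0 : 0 ≤ r := le_of_lt hr
    refine mul_nonneg (sub_nonneg.2 ?_) (Real.rpow_nonneg hr0 _)
    refine Real.rpow_le_rpow (le_max_right _ _) (max_le_max_right _ ?_) ha.le
    nlinarith [mul_nonneg he hr0]
  rw [integral_eq_lintegral_of_nonneg_ae
    ((ae_restrict_iff' measurableSet_Ioi).2 (Filter.Eventually.of_forall hnn))
    (Measurable.aestronglyMeasurable (by fun_prop))]
  have h3 : ∫⁻ r in Ioi (0 : ℝ), ENNReal.ofReal (((max (A - r ^ 2 + 2 * e * r) 0) ^ a -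
      (max (A - r ^ 2 - 2 * e * r) 0) ^ a) * r ^ (-(2 * a))) =
      ∫⁻ r in Ioi (0 : ℝ), ∫⁻ τ in Ioo (-e) e, ENNReal.ofReal (2 * a) * ENNReal.ofReal
        ((max (A - r ^ 2 + 2 * τ * r) 0) ^ (a - 1) * r ^ (1 - 2 * a)) := by
    refine setLIntegral_congr_fun measurableSet_Ioi fun r (hr : 0 < r) => ?_
    have hr1 : 0 ≤ r ^ (-(2 * a)) := Real.rpow_nonneg hr.le _
    rw [ENNReal.ofReal_mul' hr1, lintegral_max_rpow_affine ha ha1 hr he,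
      lintegral_const_mul _ (by fun_prop)]
    have h4 : ∀ τ, ENNReal.ofReal ((max (A - r ^ 2 + 2 * τ * r) 0) ^ (a - 1) * r ^ (1 - 2 * a)) =
        ENNReal.ofReal (r ^ (1 - 2 * a)) *
          ENNReal.ofReal ((max (A - r ^ 2 + 2 * τ * r) 0) ^ (a - 1)) := fun τ => by
      rw [mul_comm, ENNReal.ofReal_mul (Real.rpow_nonneg hr.le _)]
    simp_rw [h4]
    rw [lintegral_const_mul _ (by fun_prop), mul_right_comm, ← mul_assoc,
      ← ENNReal.ofReal_mul (by positivity), ← ENNReal.ofReal_mul (by positivity)]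
    congr 2
    rw [show (1 : ℝ) - 2 * a = 1 + -(2 * a) by ring, Real.rpow_add hr, Real.rpow_one]
    ring
  rw [h3, lintegral_lintegral_swap (hmeas.const_mul _).aemeasurable]
  have h5 : ∀ τ, ∫⁻ r in Ioi (0 : ℝ), ENNReal.ofReal (2 * a) * ENNReal.ofReal
        ((max (A - r ^ 2 + 2 * τ * r) 0) ^ (a - 1) * r ^ (1 - 2 * a)) =
      ENNReal.ofReal (2 * a) * L τ := fun τ => lintegral_const_mul _ (by fun_prop)
  simp_rw [h5]
  rw [lintegral_const_mul _ hLm, hLint, ← ENNReal.ofReal_mul (by positivity),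
    ENNReal.toReal_ofReal (by positivity), add_comm 1 a, Real.Gamma_add_one ha.ne']
  ring

theorem integral_chord {a A : ℝ} (ha : 0 < a) (ha1 : a < 1) (hA : 0 < A) (e : ℝ) :
    ∫ r in Ioi (0 : ℝ), ((max (A - r ^ 2 + 2 * e * r) 0) ^ a -
      (max (A - r ^ 2 - 2 * e * r) 0) ^ a) * r ^ (-(2 * a)) =
      2 * Real.Gamma (1 + a) * Real.Gamma (1 - a) * e := by
  rcases le_total 0 e with he | he
  · exact integral_chord_of_nonneg ha ha1 hA he
  · have h := integral_chord_of_nonneg ha ha1 hA (neg_nonneg.2 he)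
    have h1 : ∀ r : ℝ, ((max (A - r ^ 2 + 2 * e * r) 0) ^ a -
      (max (A - r ^ 2 - 2 * e * r) 0) ^ a) * r ^ (-(2 * a)) =
      -(((max (A - r ^ 2 + 2 * -e * r) 0) ^ a -
      (max (A - r ^ 2 - 2 * -e * r) 0) ^ a) * r ^ (-(2 * a))) := by
      intro r
      rw [show A - r ^ 2 + 2 * -e * r = A - r ^ 2 - 2 * e * r by ring,
        show A - r ^ 2 - 2 * -e * r = A - r ^ 2 + 2 * e * r by ring]
      ring
    simp_rw [h1]
    rw [integral_neg, h]
    ring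

/-- The function `(ρ² - ‖x‖²)₊^a`. -/
noncomputable def ballPower {d : ℕ} (a ρ : ℝ) (x : EucSpace d) : ℝ :=
  (max (ρ ^ 2 - ‖x‖ ^ 2) 0) ^ a

/-- Along x ± rθ the squared norm is quadratic in r. Rescaling r by ‖θ‖ gives the chord integral
with A = ρ² - ‖x‖², positive inside the ball, and slope ⟨x, θ⟩ / ‖θ‖. -/
theorem integral_ballPower_chord {d : ℕ} {a ρ : ℝ} (ha : 0 < a) (ha1 : a < 1) {x θ : EucSpace d}
    (hx : ‖x‖ < ρ) (hθ : θ ≠ 0) :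
    ∫ r in Ioi (0 : ℝ), (ballPower a ρ (x + r • θ) - ballPower a ρ (x - r • θ)) * r ^ (-(2 * a)) =
      -(2 * Real.Gamma (1 + a) * Real.Gamma (1 - a)) * (‖θ‖ ^ (2 * a - 2) * inner ℝ x θ) := by
  have hn : 0 < ‖θ‖ := norm_pos_iff.2 hθ
  set A := ρ ^ 2 - ‖x‖ ^ 2 with hA
  have hApos : 0 < A := by
    have := norm_nonneg x
    rw [hA]; nlinarith
  set e := inner ℝ x θ / ‖θ‖ with he
  have hein : inner ℝ x θ = e * ‖θ‖ := by rw [he]; field_simp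
  set G : ℝ → ℝ := fun r => ((max (A - r ^ 2 + 2 * e * r) 0) ^ a -
      (max (A - r ^ 2 - 2 * e * r) 0) ^ a) * r ^ (-(2 * a)) with hG
  have h1 : ∀ r ∈ Ioi (0 : ℝ),
      (ballPower a ρ (x + r • θ) - ballPower a ρ (x - r • θ)) * r ^ (-(2 * a)) =
      -(‖θ‖ ^ (2 * a) * G (‖θ‖ * r)) := by
    intro r (hr : 0 < r)
    have e1 : ρ ^ 2 - ‖x + r • θ‖ ^ 2 = A - (‖θ‖ * r) ^ 2 - 2 * e * (‖θ‖ * r) := by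
      rw [norm_add_sq_real, norm_smul, Real.norm_of_nonneg hr.le, real_inner_smul_right, hein, hA]
      ring
    have e2 : ρ ^ 2 - ‖x - r • θ‖ ^ 2 = A - (‖θ‖ * r) ^ 2 + 2 * e * (‖θ‖ * r) := by
      rw [norm_sub_sq_real, norm_smul, Real.norm_of_nonneg hr.le, real_inner_smul_right, hein, hA]
      ring
    rw [ballPower, ballPower, e1, e2, hG]
    simp only
    rw [Real.mul_rpow hn.le hr.le, Real.rpow_neg hn.le]
    have := (Real.rpow_pos_of_pos hn (2 * a)).ne'
    field_simp
    ring
  rw [setIntegral_congr_fun measurableSet_Ioi h1, integral_neg, integral_const_mul,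
    integral_comp_mul_left_Ioi G 0 hn, mul_zero, hG, integral_chord ha ha1 hApos, hein, smul_eq_mul,
    show 2 * a = (2 * a - 2) + 1 + 1 by ring, Real.rpow_add hn, Real.rpow_add hn, Real.rpow_one,
    show 2 * a - 2 + 1 + 1 - 2 = 2 * a - 2 by ring]
  field_simp

/-! ### Gaussian integrals weighted by a power of the norm. -/

theorem abs_gaussian_mul_inner_mul_inner_le {d : ℕ} {q : ℝ} (x y θ : EucSpace d) :
    ‖Real.exp (-Real.pi * ‖θ‖ ^ 2) * ‖θ‖ ^ (q - 2) * (inner ℝ θ x * inner ℝ θ y)‖ ≤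
      ‖x‖ * ‖y‖ * (‖θ‖ ^ q * Real.exp (-Real.pi * ‖θ‖ ^ 2)) := by
  rcases eq_or_ne θ 0 with rfl | hθ
  · simp only [inner_zero_left, mul_zero, norm_zero]
    positivity
  have hn : 0 < ‖θ‖ := norm_pos_iff.2 hθ
  rw [norm_mul, norm_mul, norm_mul, Real.norm_of_nonneg (Real.exp_pos _).le,
    Real.norm_of_nonneg (Real.rpow_nonneg hn.le _)]
  have h1 := norm_inner_le_norm (𝕜 := ℝ) θ x
  have h2 := norm_inner_le_norm (𝕜 := ℝ) θ y
  calc _ ≤ Real.exp (-Real.pi * ‖θ‖ ^ 2) * ‖θ‖ ^ (q - 2) * ((‖θ‖ * ‖x‖) * (‖θ‖ * ‖y‖)) := by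
        gcongr
    _ = _ := by
        rw [Real.rpow_sub hn, Real.rpow_two]; field_simp

section gaussian

variable {d : ℕ} [NeZero d]

theorem integrable_rpow_norm_mul_gaussian {q : ℝ} (hq : -(d : ℝ) < q) :
    Integrable (fun θ : EucSpace d => ‖θ‖ ^ q * Real.exp (-Real.pi * ‖θ‖ ^ 2)) := by
  rw [integrable_fun_norm_addHaar volume (f := fun y => y ^ q * Real.exp (-Real.pi * y ^ 2))]
  have hd : 1 ≤ d := NeZero.one_le
  have h := integrableOn_rpow_mul_exp_neg_mul_sq Real.pi_pos (s := q + (d - 1))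
    (by linarith)
  refine h.congr_fun (fun y (hy : 0 < y) => ?_) measurableSet_Ioi
  simp only [smul_eq_mul, finrank_euclideanSpace, Fintype.card_fin]
  rw [Real.rpow_add hy, ← Nat.cast_pred hd, Real.rpow_natCast]
  ring

theorem integral_rpow_norm_mul_gaussian_toSphere {q : ℝ} (hq : -(d : ℝ) < q) :
    ∫ r in Ioi (0 : ℝ), r ^ (d - 1) * (r ^ q * Real.exp (-Real.pi * r ^ 2)) =
      Real.pi ^ (-((d + q) / 2)) * (1 / 2) * Real.Gamma ((d + q) / 2) := by
  have hd : 1 ≤ d := NeZero.one_le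
  have h := integral_rpow_mul_exp_neg_mul_rpow (p := 2) (q := q + (d - 1)) (b := Real.pi)
    two_pos (by linarith) Real.pi_pos
  rw [show -(q + (d - 1) + 1) / 2 = -((d + q) / 2) by ring,
    show (q + (d - 1) + 1) / 2 = (d + q) / 2 by ring] at h
  rw [← h]
  refine setIntegral_congr_fun measurableSet_Ioi fun y (hy : 0 < y) => ?_
  rw [Real.rpow_add hy, ← Nat.cast_pred hd, Real.rpow_natCast, Real.rpow_two]
  ring

theorem integral_gaussian_mul_inner_sq {q : ℝ} (hq : 0 < q) (x : EucSpace d) :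
    ∫ θ : EucSpace d, Real.exp (-Real.pi * ‖θ‖ ^ 2) * ‖θ‖ ^ (q - 2) * inner ℝ θ x ^ 2 =
      ‖x‖ ^ 2 * (Real.Gamma ((d + q) / 2) /
        (d * Real.Gamma ((d : ℝ) / 2) * Real.pi ^ (q / 2))) := by
  have hd : (0 : ℝ) < d := by exact_mod_cast NeZero.pos d
  have hG : 0 < Real.Gamma ((d : ℝ) / 2) := Real.Gamma_pos_of_pos (by positivity)
  rw [integral_polar_mul volume (fun r => r ^ q * Real.exp (-Real.pi * r ^ 2))
    (fun θ : Metric.sphere (0 : EucSpace d) 1 => inner ℝ (θ : EucSpace d) x ^ (2 * 1))]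
  · rw [finrank_euclideanSpace, Fintype.card_fin,
      integral_rpow_norm_mul_gaussian_toSphere (by linarith)]
    have h := integral_sphereUniform_inner_pow_even d 1 x
    rw [integral_sphereUniform] at h
    have hu := toSphere_real_univ_pos d
    have hu2 := toSphere_real_univ d
    rw [inv_mul_eq_div, div_eq_iff hu.ne'] at h
    rw [h]
    simp only [ascPochhammer_one, Polynomial.eval_X]
    have hS : (volume : Measure (EucSpace d)).toSphere.real univ =
        2 * Real.pi ^ ((d : ℝ) / 2) / Real.Gamma ((d : ℝ) / 2) := by
      rw [eq_div_iff hG.ne']; linarith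
    rw [hS, show -(((d : ℝ) + q) / 2) = -(d / 2 : ℝ) - q / 2 by ring,
      Real.rpow_sub Real.pi_pos, Real.rpow_neg Real.pi_pos.le]
    have h1 := Real.rpow_pos_of_pos Real.pi_pos ((d : ℝ) / 2)
    have h2 := Real.rpow_pos_of_pos Real.pi_pos (q / 2)
    field_simp
  · intro r hr θ
    have hθ : ‖(θ : EucSpace d)‖ = 1 := by simp
    rw [norm_smul, hθ, mul_one, Real.norm_of_nonneg hr.le, real_inner_smul_left,
      Real.rpow_sub hr, Real.rpow_two]
    field_simp

theorem integrable_gaussian_mul_inner_mul_inner {q : ℝ} (hq : 0 < q) (x y : EucSpace d) :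
    Integrable (fun θ : EucSpace d =>
      Real.exp (-Real.pi * ‖θ‖ ^ 2) * ‖θ‖ ^ (q - 2) * (inner ℝ θ x * inner ℝ θ y)) := by
  have hd : (0 : ℝ) < d := by exact_mod_cast NeZero.pos d
  refine ((integrable_rpow_norm_mul_gaussian (d := d) (q := q) (by linarith)).const_mul
    (‖x‖ * ‖y‖)).mono' (Measurable.aestronglyMeasurable (by fun_prop))
    (Filter.Eventually.of_forall fun θ => abs_gaussian_mul_inner_mul_inner_le x y θ)

theorem integral_gaussian_mul_inner_mul_inner {q : ℝ} (hq : 0 < q) (x y : EucSpace d) :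
    ∫ θ : EucSpace d, Real.exp (-Real.pi * ‖θ‖ ^ 2) * ‖θ‖ ^ (q - 2) *
        (inner ℝ θ x * inner ℝ θ y) =
      inner ℝ x y * (Real.Gamma ((d + q) / 2) /
        (d * Real.Gamma ((d : ℝ) / 2) * Real.pi ^ (q / 2))) := by
  have h1 := integral_gaussian_mul_inner_sq hq (x + y)
  have h2 := integral_gaussian_mul_inner_sq hq (x - y)
  have e : ∀ θ : EucSpace d, Real.exp (-Real.pi * ‖θ‖ ^ 2) * ‖θ‖ ^ (q - 2) *
        (inner ℝ θ x * inner ℝ θ y) =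
      1 / 4 * (Real.exp (-Real.pi * ‖θ‖ ^ 2) * ‖θ‖ ^ (q - 2) * inner ℝ θ (x + y) ^ 2 -
      Real.exp (-Real.pi * ‖θ‖ ^ 2) * ‖θ‖ ^ (q - 2) * inner ℝ θ (x - y) ^ 2) := by
    intro θ
    rw [inner_add_right, inner_sub_right]
    ring
  have i := fun z : EucSpace d => integrable_gaussian_mul_inner_mul_inner hq z z
  simp_rw [← sq] at i
  simp_rw [e]
  rw [integral_const_mul, integral_sub (i _) (i _), h1, h2, norm_add_sq_real, norm_sub_sq_real]
  ring

end gaussian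

/-! ### The chord representation of fractional gradients -/

section ChordGradient

/-- Locally uniform bounds on the symmetric differences of `v` under which the chord
representation of the fractional gradient of order `2a - 1` converges absolutely. -/
def ChordBound {d : ℕ} (a : ℝ) (v : EucSpace d → ℝ) (L C : ℝ) : Prop :=
  ∀ x, ‖x‖ ≤ L → ∀ z, |v (x + z) - v (x - z)| ≤ C * ‖z‖ ^ a ∧
    |v (x + z) - v (x - z)| ≤ C * ‖z‖ ^ (a - 1)

/-- The density of the chord representation at direction and length `p = (θ, r)`. -/
noncomputable def chordKernel {d : ℕ} (a : ℝ) (v : EucSpace d → ℝ) (x : EucSpace d)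
    (p : EucSpace d × ℝ) : ℝ :=
  Real.exp (-Real.pi * ‖p.1‖ ^ 2) *
    ((v (x + p.2 • p.1) - v (x - p.2 • p.1)) * p.2 ^ (-(2 * a)))

/-- The normalizing constant of the chord representation. -/
noncomputable def chordConst (a : ℝ) : ℝ := 2 ^ (2 * a - 1) * Real.pi ^ a / Real.Gamma (1 - a)

/-- The chord representation of the fractional gradient of order `2a - 1`. -/
noncomputable def chordGradient {d : ℕ} (a : ℝ) (v : EucSpace d → ℝ) (x : EucSpace d) :
    EucSpace d :=
  chordConst a • ∫ p in (univ : Set (EucSpace d)) ×ˢ Ioi (0 : ℝ), chordKernel a v x p • p.1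

/-- The function dominating the chord kernel. -/
noncomputable def chordMajorant {d : ℕ} (a : ℝ) (p : EucSpace d × ℝ) : ℝ :=
  (‖p.1‖ ^ (1 + a) * Real.exp (-Real.pi * ‖p.1‖ ^ 2) +
      ‖p.1‖ ^ a * Real.exp (-Real.pi * ‖p.1‖ ^ 2)) *
    ((Ioc 0 1).indicator (fun r : ℝ => r ^ (-a)) p.2 +
      (Ioi 1).indicator (fun r : ℝ => r ^ (-a - 1)) p.2)

variable {d : ℕ} {a : ℝ} {v : EucSpace d → ℝ}

theorem integrable_chordMajorant [NeZero d] (ha : 0 < a) (ha1 : a < 1) :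
    Integrable (chordMajorant (d := d) a) := by
  have hd : (0 : ℝ) < d := by exact_mod_cast NeZero.pos d
  refine Integrable.mul_prod (μ := (volume : Measure (EucSpace d))) (ν := (volume : Measure ℝ))
    (f := fun θ : EucSpace d => ‖θ‖ ^ (1 + a) * Real.exp (-Real.pi * ‖θ‖ ^ 2) +
      ‖θ‖ ^ a * Real.exp (-Real.pi * ‖θ‖ ^ 2))
    (g := fun r : ℝ => (Ioc 0 1).indicator (fun r : ℝ => r ^ (-a)) r +
      (Ioi 1).indicator (fun r : ℝ => r ^ (-a - 1)) r) ?_ ?_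
  · exact (integrable_rpow_norm_mul_gaussian (by linarith)).add
      (integrable_rpow_norm_mul_gaussian (by linarith))
  · refine Integrable.add ?_ ?_
    · rw [integrable_indicator_iff measurableSet_Ioc,
        ← intervalIntegrable_iff_integrableOn_Ioc_of_le zero_le_one]
      exact intervalIntegral.intervalIntegrable_rpow' (by linarith)
    · rw [integrable_indicator_iff measurableSet_Ioi]
      exact integrableOn_Ioi_rpow_of_lt (by linarith) one_pos

/-- For r ≤ 1 the bound with exponent a leaves r^(-a), integrable at 0 when a < 1; for r > 1 the
bound with exponent a - 1 leaves r^(-a-1), integrable at infinity. -/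
theorem abs_chordKernel_mul_norm_le (ha : 0 < a) {L C : ℝ} (hC : ChordBound a v L C) {x : EucSpace d}
    (hx : ‖x‖ ≤ L) {p : EucSpace d × ℝ} (hp : 0 < p.2) :
    |chordKernel a v x p| * ‖p.1‖ ≤ C * chordMajorant a p := by
  obtain ⟨θ, r⟩ := p
  simp only at hp
  obtain ⟨h1, h2⟩ := hC x hx (r • θ)
  rcases eq_or_ne θ 0 with rfl | hθ
  · simp [chordMajorant, Real.zero_rpow ha.ne', Real.zero_rpow (by linarith : 1 + a ≠ 0)]
  have hn : 0 < ‖θ‖ := norm_pos_iff.2 hθ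
  rw [norm_smul, Real.norm_of_nonneg hp.le] at h1 h2
  have hC : 0 ≤ C := by
    by_contra hneg
    have : 0 < (r * ‖θ‖) ^ a := Real.rpow_pos_of_pos (by positivity) _
    have := (abs_nonneg _).trans h1
    nlinarith
  rw [Real.mul_rpow hp.le hn.le] at h1 h2
  simp only [chordKernel, chordMajorant]
  rw [abs_mul, abs_mul, abs_of_pos (Real.exp_pos _), abs_of_nonneg (Real.rpow_nonneg hp.le _)]
  have hE := Real.exp_pos (-Real.pi * ‖θ‖ ^ 2)
  have hr := Real.rpow_pos_of_pos hp (-(2 * a))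
  rcases le_or_gt r 1 with h | h
  · rw [indicator_of_mem (show r ∈ Ioc (0 : ℝ) 1 from ⟨hp, h⟩),
      indicator_of_notMem (show r ∉ Ioi (1 : ℝ) from not_lt.2 h), add_zero]
    calc _ ≤ Real.exp (-Real.pi * ‖θ‖ ^ 2) * (C * (r ^ a * ‖θ‖ ^ a) * r ^ (-(2 * a))) * ‖θ‖ := by
          gcongr
      _ = C * (‖θ‖ ^ (1 + a) * Real.exp (-Real.pi * ‖θ‖ ^ 2) * r ^ (-a)) := by
          rw [Real.rpow_add hn, Real.rpow_one, show -a = a + -(2 * a) by ring, Real.rpow_add hp]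
          ring
      _ ≤ _ := by
          have := Real.rpow_pos_of_pos hp (-a)
          have := Real.rpow_pos_of_pos hn a
          gcongr
          exact le_add_of_nonneg_right (by positivity)
  · rw [indicator_of_notMem (show r ∉ Ioc (0 : ℝ) 1 from fun h' => not_lt.2 h'.2 h),
      indicator_of_mem (show r ∈ Ioi (1 : ℝ) from h), zero_add]
    calc _ ≤ Real.exp (-Real.pi * ‖θ‖ ^ 2) *
            (C * (r ^ (a - 1) * ‖θ‖ ^ (a - 1)) * r ^ (-(2 * a))) * ‖θ‖ := by
          gcongr
      _ = C * (‖θ‖ ^ a * Real.exp (-Real.pi * ‖θ‖ ^ 2) * r ^ (-a - 1)) := by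
          rw [show -a - 1 = (a - 1) + -(2 * a) by ring, Real.rpow_add hp, Real.rpow_sub hn,
            Real.rpow_one]
          field_simp
      _ ≤ _ := by
          have := Real.rpow_pos_of_pos hp (-a - 1)
          have := Real.rpow_pos_of_pos hn (1 + a)
          gcongr
          exact le_add_of_nonneg_left (by positivity)

theorem norm_chordKernel_smul_le (ha : 0 < a) {L C : ℝ} (hC : ChordBound a v L C) {x : EucSpace d}
    (hx : ‖x‖ ≤ L) {p : EucSpace d × ℝ} (hp : p ∈ (univ : Set (EucSpace d)) ×ˢ Ioi (0 : ℝ)) :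
    ‖chordKernel a v x p • p.1‖ ≤ C * chordMajorant a p := by
  rw [norm_smul]
  exact abs_chordKernel_mul_norm_le ha hC hx hp.2

/-- The parameter space Γ will be the range of radii: space-time integrability needs joint
measurability in the radius and the point. -/
theorem measurable_chordKernel {Γ : Type*} [MeasurableSpace Γ] {V : Γ → EucSpace d → ℝ}
    (hV : Measurable (Function.uncurry V)) :
    Measurable (fun q : (Γ × EucSpace d) × (EucSpace d × ℝ) =>
      chordKernel a (V q.1.1) q.1.2 q.2) := by
  have h1 : Measurable (fun q : (Γ × EucSpace d) × (EucSpace d × ℝ) =>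
      V q.1.1 (q.1.2 + q.2.2 • q.2.1)) :=
    hV.comp (f := fun q : (Γ × EucSpace d) × (EucSpace d × ℝ) =>
      (q.1.1, q.1.2 + q.2.2 • q.2.1)) (by fun_prop)
  have h2 : Measurable (fun q : (Γ × EucSpace d) × (EucSpace d × ℝ) =>
      V q.1.1 (q.1.2 - q.2.2 • q.2.1)) :=
    hV.comp (f := fun q : (Γ × EucSpace d) × (EucSpace d × ℝ) =>
      (q.1.1, q.1.2 - q.2.2 • q.2.1)) (by fun_prop)
  unfold chordKernel
  fun_prop

theorem measurable_chordKernel_right (hv : Measurable v) (x : EucSpace d) :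
    Measurable (chordKernel a v x) := by
  have h := measurable_chordKernel (a := a) (V := fun _ : Unit => v) (hv.comp measurable_snd)
  exact h.comp (g := fun q : (Unit × EucSpace d) × (EucSpace d × ℝ) => chordKernel a v q.1.2 q.2)
    (f := fun p => (((), x), p)) (by fun_prop)

theorem measurable_chordGradient {Γ : Type*} [MeasurableSpace Γ] {V : Γ → EucSpace d → ℝ}
    (hV : Measurable (Function.uncurry V)) :
    Measurable (fun q : Γ × EucSpace d => chordGradient a (V q.1) q.2) := by
  have h := ((measurable_chordKernel (a := a) hV).smul
    (measurable_fst.comp measurable_snd : Measurable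
      fun q : (Γ × EucSpace d) × (EucSpace d × ℝ) => q.2.1)).stronglyMeasurable
  exact (h.integral_prod_right' (ν := volume.restrict
    ((univ : Set (EucSpace d)) ×ˢ Ioi (0 : ℝ)))).measurable.const_smul (chordConst a)

theorem integrableOn_chordKernel_smul [NeZero d] (ha : 0 < a) (ha1 : a < 1) (hv : Measurable v)
    {L C : ℝ} (hC : ChordBound a v L C) {x : EucSpace d} (hx : ‖x‖ ≤ L) :
    IntegrableOn (fun p : EucSpace d × ℝ => chordKernel a v x p • p.1)
      ((univ : Set (EucSpace d)) ×ˢ Ioi (0 : ℝ)) := by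
  refine Integrable.mono' ((integrable_chordMajorant ha ha1).const_mul C).integrableOn
    ((measurable_chordKernel_right hv x).smul measurable_fst).aestronglyMeasurable ?_
  exact (ae_restrict_iff' (MeasurableSet.univ.prod measurableSet_Ioi)).2
    (Filter.Eventually.of_forall fun p hp => norm_chordKernel_smul_le ha hC hx hp)

theorem norm_chordGradient_le [NeZero d] (ha : 0 < a) (ha1 : a < 1) {L C : ℝ}
    (hC : ChordBound a v L C) {x : EucSpace d} (hx : ‖x‖ ≤ L) :
    ‖chordGradient a v x‖ ≤ ‖chordConst a‖ * (C * ∫ p in (univ : Set (EucSpace d)) ×ˢ Ioi (0 : ℝ),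
      chordMajorant a p) := by
  rw [chordGradient, norm_smul, ← integral_const_mul]
  refine mul_le_mul_of_nonneg_left ?_ (norm_nonneg _)
  refine norm_integral_le_of_norm_le ((integrable_chordMajorant ha ha1).const_mul C).integrableOn ?_
  exact (ae_restrict_iff' (MeasurableSet.univ.prod measurableSet_Ioi)).2
    (Filter.Eventually.of_forall fun p hp => norm_chordKernel_smul_le ha hC hx hp)

theorem chordGradient_apply [NeZero d] (ha : 0 < a) (ha1 : a < 1) (hv : Measurable v)
    {L C : ℝ} (hC : ChordBound a v L C) {x : EucSpace d} (hx : ‖x‖ ≤ L) (j : Fin d) :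
    chordGradient a v x j = chordConst a *
      ∫ p in (univ : Set (EucSpace d)) ×ˢ Ioi (0 : ℝ), chordKernel a v x p * p.1 j := by
  rw [chordGradient, PiLp.smul_apply, smul_eq_mul]
  congr 1
  exact ((EuclideanSpace.proj (𝕜 := ℝ) j).integral_comp_comm
    (integrableOn_chordKernel_smul ha ha1 hv hC hx)).symm

theorem locallyIntegrable_chordGradient [NeZero d] (ha : 0 < a) (ha1 : a < 1) (hv : Measurable v)
    (hC : ∀ L, ∃ C, ChordBound a v L C) : LocallyIntegrable (chordGradient a v) := by
  rw [locallyIntegrable_iff]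
  intro K hK
  obtain ⟨L, hL⟩ := hK.isBounded.exists_norm_le
  obtain ⟨C, hC⟩ := hC L
  have hm : Measurable (chordGradient a v) := by
    have h := measurable_chordGradient (a := a) (V := fun _ : Unit => v) (hv.comp measurable_snd)
    exact h.comp (g := fun q : Unit × EucSpace d => chordGradient a v q.2)
      (f := fun x => ((), x)) (by fun_prop)
  refine Measure.integrableOn_of_bounded (M := ‖chordConst a‖ * (C *
    ∫ p in (univ : Set (EucSpace d)) ×ˢ Ioi (0 : ℝ), chordMajorant a p))
    hK.measure_lt_top.ne hm.aestronglyMeasurable ?_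
  exact (ae_restrict_iff' hK.measurableSet).2 (Filter.Eventually.of_forall fun x hx =>
    norm_chordGradient_le ha ha1 hC (hL x hx))

end ChordGradient

/-! ### Fourier transforms of Gaussian moments -/

theorem hasLineDerivAt_fourier {d : ℕ} {f : EucSpace d → ℂ} (h0 : Integrable f)
    (h1 : Integrable (fun θ => ‖θ‖ * ‖f θ‖)) (j : Fin d) (w : EucSpace d) :
    HasLineDerivAt ℝ (FourierTransform.fourier f)
      (FourierTransform.fourier (fun θ : EucSpace d => -(2 * Real.pi * Complex.I) * (θ j * f θ)) w)
      w (EuclideanSpace.single j (1 : ℝ)) := by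
  have hline := (Real.hasFDerivAt_fourier h0 h1 w).hasLineDerivAt
    (EuclideanSpace.single j (1 : ℝ))
  have hint : Integrable (VectorFourier.fourierSMulRight (innerSL ℝ) f) := by
    refine Integrable.mono' (h1.const_mul (2 * Real.pi * ‖innerSL ℝ (E := EucSpace d)‖))
      (h0.aestronglyMeasurable.fourierSMulRight (L := innerSL ℝ))
      (Filter.Eventually.of_forall fun θ => ?_)
    have := VectorFourier.norm_fourierSMulRight_le (innerSL ℝ) f θ
    linarith
  rw [Real.fourier_continuousLinearMap_apply hint] at hline
  have e2 : (fun x : EucSpace d => VectorFourier.fourierSMulRight (innerSL ℝ) f x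
      (EuclideanSpace.single j (1 : ℝ))) =
      (fun θ : EucSpace d => -(2 * Real.pi * Complex.I) * (θ j * f θ)) := by
    ext θ
    have hin : (innerSL ℝ) θ (EuclideanSpace.single j (1 : ℝ)) = θ j := by
      rw [innerSL_apply_apply, EuclideanSpace.inner_single_right]; simp
    rw [VectorFourier.fourierSMulRight_apply, hin]
    simp [mul_assoc]
  rwa [e2] at hline

theorem fourier_const_mul {d : ℕ} (c : ℂ) (f : EucSpace d → ℂ) (w : EucSpace d) :
    FourierTransform.fourier (fun θ => c * f θ) w = c * FourierTransform.fourier f w := by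
  rw [Real.fourier_eq, Real.fourier_eq, ← integral_const_mul]
  refine integral_congr_ae (Filter.Eventually.of_forall fun θ => ?_)
  simp only [Circle.smul_def, smul_eq_mul]
  ring

section gaussian

variable {d : ℕ}

theorem fourier_gaussian_eq (w : EucSpace d) :
    FourierTransform.fourier (fun θ : EucSpace d => Complex.exp (-(Real.pi : ℂ) * ‖θ‖ ^ 2)) w =
      Complex.exp (-(Real.pi : ℂ) * ‖w‖ ^ 2) := by
  rw [fourier_gaussian_innerProductSpace (by simpa using Real.pi_pos)]
  have : (Real.pi : ℂ) ≠ 0 := by exact_mod_cast Real.pi_ne_zero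
  rw [div_self this, Complex.one_cpow, one_mul]
  congr 1
  field_simp

theorem cexp_neg_pi_mul_norm_sq (θ : EucSpace d) :
    Complex.exp (-(Real.pi : ℂ) * ‖θ‖ ^ 2) = ((Real.exp (-Real.pi * ‖θ‖ ^ 2) : ℝ) : ℂ) := by
  push_cast; rfl

theorem integrable_gaussian_mul_coord [NeZero d] (j : Fin d) :
    Integrable (fun θ : EucSpace d => Real.exp (-Real.pi * ‖θ‖ ^ 2) * θ j) := by
  have h := integrable_rpow_norm_mul_gaussian (d := d) (q := 1)
    (by have : (0 : ℝ) < d := by exact_mod_cast NeZero.pos d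
        linarith)
  refine h.mono (Measurable.aestronglyMeasurable (by fun_prop))
    (Filter.Eventually.of_forall fun θ => ?_)
  rw [norm_mul, norm_mul, mul_comm, Real.rpow_one, norm_norm]
  gcongr
  exact PiLp.norm_apply_le θ j

/-- The derivative of the Gaussian is computed twice, directly and as the derivative of a Fourier
transform. -/
theorem fourier_coord_mul_gaussian [NeZero d] (j : Fin d) (w : EucSpace d) :
    FourierTransform.fourier
      (fun θ : EucSpace d => (θ j : ℂ) * Complex.exp (-(Real.pi : ℂ) * ‖θ‖ ^ 2)) w =
      -(Complex.I * w j * Complex.exp (-(Real.pi : ℂ) * ‖w‖ ^ 2)) := by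
  have hd : (0 : ℝ) < d := by exact_mod_cast NeZero.pos d
  set f : EucSpace d → ℂ := fun θ => Complex.exp (-(Real.pi : ℂ) * ‖θ‖ ^ 2) with hf
  have hnorm : ∀ θ, ‖f θ‖ = Real.exp (-Real.pi * ‖θ‖ ^ 2) := fun θ => by
    rw [hf]; simp only
    rw [cexp_neg_pi_mul_norm_sq, Complex.norm_real, Real.norm_of_nonneg (Real.exp_pos _).le]
  have hfm : AEStronglyMeasurable f volume :=
    (by fun_prop : Continuous f).aestronglyMeasurable
  have h0 : Integrable f := by
    rw [← integrable_norm_iff hfm]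
    simp_rw [hnorm]
    simpa using integrable_rpow_norm_mul_gaussian (d := d) (q := 0) (by linarith)
  have h1 : Integrable (fun θ => ‖θ‖ * ‖f θ‖) := by
    simp_rw [hnorm]
    simpa using integrable_rpow_norm_mul_gaussian (d := d) (q := 1) (by linarith)
  have hF : FourierTransform.fourier f = f := funext fun w => fourier_gaussian_eq w
  have hline := hasLineDerivAt_fourier h0 h1 j w
  rw [hF, fourier_const_mul] at hline
  have hline2 : HasLineDerivAt ℝ f (-(2 * Real.pi * w j) * f w) w
      (EuclideanSpace.single j (1 : ℝ)) := by
    have e : ∀ t : ℝ, f (w + t • EuclideanSpace.single j (1 : ℝ)) =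
        Complex.exp (-(Real.pi : ℂ) * (‖w‖ ^ 2 + 2 * t * w j + t ^ 2)) := by
      intro t
      rw [hf]
      simp only
      congr 2
      have : ‖w + t • EuclideanSpace.single j (1 : ℝ)‖ ^ 2 = ‖w‖ ^ 2 + 2 * t * w j + t ^ 2 := by
        rw [norm_add_sq_real, norm_smul, real_inner_smul_right, EuclideanSpace.inner_single_right]
        simp
        ring
      exact_mod_cast this
    unfold HasLineDerivAt
    simp_rw [e]
    have hp : HasDerivAt (fun t : ℝ => -(Real.pi : ℂ) * (‖w‖ ^ 2 + 2 * (t : ℂ) * w j + (t : ℂ) ^ 2))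
        (-(2 * Real.pi * w j : ℂ)) 0 := by
      have hid : HasDerivAt (fun t : ℝ => (t : ℂ)) 1 0 := Complex.ofRealCLM.hasDerivAt
      have := ((((hid.const_mul (2 : ℂ)).mul_const (w j : ℂ)).const_add ((‖w‖ : ℂ) ^ 2)).add
        (hid.pow 2)).const_mul (-(Real.pi : ℂ))
      exact this.congr_deriv (by simp; ring)
    have := hp.cexp
    refine this.congr_deriv ?_
    rw [hf]
    simp
    ring
  have huniq := hline.unique hline2
  have hpi : (Real.pi : ℂ) ≠ 0 := by exact_mod_cast Real.pi_ne_zero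
  have h2 : (2 * Real.pi * Complex.I : ℂ) ≠ 0 := by simp [hpi]
  refine mul_left_cancel₀ (neg_ne_zero.2 h2) (huniq.trans ?_)
  rw [neg_mul_neg]
  linear_combination (-(2 * Real.pi * w j * f w)) * Complex.I_sq

/-- This is the reason for the Gaussian weight: integrating out the direction leaves an explicit
Gaussian in y, and the later integral over its dilations is a Gamma integral. -/
theorem integral_gaussian_mul_coord_mul_fourierChar_sub [NeZero d] (j : Fin d) (y : EucSpace d) :
    ∫ θ : EucSpace d, ((Real.exp (-Real.pi * ‖θ‖ ^ 2) * θ j : ℝ) : ℂ) *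
        ((Real.fourierChar (inner ℝ θ y) : ℂ) - (Real.fourierChar (-inner ℝ θ y) : ℂ)) =
      2 * Complex.I * y j * ((Real.exp (-Real.pi * ‖y‖ ^ 2) : ℝ) : ℂ) := by
  have hint : ∀ c : EucSpace d → ℝ, Continuous c → Integrable (fun θ : EucSpace d =>
      ((Real.exp (-Real.pi * ‖θ‖ ^ 2) * θ j : ℝ) : ℂ) * (Real.fourierChar (c θ) : ℂ)) := by
    intro c hc
    refine (integrable_gaussian_mul_coord j).ofReal.mul_bdd (c := 1) ?_
      (Filter.Eventually.of_forall fun θ => (Circle.norm_coe _).le)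
    exact (continuous_induced_dom.comp (Real.continuous_fourierChar.comp hc)).aestronglyMeasurable
  have h1 := fourier_coord_mul_gaussian j y
  have h2 := fourier_coord_mul_gaussian j (-y)
  rw [Real.fourier_eq] at h1 h2
  simp_rw [inner_neg_right, neg_neg] at h2
  have e : ∀ (θ : EucSpace d) (t : ℝ), Real.fourierChar t •
      ((θ j : ℂ) * Complex.exp (-(Real.pi : ℂ) * ‖θ‖ ^ 2)) =
      ((Real.exp (-Real.pi * ‖θ‖ ^ 2) * θ j : ℝ) : ℂ) * (Real.fourierChar t : ℂ) := by
    intro θ t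
    rw [Circle.smul_def, cexp_neg_pi_mul_norm_sq, smul_eq_mul]
    push_cast
    ring
  simp_rw [e] at h1 h2
  simp_rw [mul_sub]
  rw [integral_sub (hint _ (by fun_prop)) (hint _ (by fun_prop)), h1, h2,
    cexp_neg_pi_mul_norm_sq, cexp_neg_pi_mul_norm_sq, norm_neg]
  simp only [PiLp.neg_apply]
  push_cast
  ring

end gaussian

/-! ### Parseval's identity and the Fourier symbol of chord integrals. -/

theorem integral_comp_add_right_mul {d : ℕ} {v ψ : EucSpace d → ℂ} (hv : Integrable v)
    (hψ2 : Integrable (FourierTransformInv.fourierInv ψ))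
    (hψ3 : FourierTransform.fourier (FourierTransformInv.fourierInv ψ) = ψ)
    (z : EucSpace d) :
    ∫ x, v (x + z) * ψ x = ∫ ξ, (Real.fourierChar (inner ℝ z ξ) : ℂ) *
      (FourierTransform.fourier v ξ * FourierTransformInv.fourierInv ψ ξ) := by
  have h := VectorFourier.integral_fourierIntegral_smul_eq_flip (L := innerₗ (EucSpace d))
    (μ := volume) (ν := volume) Real.continuous_fourierChar continuous_inner
    (hv.comp_add_right z) hψ2
  have h2 := VectorFourier.fourierIntegral_comp_add_right Real.fourierChar volume
    (innerₗ (EucSpace d)) v z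
  simp only [Function.comp_def] at h2
  rw [h2, flip_innerₗ] at h
  have e1 : VectorFourier.fourierIntegral Real.fourierChar volume (innerₗ (EucSpace d))
    (FourierTransformInv.fourierInv ψ) = ψ := hψ3
  rw [e1] at h
  simp only [smul_eq_mul] at h
  rw [← h]
  refine integral_congr_ae (Filter.Eventually.of_forall fun ξ => ?_)
  simp only [Circle.smul_def, smul_eq_mul, innerₗ_apply_apply]
  rw [mul_assoc]
  rfl

section FourierIdentity

variable {d : ℕ}

theorem exists_schwartzMap_fourierInv {ψ : EucSpace d → ℂ}
    (h1 : ContDiff ℝ ((⊤ : ℕ∞) : WithTop ℕ∞) ψ) (h2 : HasCompactSupport ψ) :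
    ∃ f : SchwartzMap (EucSpace d) ℂ, FourierTransformInv.fourierInv ψ = f ∧
      FourierTransform.fourier (FourierTransformInv.fourierInv ψ) = ψ := by
  refine ⟨FourierTransformInv.fourierInv (h2.toSchwartzMap h1), ?_, ?_⟩
  · rw [SchwartzMap.fourierInv_coe]; rfl
  · have h : FourierTransform.fourier (FourierTransformInv.fourierInv (h2.toSchwartzMap h1)) =
        h2.toSchwartzMap h1 := FourierTransform.fourier_fourierInv_eq _
    have h3 := congrArg (fun f : SchwartzMap (EucSpace d) ℂ => (f : EucSpace d → ℂ)) h
    simp only [SchwartzMap.fourier_coe, SchwartzMap.fourierInv_coe] at h3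
    exact h3

/-- Near 0 the exponent 2a - 1 exceeds -1 ≥ -d, and on the unit ball the Gaussian times e^π is at
least 1. Outside the unit ball the power is at most ‖ξ‖. -/
theorem integrable_rpow_norm_mul_schwartzMap [NeZero d] (f : SchwartzMap (EucSpace d) ℂ) {a : ℝ}
    (ha : 0 < a) (ha1 : a < 1) :
    Integrable (fun ξ : EucSpace d => ‖ξ‖ ^ (2 * a - 1) * ‖f ξ‖) := by
  have hd : (1 : ℝ) ≤ d := by exact_mod_cast NeZero.one_le
  obtain ⟨C, hC⟩ : ∃ C, ∀ ξ, ‖f ξ‖ ≤ C := ⟨_, fun ξ => f.norm_le_seminorm ℝ ξ⟩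
  have hC0 : 0 ≤ C := (norm_nonneg _).trans (hC 0)
  have i1 := (integrable_rpow_norm_mul_gaussian (d := d) (q := 2 * a - 1) (by linarith)).const_mul
    (C * Real.exp Real.pi)
  have i2 : Integrable (fun ξ => ‖ξ‖ * ‖f ξ‖) := by
    simpa using f.integrable_pow_mul volume 1
  refine (i1.add i2).mono' (Measurable.aestronglyMeasurable ?_)
    (Filter.Eventually.of_forall fun ξ => ?_)
  · have := f.continuous.measurable
    fun_prop
  · have hn := Real.rpow_nonneg (norm_nonneg ξ) (2 * a - 1)
    rw [Real.norm_of_nonneg (by positivity)]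
    simp only [Pi.add_apply]
    rcases le_or_gt ‖ξ‖ 1 with h | h
    · refine le_add_of_le_of_nonneg ?_ (by positivity)
      have h3 : 1 ≤ Real.exp Real.pi * Real.exp (-Real.pi * ‖ξ‖ ^ 2) := by
        rw [← Real.exp_add, ← Real.exp_zero]
        refine Real.exp_le_exp.2 ?_
        have : ‖ξ‖ ^ 2 ≤ 1 := pow_le_one₀ (norm_nonneg _) h
        nlinarith [Real.pi_pos]
      calc _ ≤ ‖ξ‖ ^ (2 * a - 1) * C * 1 := by rw [mul_one]; gcongr; exact hC ξ
        _ ≤ ‖ξ‖ ^ (2 * a - 1) * C * (Real.exp Real.pi * Real.exp (-Real.pi * ‖ξ‖ ^ 2)) := by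
            gcongr
        _ = _ := by ring
    · refine le_add_of_nonneg_of_le (by positivity) ?_
      gcongr
      calc ‖ξ‖ ^ (2 * a - 1) ≤ ‖ξ‖ ^ (1 : ℝ) := Real.rpow_le_rpow_of_exponent_le h.le (by linarith)
        _ = _ := Real.rpow_one _

theorem integral_rpow_mul_gaussian_dilation {a : ℝ} (ha1 : a < 1) {ξ : EucSpace d}
    (hξ : ξ ≠ 0) :
    IntegrableOn (fun r : ℝ => r ^ (1 - 2 * a) * Real.exp (-Real.pi * ‖r • ξ‖ ^ 2)) (Ioi 0) ∧
    ∫ r in Ioi (0 : ℝ), r ^ (1 - 2 * a) * Real.exp (-Real.pi * ‖r • ξ‖ ^ 2) =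
      Real.Gamma (1 - a) / 2 * (Real.pi ^ (a - 1) * ‖ξ‖ ^ (2 * a - 2)) := by
  have hn : 0 < ‖ξ‖ := norm_pos_iff.2 hξ
  have hb : 0 < Real.pi * ‖ξ‖ ^ 2 := by positivity
  have e : ∀ r : ℝ, -Real.pi * ‖r • ξ‖ ^ 2 = -(Real.pi * ‖ξ‖ ^ 2) * r ^ 2 := by
    intro r
    rw [norm_smul, mul_pow, Real.norm_eq_abs, sq_abs]; ring
  simp_rw [e]
  refine ⟨integrableOn_rpow_mul_exp_neg_mul_sq hb (by linarith), ?_⟩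
  have h := integral_rpow_mul_exp_neg_mul_rpow (p := 2) (q := 1 - 2 * a) two_pos (by linarith) hb
  simp only [Real.rpow_two] at h
  rw [h, show -(1 - 2 * a + 1) / 2 = a - 1 by ring, show (1 - 2 * a + 1) / 2 = 1 - a by ring,
    Real.mul_rpow Real.pi_pos.le (by positivity), ← Real.rpow_natCast, ← Real.rpow_mul hn.le,
    show ((2 : ℕ) : ℝ) * (a - 1) = 2 * a - 2 by push_cast; ring]
  ring

/-- The r-integral produces ‖ξ‖^(2a-2), and the coordinate ξ j supplies one more power, so
‖ξ‖^(2a-1) is all that has to be integrated against a Schwartz function. -/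
theorem integrable_mul_gaussian_dilation [NeZero d] {U : EucSpace d → ℂ}
    (f : SchwartzMap (EucSpace d) ℂ) {a B : ℝ} (ha : 0 < a) (ha1 : a < 1) (hU : Measurable U)
    (hB : ∀ ξ, ‖U ξ‖ ≤ B * ‖f ξ‖) (j : Fin d) :
    Integrable (fun p : ℝ × EucSpace d => U p.2 * (p.2 j : ℂ) *
      ((p.1 ^ (1 - 2 * a) * Real.exp (-Real.pi * ‖p.1 • p.2‖ ^ 2) : ℝ) : ℂ))
      ((volume.restrict (Ioi (0 : ℝ))).prod volume) := by
  have hm : Measurable (fun p : ℝ × EucSpace d => U p.2 * (p.2 j : ℂ) *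
      ((p.1 ^ (1 - 2 * a) * Real.exp (-Real.pi * ‖p.1 • p.2‖ ^ 2) : ℝ) : ℂ)) := by
    fun_prop
  have hnorm : ∀ (ξ : EucSpace d), ∀ r ∈ Ioi (0 : ℝ), ‖U ξ * (ξ j : ℂ) *
      ((r ^ (1 - 2 * a) * Real.exp (-Real.pi * ‖r • ξ‖ ^ 2) : ℝ) : ℂ)‖ =
      ‖U ξ * (ξ j : ℂ)‖ * (r ^ (1 - 2 * a) * Real.exp (-Real.pi * ‖r • ξ‖ ^ 2)) := by
    intro ξ r hr
    rw [norm_mul _ ((_ : ℝ) : ℂ), Complex.norm_real, Real.norm_of_nonneg]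
    exact mul_nonneg (Real.rpow_nonneg (le_of_lt hr) _) (Real.exp_pos _).le
  rw [integrable_prod_iff' hm.aestronglyMeasurable]
  constructor
  · refine Filter.Eventually.of_forall fun ξ => ?_
    rcases eq_or_ne ξ 0 with rfl | hξ
    · simp
    · exact ((integral_rpow_mul_gaussian_dilation ha1 hξ).1.ofReal (𝕜 := ℂ)).const_mul (U ξ * (ξ j : ℂ))
  · have i := (integrable_rpow_norm_mul_schwartzMap f ha ha1).const_mul
      (B * (Real.Gamma (1 - a) / 2 * Real.pi ^ (a - 1)))
    have hG : 0 < Real.Gamma (1 - a) := Real.Gamma_pos_of_pos (by linarith)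
    refine i.mono' ?_ (Filter.Eventually.of_forall fun ξ => ?_)
    · exact (hm.norm.stronglyMeasurable.integral_prod_left').aestronglyMeasurable
    · simp only
      rw [setIntegral_congr_fun measurableSet_Ioi (hnorm ξ), integral_const_mul]
      rcases eq_or_ne ξ 0 with rfl | hξ
      · have h0 := (norm_nonneg _).trans (hB 0)
        have h1 : 0 ≤ (0 : ℝ) ^ (2 * a - 1) := Real.rpow_nonneg le_rfl _
        simp only [PiLp.zero_apply, Complex.ofReal_zero, mul_zero, norm_zero, zero_mul]
        calc (0 : ℝ) ≤ (B * ‖f 0‖) * (Real.Gamma (1 - a) / 2 * Real.pi ^ (a - 1) *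
              (0 : ℝ) ^ (2 * a - 1)) := by positivity
          _ = _ := by ring
      · have hn : 0 < ‖ξ‖ := norm_pos_iff.2 hξ
        rw [(integral_rpow_mul_gaussian_dilation ha1 hξ).2, Real.norm_of_nonneg (by positivity),
          norm_mul]
        have hj : ‖(ξ j : ℂ)‖ ≤ ‖ξ‖ := by
          rw [Complex.norm_real]; exact PiLp.norm_apply_le ξ j
        calc _ ≤ B * ‖f ξ‖ * ‖ξ‖ *
              (Real.Gamma (1 - a) / 2 * (Real.pi ^ (a - 1) * ‖ξ‖ ^ (2 * a - 2))) := by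
              gcongr
              · exact (norm_nonneg _).trans (hB ξ)
              · exact hB ξ
          _ = _ := by
              rw [show 2 * a - 1 = (2 * a - 2) + 1 by ring, Real.rpow_add hn, Real.rpow_one]
              ring

section parseval

variable {a : ℝ} {v : EucSpace d → ℝ} {ψ : EucSpace d → ℂ}

theorem integral_sub_translate_mul (hv : Integrable v)
    (hψ : Continuous ψ) (hψc : HasCompactSupport ψ)
    (hv' : Continuous v)
    (hψ2 : Integrable (FourierTransformInv.fourierInv ψ))
    (hψ3 : FourierTransform.fourier (FourierTransformInv.fourierInv ψ) = ψ) (z : EucSpace d) :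
    ∫ x, (((v (x + z) - v (x - z) : ℝ)) : ℂ) * ψ x =
      ∫ ξ, ((Real.fourierChar (inner ℝ z ξ) : ℂ) - (Real.fourierChar (-inner ℝ z ξ) : ℂ)) *
        (FourierTransform.fourier (fun x => (v x : ℂ)) ξ * FourierTransformInv.fourierInv ψ ξ) := by
  have h1 := integral_comp_add_right_mul (v := fun x => (v x : ℂ)) hv.ofReal hψ2 hψ3 z
  have h2 := integral_comp_add_right_mul (v := fun x => (v x : ℂ)) hv.ofReal hψ2 hψ3 (-z)
  have i : ∀ z : EucSpace d, Integrable (fun x => (v (x + z) : ℂ) * ψ x) := fun z =>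
    Continuous.integrable_of_hasCompactSupport (by fun_prop) (hψc.mul_left)
  have hF : Continuous (FourierTransform.fourier (fun x => (v x : ℂ))) :=
    VectorFourier.fourierIntegral_continuous Real.continuous_fourierChar continuous_inner hv.ofReal
  obtain ⟨B, hB⟩ : ∃ B, ∀ ξ, ‖FourierTransform.fourier (fun x => (v x : ℂ)) ξ‖ ≤ B :=
    ⟨_, fun ξ => VectorFourier.norm_fourierIntegral_le_integral_norm _ _ _ _ _⟩
  have iU : Integrable (fun ξ => FourierTransform.fourier (fun x => (v x : ℂ)) ξ *
      FourierTransformInv.fourierInv ψ ξ) :=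
    hψ2.bdd_mul (c := B) hF.aestronglyMeasurable (Filter.Eventually.of_forall hB)
  have iV : ∀ c : EucSpace d → ℝ, Continuous c → Integrable (fun ξ =>
      (Real.fourierChar (c ξ) : ℂ) * (FourierTransform.fourier (fun x => (v x : ℂ)) ξ *
      FourierTransformInv.fourierInv ψ ξ)) := fun c hc =>
    iU.bdd_mul (c := 1) (continuous_induced_dom.comp
      (Real.continuous_fourierChar.comp hc)).aestronglyMeasurable
      (Filter.Eventually.of_forall fun θ => (Circle.norm_coe _).le)
  simp_rw [sub_mul]
  rw [integral_sub (iV _ (by fun_prop)) (iV _ (by fun_prop)), ← h1]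
  simp_rw [inner_neg_left] at h2
  rw [← h2, ← integral_sub (i z) (i (-z))]
  refine integral_congr_ae (Filter.Eventually.of_forall fun x => ?_)
  simp only [← sub_eq_add_neg]
  push_cast
  ring

theorem integrable_chordKernel_mul_test [NeZero d] (ha : 0 < a) (ha1 : a < 1)
    (hv : Continuous v) (hC : ∀ L, ∃ C, ChordBound a v L C) (hψ : Continuous ψ)
    (hψc : HasCompactSupport ψ) (j : Fin d) :
    Integrable (fun q : EucSpace d × (EucSpace d × ℝ) =>
      ((chordKernel a v q.1 q.2 * q.2.1 j : ℝ) : ℂ) * ψ q.1)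
      (volume.prod (volume.restrict ((univ : Set (EucSpace d)) ×ˢ Ioi (0 : ℝ)))) := by
  obtain ⟨L, hL⟩ := hψc.isCompact.isBounded.exists_norm_le
  obtain ⟨C, hC⟩ := hC L
  have hm : Measurable (fun q : EucSpace d × (EucSpace d × ℝ) => chordKernel a v q.1 q.2) := by
    have := hv.measurable
    unfold chordKernel
    fun_prop
  have hψm := hψ.measurable
  have i1 : Integrable (fun q : EucSpace d × (EucSpace d × ℝ) => ‖ψ q.1‖ * (C * chordMajorant a q.2))
      (volume.prod (volume.restrict ((univ : Set (EucSpace d)) ×ˢ Ioi (0 : ℝ)))) :=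
    Integrable.mul_prod (hψ.integrable_of_hasCompactSupport hψc).norm
      ((integrable_chordMajorant ha ha1).const_mul C).integrableOn
  refine i1.mono' (Measurable.aestronglyMeasurable (by fun_prop)) ?_
  have hae : ∀ᵐ q ∂(volume.prod (volume.restrict ((univ : Set (EucSpace d)) ×ˢ Ioi (0 : ℝ)))),
      (q : EucSpace d × (EucSpace d × ℝ)).2 ∈ (univ : Set (EucSpace d)) ×ˢ Ioi (0 : ℝ) :=
    Measure.quasiMeasurePreserving_snd.ae
      (ae_restrict_mem (MeasurableSet.univ.prod measurableSet_Ioi))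
  filter_upwards [hae] with q hq
  by_cases h0 : ψ q.1 = 0
  · simp [h0]
  · have hx := hL q.1 (subset_tsupport _ h0)
    rw [norm_mul, mul_comm, Complex.norm_real, norm_mul]
    refine mul_le_mul_of_nonneg_left ?_ (norm_nonneg _)
    refine le_trans ?_ (abs_chordKernel_mul_norm_le ha hC hx hq.2)
    rw [Real.norm_eq_abs]
    exact mul_le_mul_of_nonneg_left (PiLp.norm_apply_le _ j) (abs_nonneg _)

theorem integral_chordKernel_mul_fourier [NeZero d] {U : EucSpace d → ℂ}
    (hU : Integrable U) (j : Fin d) (r : ℝ) :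
    ∫ θ : EucSpace d, ((Real.exp (-Real.pi * ‖θ‖ ^ 2) * θ j : ℝ) : ℂ) *
      ∫ ξ, ((Real.fourierChar (inner ℝ (r • θ) ξ) : ℂ) -
        (Real.fourierChar (-inner ℝ (r • θ) ξ) : ℂ)) * U ξ =
      ∫ ξ, (2 * Complex.I * ((r * ξ j : ℝ) : ℂ) *
        ((Real.exp (-Real.pi * ‖r • ξ‖ ^ 2) : ℝ) : ℂ)) * U ξ := by
  have hcc : Continuous (fun z : Circle => (z : ℂ)) := continuous_induced_dom
  have i1 : Integrable (fun q : EucSpace d × EucSpace d =>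
      ((Real.fourierChar (inner ℝ (r • q.1) q.2) : ℂ) -
        (Real.fourierChar (-inner ℝ (r • q.1) q.2) : ℂ)) *
      (((Real.exp (-Real.pi * ‖q.1‖ ^ 2) * q.1 j : ℝ) : ℂ) * U q.2)) := by
    refine ((integrable_gaussian_mul_coord j).ofReal.mul_prod hU).bdd_mul (c := 2)
      (Continuous.aestronglyMeasurable ?_) (Filter.Eventually.of_forall fun q => ?_)
    · exact (hcc.comp (Real.continuous_fourierChar.comp (by fun_prop))).sub
        (hcc.comp (Real.continuous_fourierChar.comp (by fun_prop)))
    · refine (norm_sub_le _ _).trans ?_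
      rw [Circle.norm_coe, Circle.norm_coe]; norm_num
  simp_rw [← integral_const_mul]
  have e1 : ∀ θ ξ : EucSpace d, ((Real.exp (-Real.pi * ‖θ‖ ^ 2) * θ j : ℝ) : ℂ) *
      (((Real.fourierChar (inner ℝ (r • θ) ξ) : ℂ) -
        (Real.fourierChar (-inner ℝ (r • θ) ξ) : ℂ)) * U ξ) =
      ((Real.fourierChar (inner ℝ (r • θ) ξ) : ℂ) -
        (Real.fourierChar (-inner ℝ (r • θ) ξ) : ℂ)) *
      (((Real.exp (-Real.pi * ‖θ‖ ^ 2) * θ j : ℝ) : ℂ) * U ξ) := fun θ ξ => by ring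
  simp_rw [e1]
  rw [integral_integral_swap i1]
  refine integral_congr_ae (Filter.Eventually.of_forall fun ξ => ?_)
  have h := integral_gaussian_mul_coord_mul_fourierChar_sub j (r • ξ)
  simp only
  rw [PiLp.smul_apply, smul_eq_mul] at h
  rw [← h, ← integral_mul_const]
  refine integral_congr_ae (Filter.Eventually.of_forall fun θ => ?_)
  simp only [real_inner_smul_left, real_inner_smul_right]
  ring

/-- On the Fourier side the symmetric difference of v becomes a difference of characters. The
Gaussian integrates out θ, the integral over r gives Γ(1-a)/2 · π^(a-1) ‖ξ‖^(2a-2), and `chordConst`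
normalizes the product to the required symbol. -/
theorem integral_chordGradient_mul [NeZero d] (ha : 0 < a) (ha1 : a < 1)
    (hv : Continuous v) (hvi : Integrable v) (hC : ∀ L, ∃ C, ChordBound a v L C)
    (hψ : ContDiff ℝ ((⊤ : ℕ∞) : WithTop ℕ∞) ψ) (hψc : HasCompactSupport ψ) (j : Fin d) :
    ∫ x, ((chordGradient a v x j : ℝ) : ℂ) * ψ x =
      ∫ ξ : EucSpace d, (Complex.I * ((2 * Real.pi * ξ j : ℝ) : ℂ) *
          (((2 * Real.pi * ‖ξ‖) ^ (2 * a - 2) : ℝ) : ℂ)) *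
        FourierTransform.fourier (fun x => (v x : ℂ)) ξ * FourierTransformInv.fourierInv ψ ξ := by
  obtain ⟨f, hf, hψ3⟩ := exists_schwartzMap_fourierInv hψ hψc
  have hψ2 : Integrable (FourierTransformInv.fourierInv ψ) := by rw [hf]; exact f.integrable
  set U : EucSpace d → ℂ := fun ξ => FourierTransform.fourier (fun x => (v x : ℂ)) ξ *
      FourierTransformInv.fourierInv ψ ξ with hU
  have hF : Continuous (FourierTransform.fourier (fun x => (v x : ℂ))) :=
    VectorFourier.fourierIntegral_continuous Real.continuous_fourierChar continuous_inner
      hvi.ofReal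
  obtain ⟨B, hB⟩ : ∃ B, ∀ ξ, ‖FourierTransform.fourier (fun x => (v x : ℂ)) ξ‖ ≤ B :=
    ⟨_, fun ξ => VectorFourier.norm_fourierIntegral_le_integral_norm _ _ _ _ _⟩
  have iU : Integrable U :=
    hψ2.bdd_mul (c := B) hF.aestronglyMeasurable (Filter.Eventually.of_forall hB)
  have mU : Measurable U := by
    rw [hU, hf]
    have := f.continuous
    exact (by fun_prop : Continuous fun ξ => FourierTransform.fourier (fun x => (v x : ℂ)) ξ *
      f ξ).measurable
  have bU : ∀ ξ, ‖U ξ‖ ≤ B * ‖f ξ‖ := fun ξ => by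
    rw [hU, hf, norm_mul]
    exact mul_le_mul_of_nonneg_right (hB ξ) (norm_nonneg _)
  have i1 := integrable_chordKernel_mul_test ha ha1 hv hC hψ.continuous hψc j
  have s1 : ∫ x, ((chordGradient a v x j : ℝ) : ℂ) * ψ x = (chordConst a : ℂ) *
      ∫ x, ∫ p in (univ : Set (EucSpace d)) ×ˢ Ioi (0 : ℝ),
        ((chordKernel a v x p * p.1 j : ℝ) : ℂ) * ψ x := by
    rw [← integral_const_mul]
    refine integral_congr_ae (Filter.Eventually.of_forall fun x => ?_)
    obtain ⟨C, hC⟩ := hC ‖x‖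
    simp only
    rw [chordGradient_apply ha ha1 hv.measurable hC le_rfl j, integral_mul_const,
      integral_complex_ofReal]
    push_cast
    ring
  rw [s1, integral_integral_swap i1]
  have hS : (volume.restrict ((univ : Set (EucSpace d)) ×ˢ Ioi (0 : ℝ)) :
      Measure (EucSpace d × ℝ)) = volume.prod (volume.restrict (Ioi (0 : ℝ))) := by
    rw [Measure.volume_eq_prod, ← Measure.prod_restrict, Measure.restrict_univ]
  have s2 : ∀ p : EucSpace d × ℝ, ∫ x, ((chordKernel a v x p * p.1 j : ℝ) : ℂ) * ψ x =
      ((p.2 ^ (-(2 * a)) : ℝ) : ℂ) * (((Real.exp (-Real.pi * ‖p.1‖ ^ 2) * p.1 j : ℝ) : ℂ) *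
      ∫ ξ, ((Real.fourierChar (inner ℝ (p.2 • p.1) ξ) : ℂ) -
        (Real.fourierChar (-inner ℝ (p.2 • p.1) ξ) : ℂ)) * U ξ) := by
    intro p
    rw [← integral_sub_translate_mul hvi hψ.continuous hψc hv hψ2 hψ3, ← integral_const_mul,
      ← integral_const_mul]
    refine integral_congr_ae (Filter.Eventually.of_forall fun x => ?_)
    simp only [chordKernel]
    push_cast
    ring
  have i2 := i1.integral_prod_right
  simp only at i2
  simp_rw [s2] at i2 ⊢
  rw [hS] at i2 ⊢
  -- The order matters: θ goes before r and ξ are exchanged. The difference of characters does not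
  -- decay in r, so for a ≤ 1/2 the weight r^(-2a) is not absolutely integrable at infinity until
  -- the Gaussian in r ξ has appeared.
  rw [integral_prod_symm _ i2]
  simp only
  simp_rw [integral_const_mul, integral_chordKernel_mul_fourier iU]
  have s3 : ∀ r ∈ Ioi (0 : ℝ), ((r ^ (-(2 * a)) : ℝ) : ℂ) * ∫ ξ,
      (2 * Complex.I * ((r * ξ j : ℝ) : ℂ) *
        ((Real.exp (-Real.pi * ‖r • ξ‖ ^ 2) : ℝ) : ℂ)) * U ξ =
      ∫ ξ, 2 * Complex.I * (U ξ * (ξ j : ℂ) *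
      ((r ^ (1 - 2 * a) * Real.exp (-Real.pi * ‖r • ξ‖ ^ 2) : ℝ) : ℂ)) := by
    intro r (hr : 0 < r)
    rw [← integral_const_mul]
    refine integral_congr_ae (Filter.Eventually.of_forall fun ξ => ?_)
    simp only
    rw [show 1 - 2 * a = 1 + -(2 * a) by ring, Real.rpow_add hr, Real.rpow_one]
    push_cast
    ring
  have i3 := (integrable_mul_gaussian_dilation f ha ha1 mU bU j).const_mul (2 * Complex.I)
  rw [setIntegral_congr_fun measurableSet_Ioi s3, integral_integral_swap i3,
    ← integral_const_mul]
  refine integral_congr_ae (Filter.Eventually.of_forall fun ξ => ?_)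
  simp only
  -- At ξ = 0 both sides vanish through the coordinate ξ j, whatever value the negative power of 0
  -- takes.
  rcases eq_or_ne ξ 0 with rfl | hξ
  · simp
  · have hn : 0 < ‖ξ‖ := norm_pos_iff.2 hξ
    have hG : (Real.Gamma (1 - a)) ≠ 0 := (Real.Gamma_pos_of_pos (by linarith)).ne'
    rw [integral_const_mul, integral_const_mul, integral_complex_ofReal,
      (integral_rpow_mul_gaussian_dilation ha1 hξ).2]
    have hconst : chordConst a * (2 * (Real.Gamma (1 - a) / 2 *
        (Real.pi ^ (a - 1) * ‖ξ‖ ^ (2 * a - 2)))) =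
        2 * Real.pi * (2 * Real.pi * ‖ξ‖) ^ (2 * a - 2) := by
      rw [chordConst, Real.mul_rpow (by positivity) hn.le, Real.mul_rpow two_pos.le Real.pi_pos.le,
        show 2 * a - 1 = (2 * a - 2) + 1 by ring, Real.rpow_add two_pos, Real.rpow_one,
        show 2 * a - 2 = (a - 1) + (a - 1) by ring, Real.rpow_add Real.pi_pos,
        Real.rpow_sub Real.pi_pos a 1, Real.rpow_one]
      field_simp
    have hconst' := congrArg (fun t : ℝ => (t : ℂ)) hconst
    rw [hU]
    push_cast at hconst' ⊢
    linear_combination (Complex.I * (ξ j : ℂ) * (FourierTransform.fourier (fun x => (v x : ℂ)) ξ *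
      FourierTransformInv.fourierInv ψ ξ)) * hconst'

theorem isFractionalGradient_chordGradient [NeZero d] (ha : 0 < a) (ha1 : a < 1)
    (hv : Continuous v) (hvi : Integrable v) (hC : ∀ L, ∃ C, ChordBound a v L C) :
    IsFractionalGradient (2 * a) v (chordGradient a v) :=
  ⟨hvi, locallyIntegrable_chordGradient ha ha1 hv.measurable hC, fun j _ hψ hψc =>
    integral_chordGradient_mul ha ha1 hv hvi hC hψ hψc j⟩

end parseval

end FourierIdentity

/-! ### The chord gradient of (ρ² - ‖x‖²)₊^a for a < 1. -/

section BallPower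

variable {d : ℕ} {a : ℝ}

theorem continuous_ballPower (ha : 0 < a) (ρ : ℝ) : Continuous (ballPower (d := d) a ρ) := by
  unfold ballPower
  exact (by fun_prop : Continuous fun x : EucSpace d => max (ρ ^ 2 - ‖x‖ ^ 2) 0).rpow_const
    (fun _ => Or.inr ha.le)

theorem measurable_uncurry_ballPower :
    Measurable (Function.uncurry (ballPower (d := d) a)) := by
  unfold ballPower Function.uncurry
  fun_prop

theorem ballPower_eq_zero (ha : 0 < a) {ρ : ℝ} (hρ : 0 ≤ ρ) {x : EucSpace d} (hx : ρ ≤ ‖x‖) :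
    ballPower a ρ x = 0 := by
  rw [ballPower, max_eq_right, Real.zero_rpow ha.ne']
  nlinarith

theorem integrable_ballPower (ha : 0 < a) {ρ : ℝ} (hρ : 0 ≤ ρ) :
    Integrable (ballPower (d := d) a ρ) := by
  refine (continuous_ballPower ha ρ).integrable_of_hasCompactSupport ?_
  refine HasCompactSupport.of_support_subset_isCompact
    (isCompact_closedBall (0 : EucSpace d) ρ) fun x hx => ?_
  rw [mem_closedBall_zero_iff]
  by_contra h
  exact hx (ballPower_eq_zero ha hρ (not_le.1 h).le)

theorem abs_max_rpow_sub_le (ha : 0 < a) (ha1 : a ≤ 1) (s t : ℝ) :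
    |(max s 0) ^ a - (max t 0) ^ a| ≤ |s - t| ^ a := by
  wlog h : t ≤ s generalizing s t
  · rw [abs_sub_comm, abs_sub_comm s]
    exact this t s (le_of_not_ge h)
  have h1 : max t 0 ≤ max s 0 := max_le_max_right _ h
  have h0 : 0 ≤ max t 0 := le_max_right _ _
  rw [abs_of_nonneg (sub_nonneg.2 (Real.rpow_le_rpow h0 h1 ha.le)), abs_of_nonneg (sub_nonneg.2 h)]
  have h2 := Real.rpow_add_le_add_rpow h0 (sub_nonneg.2 h1) ha.le ha1
  rw [add_sub_cancel] at h2
  have h3 : (max s 0 - max t 0) ^ a ≤ (s - t) ^ a := by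
    refine Real.rpow_le_rpow (sub_nonneg.2 h1) ?_ ha.le
    have := abs_max_sub_max_le_abs s t 0
    rwa [abs_of_nonneg (sub_nonneg.2 h1), abs_of_nonneg (sub_nonneg.2 h)] at this
  linarith

/-- The squared norms of x + z and x - z differ by 4⟨x, z⟩ alone, so Hölder continuity of the power
gives (4 L ‖z‖)^a. For ‖z‖ > L + ρ both values vanish; for smaller z one factor ‖z‖ ≤ L + R is
traded for the exponent a - 1. The constant involves ρ only through its bound R, which later makes
the estimates uniform in time. -/
theorem chordBound_ballPower (ha : 0 < a) (ha1 : a < 1) {ρ R : ℝ} (hρ : 0 ≤ ρ) (hR : ρ ≤ R)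
    (L : ℝ) : ChordBound a (ballPower (d := d) a ρ) L ((4 * L) ^ a * (1 + L + R)) := by
  intro x hx z
  have hL : 0 ≤ L := (norm_nonneg x).trans hx
  have h4 : 0 ≤ (4 * L) ^ a := Real.rpow_nonneg (by positivity) _
  have key : |ballPower a ρ (x + z) - ballPower a ρ (x - z)| ≤ (4 * L) ^ a * ‖z‖ ^ a := by
    refine (abs_max_rpow_sub_le ha ha1.le _ _).trans ?_
    rw [← Real.mul_rpow (by positivity) (norm_nonneg _)]
    refine Real.rpow_le_rpow (abs_nonneg _) ?_ ha.le
    rw [norm_add_sq_real, norm_sub_sq_real,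
      show ρ ^ 2 - (‖x‖ ^ 2 + 2 * inner ℝ x z + ‖z‖ ^ 2) -
        (ρ ^ 2 - (‖x‖ ^ 2 - 2 * inner ℝ x z + ‖z‖ ^ 2)) = -4 * inner ℝ x z by ring,
      abs_mul, show |(-4 : ℝ)| = 4 by norm_num, mul_assoc]
    refine mul_le_mul_of_nonneg_left ((abs_real_inner_le_norm x z).trans ?_) (by norm_num)
    gcongr
  rcases eq_or_ne z 0 with rfl | hz
  · simp only [add_zero, sub_zero, sub_self, abs_zero]
    constructor <;> exact mul_nonneg (mul_nonneg h4 (by linarith)) (Real.rpow_nonneg (norm_nonneg _) _)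
  have hn : 0 < ‖z‖ := norm_pos_iff.2 hz
  have hza := Real.rpow_pos_of_pos hn a
  have hza1 := Real.rpow_pos_of_pos hn (a - 1)
  constructor
  · refine key.trans ?_
    gcongr
    exact le_mul_of_one_le_right h4 (by linarith)
  · rcases le_or_gt ‖z‖ (L + ρ) with h | h
    · refine key.trans ?_
      rw [show ‖z‖ ^ a = ‖z‖ * ‖z‖ ^ (a - 1) by
        rw [Real.rpow_sub hn, Real.rpow_one]; field_simp, ← mul_assoc]
      gcongr
      linarith
    · have e1 : ρ ≤ ‖x + z‖ := by
        have := norm_sub_le (x + z) x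
        rw [add_sub_cancel_left] at this
        linarith
      have e2 : ρ ≤ ‖x - z‖ := by
        have := norm_sub_le x (x - z)
        rw [sub_sub_cancel] at this
        linarith
      rw [ballPower_eq_zero ha hρ e1, ballPower_eq_zero ha hρ e2, sub_zero, abs_zero]
      exact mul_nonneg (mul_nonneg h4 (by linarith)) hza1.le

/-- Integrating over r first, the direction θ contributes a multiple of ‖θ‖^(2a-2) ⟨x, θ⟩ θ, whose
Gaussian integral is a multiple of x. The factor Γ(1 - a) cancels against `chordConst`. -/
theorem chordGradient_ballPower [NeZero d] (ha : 0 < a) (ha1 : a < 1) {ρ : ℝ}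
    {x : EucSpace d} (hx : ‖x‖ < ρ) :
    chordGradient a (ballPower a ρ) x = -(2 ^ (2 * a) * Real.Gamma (1 + a) *
      Real.Gamma (d / 2 + a) / (d * Real.Gamma (d / 2))) • x := by
  have hρ : 0 ≤ ρ := (norm_nonneg x).trans hx.le
  have hC := chordBound_ballPower (d := d) ha ha1 hρ le_rfl ‖x‖
  ext j
  have hS : (volume.restrict ((univ : Set (EucSpace d)) ×ˢ Ioi (0 : ℝ)) :
      Measure (EucSpace d × ℝ)) = volume.prod (volume.restrict (Ioi (0 : ℝ))) := by
    rw [Measure.volume_eq_prod, ← Measure.prod_restrict, Measure.restrict_univ]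
  have i1 : Integrable (fun p : EucSpace d × ℝ => chordKernel a (ballPower a ρ) x p * p.1 j)
      (volume.restrict ((univ : Set (EucSpace d)) ×ˢ Ioi (0 : ℝ))) :=
    (EuclideanSpace.proj (𝕜 := ℝ) j).integrable_comp
      (integrableOn_chordKernel_smul ha ha1 (continuous_ballPower ha ρ).measurable hC le_rfl)
  rw [chordGradient_apply ha ha1 (continuous_ballPower ha ρ).measurable hC le_rfl]
  rw [hS] at i1 ⊢
  rw [integral_prod _ i1]
  have s1 : ∀ θ : EucSpace d, ∫ r in Ioi (0 : ℝ), chordKernel a (ballPower a ρ) x (θ, r) * θ j =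
      -(2 * Real.Gamma (1 + a) * Real.Gamma (1 - a)) *
        (Real.exp (-Real.pi * ‖θ‖ ^ 2) * ‖θ‖ ^ (2 * a - 2) *
        (inner ℝ θ x * inner ℝ θ (EuclideanSpace.single j 1))) := by
    intro θ
    rcases eq_or_ne θ 0 with rfl | hθ
    · simp
    · simp only [chordKernel]
      rw [integral_mul_const, integral_const_mul, integral_ballPower_chord ha ha1 hx hθ,
        EuclideanSpace.inner_single_right, real_inner_comm]
      simp
      ring
  simp only
  simp_rw [s1]
  rw [integral_const_mul, integral_gaussian_mul_inner_mul_inner (by linarith),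
    EuclideanSpace.inner_single_right, chordConst, show (2 * a) / 2 = a by ring,
    show ((d : ℝ) + 2 * a) / 2 = d / 2 + a by ring, Real.rpow_sub two_pos, Real.rpow_one,
    PiLp.smul_apply, smul_eq_mul]
  have h1 : Real.Gamma (1 - a) ≠ 0 := (Real.Gamma_pos_of_pos (by linarith)).ne'
  have hpi := (Real.rpow_pos_of_pos Real.pi_pos a).ne'
  have hd : (0 : ℝ) < d := by exact_mod_cast NeZero.pos d
  have hG : Real.Gamma ((d : ℝ) / 2) ≠ 0 := (Real.Gamma_pos_of_pos (by positivity)).ne'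
  simp only [conj_trivial]
  field_simp

end BallPower

/-! ### The case α = 2, and both cases combined. -/

section BallPowerGradient

variable {d : ℕ}

/-- Integration by parts for Lipschitz functions is applied to real test functions, so the real and
imaginary parts are handled through a real linear map L. -/
theorem integral_ofReal_lineDeriv_mul {f : EucSpace d → ℝ} {C : ℝ≥0} (hf : LipschitzWith C f)
    {ψ : EucSpace d → ℂ} (hψ : ContDiff ℝ ((⊤ : ℕ∞) : WithTop ℕ∞) ψ) (hψc : HasCompactSupport ψ)
    (w : EucSpace d) :
    ∫ x, ((lineDeriv ℝ f x w : ℝ) : ℂ) * ψ x = ∫ x, (f x : ℂ) * -(lineDeriv ℝ ψ x w) := by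
  have hψd : Differentiable ℝ ψ := hψ.differentiable (by simp)
  have key : ∀ L : ℂ →L[ℝ] ℝ, (∀ (r : ℝ) (z : ℂ), L ((r : ℂ) * z) = r * L z) →
      L (∫ x, ((lineDeriv ℝ f x w : ℝ) : ℂ) * ψ x) = L (∫ x, (f x : ℂ) * -(lineDeriv ℝ ψ x w)) := by
    intro L hL
    have hg : ContDiff ℝ ((⊤ : ℕ∞) : WithTop ℕ∞) (L ∘ ψ) := L.contDiff.comp hψ
    have hgc : HasCompactSupport (L ∘ ψ) := hψc.comp_left (map_zero L)
    obtain ⟨D, hD⟩ := ContDiff.lipschitzWith_of_hasCompactSupport (𝕂 := ℝ) hgc hg (by simp)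
    have h := LipschitzWith.integral_lineDeriv_mul_eq (μ := volume) hf hD hgc w
    have hlin : ∀ x, lineDeriv ℝ ψ x w = fderiv ℝ ψ x w := fun x =>
      (hψd x).lineDeriv_eq_fderiv
    have hlinL : ∀ x, lineDeriv ℝ (L ∘ ψ) x (-w) = -L (lineDeriv ℝ ψ x w) := by
      intro x
      rw [((L.differentiable.comp hψd) x).lineDeriv_eq_fderiv, hlin,
        fderiv_comp x L.differentiableAt (hψd x), L.fderiv]
      simp
    have i1 : Integrable (fun x => ((lineDeriv ℝ f x w : ℝ) : ℂ) * ψ x) := by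
      refine (hψ.continuous.integrable_of_hasCompactSupport hψc).bdd_mul
        (c := C * ‖w‖) ?_ (Filter.Eventually.of_forall fun x => ?_)
      · exact (Complex.measurable_ofReal.comp
          (measurable_lineDeriv hf.continuous)).aestronglyMeasurable
      · rw [Complex.norm_real]
        exact norm_lineDeriv_le_of_lipschitz ℝ hf
    have i2 : Integrable (fun x => (f x : ℂ) * -(lineDeriv ℝ ψ x w)) := by
      refine Continuous.integrable_of_hasCompactSupport ?_ ?_
      · simp_rw [hlin]
        have h1 := hψ.continuous_fderiv (by simp)
        have h2 := hf.continuous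
        fun_prop
      · refine HasCompactSupport.mul_left ?_
        simp_rw [hlin]
        exact ((hψc.fderiv ℝ).comp_left (g := fun A : EucSpace d →L[ℝ] ℂ => -(A w)) (by simp))
    rw [← L.integral_comp_comm i1, ← L.integral_comp_comm i2]
    simp_rw [hL, map_neg]
    simp_rw [hlinL] at h
    simp only [Function.comp_apply] at h
    rw [h]
    refine integral_congr_ae (Filter.Eventually.of_forall fun x => ?_)
    simp only
    ring
  refine Complex.ext (key Complex.reCLM fun r z => ?_) (key Complex.imCLM fun r z => ?_)
  · simp
  · simp

theorem lipschitzWith_ballPower_one {ρ : ℝ} (hρ : 0 ≤ ρ) :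
    LipschitzWith (2 * ρ).toNNReal (ballPower (d := d) 1 ρ) := by
  -- The form ρ² - min(‖x‖, ρ)² exposes the square of a 1-Lipschitz function with values in [0, ρ].
  have e : ∀ x : EucSpace d, ballPower 1 ρ x = ρ ^ 2 - min ‖x‖ ρ ^ 2 := by
    intro x
    rw [ballPower, Real.rpow_one]
    have := norm_nonneg x
    rcases le_total ‖x‖ ρ with h | h
    · rw [min_eq_left h, max_eq_left (by nlinarith)]
    · rw [min_eq_right h, max_eq_right (by nlinarith), sub_self]
  refine LipschitzWith.of_dist_le_mul fun x y => ?_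
  rw [Real.dist_eq, e, e, Real.coe_toNNReal _ (by positivity), dist_eq_norm]
  have h1 : |min ‖x‖ ρ - min ‖y‖ ρ| ≤ ‖x - y‖ :=
    (abs_min_sub_min_le_max _ _ _ _).trans (by simpa using abs_norm_sub_norm_le x y)
  have h2 : 0 ≤ min ‖x‖ ρ := le_min (norm_nonneg _) hρ
  have h3 : 0 ≤ min ‖y‖ ρ := le_min (norm_nonneg _) hρ
  have h4 : min ‖x‖ ρ ≤ ρ := min_le_right _ _
  have h5 : min ‖y‖ ρ ≤ ρ := min_le_right _ _
  rw [show ρ ^ 2 - min ‖x‖ ρ ^ 2 - (ρ ^ 2 - min ‖y‖ ρ ^ 2) =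
    -((min ‖x‖ ρ + min ‖y‖ ρ) * (min ‖x‖ ρ - min ‖y‖ ρ)) by ring, abs_neg, abs_mul,
    abs_of_nonneg (by positivity)]
  gcongr
  linarith

/-- The gradient of `(ρ² - ‖x‖²)₊`. -/
noncomputable def paraboloidGradient (ρ : ℝ) (x : EucSpace d) : EucSpace d :=
  if ‖x‖ < ρ then (-2 : ℝ) • x else 0

theorem lineDeriv_ballPower_one {ρ : ℝ} (hρ : 0 ≤ ρ) {x : EucSpace d} (hx : ‖x‖ ≠ ρ) (j : Fin d) :
    lineDeriv ℝ (ballPower 1 ρ) x (EuclideanSpace.single j (1 : ℝ)) =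
      paraboloidGradient ρ x j := by
  have hcont : Continuous (fun t : ℝ => ‖x + t • EuclideanSpace.single j (1 : ℝ)‖) := by fun_prop
  have h0 : ‖x + (0 : ℝ) • EuclideanSpace.single j (1 : ℝ)‖ = ‖x‖ := by simp
  rcases lt_or_gt_of_ne hx with h | h
  · rw [paraboloidGradient, if_pos h]
    have hev : ∀ᶠ t in nhds (0 : ℝ), ‖x + t • EuclideanSpace.single j (1 : ℝ)‖ < ρ :=
      hcont.continuousAt.eventually_lt continuousAt_const (by rwa [h0])
    refine HasLineDerivAt.lineDeriv (HasDerivAt.congr_of_eventuallyEq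
      (f := fun t : ℝ => ρ ^ 2 - (‖x‖ ^ 2 + 2 * t * x j + t ^ 2)) ?_ ?_)
    · have := ((((hasDerivAt_id (0 : ℝ)).const_mul 2).mul_const (x j)).const_add (‖x‖ ^ 2)).add
        ((hasDerivAt_id (0 : ℝ)).pow 2)
      refine (this.const_sub (ρ ^ 2)).congr_deriv ?_
      simp
    · filter_upwards [hev] with t ht
      rw [ballPower, Real.rpow_one, max_eq_left, norm_add_sq_real, norm_smul,
        real_inner_smul_right, EuclideanSpace.inner_single_right]
      · simp
        ring
      · have := norm_nonneg (x + t • EuclideanSpace.single j (1 : ℝ))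
        nlinarith
  · rw [paraboloidGradient, if_neg (not_lt.2 h.le)]
    have hev : ∀ᶠ t in nhds (0 : ℝ), ρ < ‖x + t • EuclideanSpace.single j (1 : ℝ)‖ :=
      continuousAt_const.eventually_lt hcont.continuousAt (by rwa [h0])
    refine HasLineDerivAt.lineDeriv (HasDerivAt.congr_of_eventuallyEq
      (f := fun _ : ℝ => (0 : ℝ)) (hasDerivAt_const _ _) ?_)
    filter_upwards [hev] with t ht
    exact ballPower_eq_zero one_pos hρ ht.le

theorem measurable_uncurry_paraboloidGradient :
    Measurable (Function.uncurry (paraboloidGradient (d := d))) := by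
  unfold Function.uncurry paraboloidGradient
  exact Measurable.ite (measurableSet_lt (by fun_prop) (by fun_prop)) (by fun_prop) (by fun_prop)

theorem norm_paraboloidGradient_le (ρ : ℝ) (x : EucSpace d) :
    ‖paraboloidGradient ρ x‖ ≤ 2 * ‖x‖ := by
  unfold paraboloidGradient
  split_ifs
  · rw [norm_smul]; norm_num
  · simp

/-- Off the sphere, a null set, this is the classical derivative; integration by parts and Parseval
give the symbol 2πi ξ_j. The factor with exponent α - 2 = 0 is 1 even at ξ = 0. -/
theorem isFractionalGradient_paraboloidGradient [NeZero d] {ρ : ℝ} (hρ : 0 ≤ ρ) :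
    IsFractionalGradient 2 (ballPower (d := d) 1 ρ) (paraboloidGradient ρ) := by
  have hvi := integrable_ballPower (d := d) one_pos hρ
  refine ⟨hvi, ?_, fun j ψ hψ hψc => ?_⟩
  · have hm : Measurable (paraboloidGradient (d := d) ρ) :=
      measurable_uncurry_paraboloidGradient.of_uncurry_left
    have hb : LocallyIntegrable (fun x : EucSpace d => 2 * ‖x‖) :=
      (by fun_prop : Continuous fun x : EucSpace d => 2 * ‖x‖).locallyIntegrable
    refine hb.mono hm.aestronglyMeasurable (Filter.Eventually.of_forall fun x => ?_)
    rw [Real.norm_of_nonneg (by positivity)]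
    exact norm_paraboloidGradient_le ρ x
  obtain ⟨f, hf, hψ3⟩ := exists_schwartzMap_fourierInv hψ hψc
  rw [hf] at hψ3 ⊢
  have hline : ∀ x, -(lineDeriv ℝ ψ x (EuclideanSpace.single j (1 : ℝ))) =
      FourierTransform.fourier (fun θ : EucSpace d => 2 * Real.pi * Complex.I * (θ j * f θ)) x := by
    intro x
    have h := hasLineDerivAt_fourier f.integrable (by simpa using f.integrable_pow_mul volume 1) j x
    rw [hψ3, fourier_const_mul] at h
    rw [h.lineDeriv, fourier_const_mul]
    ring
  have s1 : ∫ x, ((paraboloidGradient ρ x j : ℝ) : ℂ) * ψ x =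
      ∫ x, ((lineDeriv ℝ (ballPower 1 ρ) x (EuclideanSpace.single j (1 : ℝ)) : ℝ) : ℂ) * ψ x := by
    have hae : ∀ᵐ x : EucSpace d, x ∉ Metric.sphere (0 : EucSpace d) ρ :=
      measure_eq_zero_iff_ae_notMem.1 (Measure.addHaar_sphere volume 0 ρ)
    refine integral_congr_ae ?_
    filter_upwards [hae] with x hx
    rw [lineDeriv_ballPower_one hρ (fun h => hx (by simpa using h))]
  rw [s1, integral_ofReal_lineDeriv_mul (lipschitzWith_ballPower_one hρ) hψ hψc]
  simp_rw [hline]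
  have ig : Integrable (fun θ : EucSpace d => 2 * Real.pi * Complex.I * (θ j * f θ)) := by
    refine Integrable.const_mul ?_ _
    have h1 : Integrable (fun θ : EucSpace d => ‖θ‖ * ‖f θ‖) := by
      simpa using f.integrable_pow_mul volume 1
    have hfc := f.continuous
    refine h1.mono (by fun_prop : Continuous fun θ : EucSpace d =>
      (θ j : ℂ) * f θ).aestronglyMeasurable (Filter.Eventually.of_forall fun θ => ?_)
    rw [norm_mul, norm_mul, norm_norm, norm_norm, Complex.norm_real]
    gcongr
    exact PiLp.norm_apply_le _ j
  have h := VectorFourier.integral_fourierIntegral_smul_eq_flip (L := innerₗ (EucSpace d))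
    (μ := volume) (ν := volume) Real.continuous_fourierChar continuous_inner
    hvi.ofReal ig
  rw [flip_innerₗ] at h
  simp only [smul_eq_mul] at h
  refine Eq.trans h.symm (integral_congr_ae (Filter.Eventually.of_forall fun ξ => ?_))
  simp only [sub_self, Real.rpow_zero]
  push_cast
  change FourierTransform.fourier (fun x : EucSpace d => ((ballPower 1 ρ x : ℝ) : ℂ)) ξ * _ = _
  ring

/-- The factor by which the fractional gradient of `(ρ² - ‖x‖²)₊^(α/2)` contracts the ball. -/
noncomputable def contractionRate (d : ℕ) (α : ℝ) : ℝ :=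
  2 ^ α * Real.Gamma (1 + α / 2) * Real.Gamma (d / 2 + α / 2) / (d * Real.Gamma (d / 2))

/-- Joint measurability and the bound uniform in ρ ≤ R serve local integrability in space-time. An
explicit value is recorded only inside the ball, which is all the flux requires. -/
theorem exists_fractionalGradient_ballPower (d : ℕ) [NeZero d] {α : ℝ} (hα : 0 < α)
    (hα2 : α ≤ 2) :
    ∃ G : ℝ → EucSpace d → EucSpace d, Measurable (Function.uncurry G) ∧
      (∀ L R, ∃ B, ∀ ρ, 0 ≤ ρ → ρ ≤ R → ∀ x, ‖x‖ ≤ L → ‖G ρ x‖ ≤ B) ∧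
      (∀ ρ, 0 ≤ ρ → IsFractionalGradient α (ballPower (α / 2) ρ) (G ρ)) ∧
      ∀ ρ x, ‖x‖ < ρ → G ρ x = -contractionRate d α • x := by
  have hd : (0 : ℝ) < d := by exact_mod_cast NeZero.pos d
  rcases hα2.lt_or_eq with h | rfl
  · have ha : 0 < α / 2 := by positivity
    have ha1 : α / 2 < 1 := by linarith
    have hm : Measurable (fun q : ℝ × EucSpace d =>
        chordGradient (α / 2) (ballPower (α / 2) q.1) q.2) :=
      measurable_chordGradient (V := ballPower (α / 2)) measurable_uncurry_ballPower
    refine ⟨fun ρ => chordGradient (α / 2) (ballPower (α / 2) ρ), hm, fun L R => ?_, fun ρ hρ => ?_,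
      fun ρ x hx => ?_⟩
    · exact ⟨_, fun ρ hρ hR x hx =>
        norm_chordGradient_le ha ha1 (chordBound_ballPower ha ha1 hρ hR L) hx⟩
    · have := isFractionalGradient_chordGradient (d := d) ha ha1 (continuous_ballPower ha ρ)
        (integrable_ballPower ha hρ) fun L => ⟨_, chordBound_ballPower ha ha1 hρ le_rfl L⟩
      rwa [show 2 * (α / 2) = α by ring] at this
    · change chordGradient (α / 2) (ballPower (α / 2) ρ) x = _
      rw [chordGradient_ballPower ha ha1 hx, contractionRate, show 2 * (α / 2) = α by ring]
  · refine ⟨paraboloidGradient, measurable_uncurry_paraboloidGradient, fun L R => ?_,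
      fun ρ hρ => ?_, fun ρ x hx => ?_⟩
    · exact ⟨2 * L, fun ρ _ _ x hx => (norm_paraboloidGradient_le ρ x).trans (by linarith)⟩
    · rw [div_self two_ne_zero]
      exact isFractionalGradient_paraboloidGradient hρ
    · rw [paraboloidGradient, if_pos hx]
      congr 1
      have hG : Real.Gamma ((d : ℝ) / 2) ≠ 0 := (Real.Gamma_pos_of_pos (by positivity)).ne'
      rw [contractionRate, div_self two_ne_zero, Real.Gamma_add_one one_ne_zero,
        Real.Gamma_one, Real.Gamma_add_one (by positivity), Real.rpow_two]
      field_simp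

end BallPowerGradient

/-! ### The transport identity for self-similar profiles -/

section SpaceTime

variable {d : ℕ} {a b : ℝ} {φ : EucSpace d × ℝ → ℝ}

theorem uniqueDiffOn_univ_prod_Icc (hab : a < b) :
    UniqueDiffOn ℝ ((univ : Set (EucSpace d)) ×ˢ Icc a b) :=
  uniqueDiffOn_univ.prod (uniqueDiffOn_Icc hab)

theorem IsSpaceTimeTest.hasFDerivAt (hφ : IsSpaceTimeTest a b φ) {p : EucSpace d × ℝ}
    (hp : p.2 ∈ Ioo a b) :
    HasFDerivAt φ (fderivWithin ℝ φ (univ ×ˢ Icc a b) p) p := by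
  have hnhds : (univ : Set (EucSpace d)) ×ˢ Icc a b ∈ nhds p := by
    rw [← Prod.eta p]
    exact prod_mem_nhds Filter.univ_mem (Icc_mem_nhds hp.1 hp.2)
  have hd := (hφ.contDiff_closure.differentiableOn one_ne_zero) p
    ⟨mem_univ _, Ioo_subset_Icc_self hp⟩
  exact hd.hasFDerivWithinAt.hasFDerivAt hnhds

theorem IsSpaceTimeTest.continuousOn_fderivWithin (hφ : IsSpaceTimeTest a b φ) (hab : a < b) :
    ContinuousOn (fderivWithin ℝ φ (univ ×ˢ Icc a b)) (univ ×ˢ Icc a b) :=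
  hφ.contDiff_closure.continuousOn_fderivWithin (uniqueDiffOn_univ_prod_Icc hab) le_rfl

theorem IsSpaceTimeTest.deriv_eq (hφ : IsSpaceTimeTest a b φ) {p : EucSpace d × ℝ}
    (hp : p.2 ∈ Ioo a b) :
    deriv (fun s => φ (p.1, s)) p.2 =
      fderivWithin ℝ φ (univ ×ˢ Icc a b) p ((0 : EucSpace d), (1 : ℝ)) := by
  have h1 : HasDerivAt (fun s : ℝ => (p.1, s)) ((0 : EucSpace d), (1 : ℝ)) p.2 :=
    (hasDerivAt_const _ _).prodMk (hasDerivAt_id _)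
  exact ((hφ.hasFDerivAt hp).comp_hasDerivAt p.2 h1).deriv

theorem IsSpaceTimeTest.inner_gradient_eq (hφ : IsSpaceTimeTest a b φ) {p : EucSpace d × ℝ}
    (hp : p.2 ∈ Ioo a b) (y : EucSpace d) :
    inner ℝ y (gradient (fun x => φ (x, p.2)) p.1) =
      fderivWithin ℝ φ (univ ×ˢ Icc a b) p (y, (0 : ℝ)) := by
  have h1 : HasFDerivAt (fun x : EucSpace d => (x, p.2))
      (ContinuousLinearMap.inl ℝ (EucSpace d) ℝ) p.1 := hasFDerivAt_prodMk_left _ _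
  have h2 := ((hφ.hasFDerivAt hp).comp p.1 h1).fderiv
  rw [gradient, real_inner_comm, InnerProductSpace.toDual_symm_apply]
  simp only [Function.comp_def] at h2
  rw [h2]
  rfl

theorem integrableOn_univ_prod_Icc {f : EucSpace d × ℝ → ℝ} {R : ℝ}
    (hf : ContinuousOn f (univ ×ˢ Icc a b))
    (h0 : ∀ x, R < ‖x‖ → ∀ t ∈ Icc a b, f (x, t) = 0) :
    IntegrableOn f (univ ×ˢ Icc a b) := by
  have hK : IsCompact (Metric.closedBall (0 : EucSpace d) R ×ˢ Icc a b) :=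
    (isCompact_closedBall _ _).prod isCompact_Icc
  refine ((hf.mono (prod_mono_left (subset_univ _))).integrableOn_compact
    hK).of_forall_sdiff_eq_zero (MeasurableSet.univ.prod measurableSet_Icc) ?_
  rintro ⟨x, t⟩ ⟨⟨_, ht⟩, h⟩
  refine h0 x ?_ t ht
  by_contra hx
  exact h ⟨mem_closedBall_zero_iff.2 (not_lt.1 hx), ht⟩

theorem continuousOn_ballProfile_selfSimilar {ν β c κ : ℝ} (hν : 0 < ν) (hc : 0 < c) (ha : 0 < a) :
    ContinuousOn (fun p : EucSpace d × ℝ => ballProfile (p.2 ^ κ) ν (c * p.2 ^ β) p.1)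
      (univ ×ˢ Icc a b) := by
  have h2 : ∀ p ∈ (univ : Set (EucSpace d)) ×ˢ Icc a b, p.2 ≠ 0 := fun p hp =>
    (ha.trans_le hp.2.1).ne'
  have hpow : ∀ s : ℝ, ContinuousOn (fun p : EucSpace d × ℝ => p.2 ^ s) (univ ×ˢ Icc a b) :=
    fun s => continuousOn_snd.rpow_const fun p hp => Or.inl (h2 p hp)
  unfold ballProfile
  refine (hpow κ).mul (ContinuousOn.rpow_const (ContinuousOn.sup (continuousOn_const.sub
    (ContinuousOn.div (by fun_prop) ((continuousOn_const.mul (hpow β)).pow 2) fun p hp => ?_))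
    continuousOn_const) fun p hp => Or.inr hν.le)
  have := Real.rpow_pos_of_pos (ha.trans_le hp.2.1) β
  positivity

theorem ballProfile_selfSimilar_eq_zero {ν β c κ t : ℝ} (hν : 0 < ν) (hc : 0 < c) (hβ : 0 < β)
    (ht : 0 < t) (htb : t ≤ b) {x : EucSpace d} (hx : c * b ^ β < ‖x‖) :
    ballProfile (t ^ κ) ν (c * t ^ β) x = 0 := by
  refine ballProfile_eq_zero hν (mul_pos hc (Real.rpow_pos_of_pos ht _)) (le_trans ?_ hx.le)
  gcongr

theorem ballProfile_selfSimilar_smul {ν β c t : ℝ} (ht : 0 < t) (y : EucSpace d) :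
    ballProfile (t ^ (-(d * β))) ν (c * t ^ β) (t ^ β • y) =
      t ^ (-(d * β)) * ballProfile 1 ν c y := by
  have h := Real.rpow_pos_of_pos ht β
  rw [ballProfile, ballProfile, norm_smul, Real.norm_of_nonneg h.le, one_mul, mul_pow, mul_pow,
    mul_comm (c ^ 2), mul_div_mul_left _ _ (by positivity)]

/-- Conservation of mass: for x = t^β y the Jacobian t^(dβ) cancels the amplitude t^(-dβ). -/
theorem integral_ballProfile_selfSimilar_mul {ν β c t : ℝ} (ht : 0 < t) (f : EucSpace d → ℝ) :
    ∫ x, ballProfile (t ^ (-(d * β))) ν (c * t ^ β) x * f x =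
      ∫ y, ballProfile 1 ν c y * f (t ^ β • y) := by
  have h := Real.rpow_pos_of_pos ht β
  have h1 := Measure.integral_comp_smul (volume : Measure (EucSpace d))
    (fun x => ballProfile (t ^ (-(d * β))) ν (c * t ^ β) x * f x) (t ^ β)
  have h3 : t ^ (-(d * β)) * (t ^ β) ^ d = 1 := by
    rw [← Real.rpow_natCast, ← Real.rpow_mul ht.le, ← Real.rpow_add ht,
      show -(d * β) + β * d = 0 by ring, Real.rpow_zero]
  rw [finrank_euclideanSpace, Fintype.card_fin, abs_of_pos (by positivity), smul_eq_mul,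
    eq_comm, inv_mul_eq_iff_eq_mul₀ (by positivity)] at h1
  rw [h1, ← integral_const_mul]
  refine integral_congr_ae (Filter.Eventually.of_forall fun y => ?_)
  simp only
  rw [ballProfile_selfSimilar_smul ht]
  linear_combination (ballProfile 1 ν c y * f (t ^ β • y)) * h3

/-- The profile is transported by the velocity (β/t) x. In the variable y = t^(-β) x its weight no
longer depends on t, and the other factor is the derivative of t ↦ φ(t^β y, t). The fundamental
theorem of calculus leaves the value at t = a, since φ vanishes near t = b. -/
theorem IsSpaceTimeTest.transport_identity (hφ : IsSpaceTimeTest a b φ) {ν β c : ℝ} (hν : 0 < ν)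
    (hc : 0 < c) (hβ : 0 < β) (ha : 0 < a) (hab : a < b) :
    IntegrableOn (fun p : EucSpace d × ℝ => ballProfile (p.2 ^ (-(d * β))) ν (c * p.2 ^ β) p.1 *
        fderivWithin ℝ φ (univ ×ˢ Icc a b) p ((β / p.2) • p.1, (1 : ℝ))) (univ ×ˢ Ioo a b) ∧
      (∫ p in (univ : Set (EucSpace d)) ×ˢ Ioo a b,
        ballProfile (p.2 ^ (-(d * β))) ν (c * p.2 ^ β) p.1 *
          fderivWithin ℝ φ (univ ×ˢ Icc a b) p ((β / p.2) • p.1, (1 : ℝ))) +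
        ∫ x, ballProfile (a ^ (-(d * β))) ν (c * a ^ β) x * φ (x, a) = 0 := by
  -- The derivative within the closed strip is continuous up to its boundary and agrees with the
  -- full derivative at interior times.
  set D := fderivWithin ℝ φ ((univ : Set (EucSpace d)) ×ˢ Icc a b) with hD
  have hDc := hφ.continuousOn_fderivWithin hab
  rw [← hD] at hDc
  have hpos : ∀ p ∈ (univ : Set (EucSpace d)) ×ˢ Icc a b, 0 < p.2 := fun p hp =>
    ha.trans_le hp.2.1
  have hpow : ∀ s : ℝ, ContinuousOn (fun p : EucSpace d × ℝ => p.2 ^ s) (univ ×ˢ Icc a b) :=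
    fun s => continuousOn_snd.rpow_const fun p hp => Or.inl (hpos p hp).ne'
  have hsub : (univ : Set (EucSpace d)) ×ˢ Ioo a b ⊆ univ ×ˢ Icc a b :=
    prod_mono_right Ioo_subset_Icc_self
  have hS : (volume.restrict ((univ : Set (EucSpace d)) ×ˢ Ioo a b) :
      Measure (EucSpace d × ℝ)) = volume.prod (volume.restrict (Ioo a b)) := by
    rw [Measure.volume_eq_prod, ← Measure.prod_restrict, Measure.restrict_univ]
  have i1 : IntegrableOn (fun p : EucSpace d × ℝ =>
      ballProfile (p.2 ^ (-(d * β))) ν (c * p.2 ^ β) p.1 * D p ((β / p.2) • p.1, (1 : ℝ)))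
      (univ ×ˢ Icc a b) := by
    refine integrableOn_univ_prod_Icc (R := c * b ^ β)
      ((continuousOn_ballProfile_selfSimilar hν hc ha).mul (hDc.clm_apply
        (ContinuousOn.prodMk (ContinuousOn.smul (continuousOn_const.div continuousOn_snd
          fun p hp => (hpos p hp).ne') continuousOn_fst) continuousOn_const)))
      fun x hx t ht => ?_
    simp only
    rw [ballProfile_selfSimilar_eq_zero hν hc hβ (ha.trans_le ht.1) ht.2 hx, zero_mul]
  have hmap : ContinuousOn (fun p : EucSpace d × ℝ => (p.2 ^ β • p.1, p.2)) (univ ×ˢ Icc a b) :=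
    ((hpow β).smul continuousOn_fst).prodMk continuousOn_snd
  have i2 : IntegrableOn (fun p : EucSpace d × ℝ => ballProfile 1 ν c p.1 *
      D (p.2 ^ β • p.1, p.2) ((β * p.2 ^ (β - 1)) • p.1, (1 : ℝ))) (univ ×ˢ Icc a b) := by
    refine integrableOn_univ_prod_Icc (R := c)
      ((((continuous_ballProfile hν).comp continuous_fst).continuousOn).mul
        ((hDc.comp hmap fun p hp => ⟨mem_univ _, hp.2⟩).clm_apply
        (ContinuousOn.prodMk (ContinuousOn.smul (continuousOn_const.mul (hpow _))
          continuousOn_fst) continuousOn_const)))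
      fun x hx t ht => ?_
    simp only
    rw [ballProfile_eq_zero hν hc hx.le, zero_mul]
  have i1' := i1.mono_set hsub
  have i2' := i2.mono_set hsub
  refine ⟨i1', ?_⟩
  rw [IntegrableOn, hS] at i1' i2'
  rw [hS, integral_prod_symm _ i1']
  have s1 : ∀ t ∈ Ioo a b, ∫ x, ballProfile (t ^ (-(d * β))) ν (c * t ^ β) x *
      D (x, t) ((β / t) • x, (1 : ℝ)) = ∫ y, ballProfile 1 ν c y *
      D (t ^ β • y, t) ((β * t ^ (β - 1)) • y, (1 : ℝ)) := by
    intro t ht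
    have ht0 := ha.trans ht.1
    rw [integral_ballProfile_selfSimilar_mul ht0]
    refine integral_congr_ae (Filter.Eventually.of_forall fun y => ?_)
    simp only
    rw [smul_smul, Real.rpow_sub ht0, Real.rpow_one, div_mul_eq_mul_div, mul_div_assoc]
  rw [setIntegral_congr_fun measurableSet_Ioo s1, integral_integral_swap
    (f := fun t y => ballProfile 1 ν c y *
      D (t ^ β • y, t) ((β * t ^ (β - 1)) • y, (1 : ℝ))) i2'.swap,
    integral_ballProfile_selfSimilar_mul ha]
  have s2 : ∀ y : EucSpace d, ∫ t in Ioo a b, ballProfile 1 ν c y *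
      D (t ^ β • y, t) ((β * t ^ (β - 1)) • y, (1 : ℝ)) =
      -(ballProfile 1 ν c y * φ (a ^ β • y, a)) := by
    intro y
    have hcurve : ContinuousOn (fun t : ℝ => ((t ^ β • y, t) : EucSpace d × ℝ)) (Icc a b) :=
      hmap.comp (f := fun t : ℝ => (y, t)) (by fun_prop) fun t ht => ⟨mem_univ _, ht⟩
    have hderiv : ∀ t ∈ Ioo a b, HasDerivAt (fun t : ℝ => φ (t ^ β • y, t))
        (D (t ^ β • y, t) ((β * t ^ (β - 1)) • y, (1 : ℝ))) t := by
      intro t ht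
      have h1 := (Real.hasDerivAt_rpow_const (p := β) (Or.inl (ha.trans ht.1).ne')).smul_const y
      have h2 : HasDerivAt (fun t : ℝ => ((t ^ β • y, t) : EucSpace d × ℝ))
        ((β * t ^ (β - 1)) • y, (1 : ℝ)) t := h1.prodMk (hasDerivAt_id t)
      exact HasFDerivAt.comp_hasDerivAt (f := fun t : ℝ => ((t ^ β • y, t) : EucSpace d × ℝ)) t
        (hφ.hasFDerivAt (p := (t ^ β • y, t)) ht) h2
    have hcont : ContinuousOn (fun t : ℝ => D (t ^ β • y, t) ((β * t ^ (β - 1)) • y, (1 : ℝ)))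
        (Icc a b) := by
      refine (hDc.comp hcurve fun t ht => ⟨mem_univ _, ht⟩).clm_apply (ContinuousOn.prodMk
        (ContinuousOn.smul (continuousOn_const.mul (continuousOn_id.rpow_const fun t ht =>
          Or.inl (ha.trans_le ht.1).ne')) continuousOn_const) continuousOn_const)
    have hftc := intervalIntegral.integral_eq_sub_of_hasDerivAt_of_le hab.le
      (hφ.contDiff_closure.continuousOn.comp hcurve fun t ht => ⟨mem_univ _, ht⟩) hderiv
      ((intervalIntegrable_iff_integrableOn_Icc_of_le hab.le).2
        (hcont.integrableOn_compact isCompact_Icc))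
    obtain ⟨δ, hδ, hend⟩ := hφ.vanish_end
    simp only [Function.comp_apply] at hftc
    rw [hend _ b (right_mem_Icc.2 hab.le) (by linarith)] at hftc
    rw [integral_const_mul, ← integral_Ioc_eq_integral_Ioo,
      ← intervalIntegral.integral_of_le hab.le, hftc]
    ring
  simp_rw [s2]
  rw [integral_neg, neg_add_cancel]

end SpaceTime

/-! ### The weak solution -/

section SelfSimilar

theorem IsFractionalGradient.const_mul {d : ℕ} {α : ℝ} {v : EucSpace d → ℝ}
    {g : EucSpace d → EucSpace d} (h : IsFractionalGradient α v g) (c : ℝ) :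
    IsFractionalGradient α (fun x => c * v x) (fun x => c • g x) := by
  obtain ⟨h1, h2, h3⟩ := h
  refine ⟨h1.const_mul c, h2.smul c, fun j ψ hψ hψc => ?_⟩
  have h := h3 j ψ hψ hψc
  have e : ∀ x, (((c • g x) j : ℝ) : ℂ) * ψ x = (c : ℂ) * (((g x j : ℝ) : ℂ) * ψ x) := by
    intro x
    rw [PiLp.smul_apply, smul_eq_mul, Complex.ofReal_mul, mul_assoc]
  have e2 : (fun x => ((c * v x : ℝ) : ℂ)) = fun x => (c : ℂ) * ((v x : ℝ) : ℂ) :=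
    funext fun x => Complex.ofReal_mul c (v x)
  simp_rw [e]
  rw [integral_const_mul, h, ← integral_const_mul]
  refine integral_congr_ae (Filter.Eventually.of_forall fun ξ => ?_)
  simp only
  rw [e2, fourier_const_mul]
  ring

/-- The self-similar profile `C⁻¹ u`. -/
noncomputable def npmeProfile (d : ℕ) (α m : ℝ) (x : EucSpace d) (t : ℝ) : ℝ :=
  ballProfile (t ^ (-(d * npmeBeta d α m))) (α / (2 * (m - 1)))
    (npmeSpeed d α m * t ^ npmeBeta d α m) x

theorem npmeProfile_nonneg {d : ℕ} {α m t : ℝ} (ht : 0 < t) (x : EucSpace d) : 0 ≤ npmeProfile d α m x t :=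
  ballProfile_nonneg (Real.rpow_nonneg ht.le _) x

variable {d : ℕ} [NeZero d] {α m : ℝ}

/-- This relation dictates the constant k: it converts the contraction rate of the fractional
gradient into the expansion exponent β. -/
theorem npmeK_mul_contractionRate (hα : 0 < α) :
    npmeK d α m * contractionRate d α = npmeBeta d α m := by
  have hd : (0 : ℝ) < d := by exact_mod_cast NeZero.pos d
  have h1 : Real.Gamma ((d : ℝ) / 2) ≠ 0 := (Real.Gamma_pos_of_pos (by positivity)).ne'
  have h2 : Real.Gamma (1 + α / 2) ≠ 0 := (Real.Gamma_pos_of_pos (by positivity)).ne'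
  have h3 : Real.Gamma (((d : ℝ) + α) / 2) ≠ 0 := (Real.Gamma_pos_of_pos (by positivity)).ne'
  have h4 : (2 : ℝ) ^ α ≠ 0 := (Real.rpow_pos_of_pos two_pos α).ne'
  rw [npmeK, contractionRate, npmeBeta, show (d : ℝ) / 2 + α / 2 = (d + α) / 2 by ring]
  obtain ⟨D, hD⟩ : ∃ D, D = (d : ℝ) * (m - 1) + α := ⟨_, rfl⟩
  rw [← hD]
  rcases eq_or_ne D 0 with rfl | hD0
  · simp
  · field_simp

theorem npmeSpeed_rpow (hα : 0 < α) (hm : 1 < m) : npmeSpeed d α m ^ α = (npmeK d α m)⁻¹ := by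
  have hk := npmeK_pos (d := d) hα hm
  rw [npmeSpeed, one_div, Real.inv_rpow (Real.rpow_nonneg hk.le _), ← Real.rpow_mul hk.le,
    one_div_mul_cancel hα.ne', Real.rpow_one]

theorem inv_npmeC_mul_npmeDensity (hα : 0 < α) (hm : 1 < m) {t : ℝ} (ht : 0 < t)
    (x : EucSpace d) : (npmeC d α m)⁻¹ * npmeDensity d α m x t = npmeProfile d α m x t := by
  have hC := npmeC_pos (d := d) hα hm
  rw [npmeDensity_eq_ballProfile hα hm ht, npmeProfile, ballProfile, ballProfile, mul_assoc,
    inv_mul_cancel_left₀ hC.ne']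

/-- Three relations between the constants meet here: ν (m - 1) = α/2 gives the power of the
paraboloid, β (d(m-1) + α) = 1 gives t^(-dβ(m-1)) = t^(βα) / t, and c^α = 1/k gives the factor k. -/
theorem npmeProfile_rpow (hα : 0 < α) (hm : 1 < m) {t : ℝ} (ht : 0 < t) (x : EucSpace d) :
    |npmeProfile d α m x t| ^ (m - 2) * npmeProfile d α m x t =
      npmeK d α m / t * ballPower (α / 2) (npmeSpeed d α m * t ^ npmeBeta d α m) x := by
  have hk := npmeK_pos (d := d) hα hm
  have hc := npmeSpeed_pos (d := d) hα hm
  have hm1 : 0 < m - 1 := by linarith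
  have hd : (0 : ℝ) < d := by exact_mod_cast NeZero.pos d
  set β := npmeBeta d α m with hβ
  set ρ := npmeSpeed d α m * t ^ β with hρ
  have hρ0 : 0 < ρ := mul_pos hc (Real.rpow_pos_of_pos ht _)
  set s := max (1 - ‖x‖ ^ 2 / ρ ^ 2) 0 with hs
  have hs0 : 0 ≤ s := le_max_right _ _
  have hball : ballPower (α / 2) ρ x = ρ ^ α * s ^ (α / 2) := by
    have : max (ρ ^ 2 - ‖x‖ ^ 2) 0 = ρ ^ 2 * s := by
      rw [hs, mul_max_of_nonneg _ _ (sq_nonneg ρ), mul_zero]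
      congr 1
      field_simp
    rw [ballPower, this, Real.mul_rpow (sq_nonneg _) hs0, ← Real.rpow_natCast,
      ← Real.rpow_mul hρ0.le]
    congr 2
    push_cast
    ring
  have hW : npmeProfile d α m x t = t ^ (-(d * β)) * s ^ (α / (2 * (m - 1))) := rfl
  rw [abs_of_nonneg (npmeProfile_nonneg ht x), hball, hW]
  -- Where the profile vanishes the exponent m - 2 may be negative, but the second factor w is zero.
  rcases hs0.eq_or_lt with h0 | h0
  · rw [← h0, Real.zero_rpow (by positivity), Real.zero_rpow (by positivity)]
    ring
  · have hpos : 0 < t ^ (-(d * β)) * s ^ (α / (2 * (m - 1))) :=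
      mul_pos (Real.rpow_pos_of_pos ht _) (Real.rpow_pos_of_pos h0 _)
    have hβ1 : β * (d * (m - 1) + α) = 1 := by
      rw [hβ, npmeBeta]
      exact one_div_mul_cancel (by positivity)
    have e1 : ∀ y : ℝ, 0 < y → y ^ (m - 2) * y = y ^ (m - 1) := fun y hy => by
      rw [show m - 1 = (m - 2) + 1 by ring, Real.rpow_add hy, Real.rpow_one]
    rw [e1 _ hpos, Real.mul_rpow (Real.rpow_nonneg ht.le _) (Real.rpow_nonneg hs0 _),
      ← Real.rpow_mul ht.le, ← Real.rpow_mul hs0, hρ, Real.mul_rpow hc.le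
      (Real.rpow_nonneg ht.le _), npmeSpeed_rpow hα hm, ← Real.rpow_mul ht.le,
      show -(d * β) * (m - 1) = β * α - 1 by linear_combination -hβ1, Real.rpow_sub ht,
      Real.rpow_one, show α / (2 * (m - 1)) * (m - 1) = α / 2 by field_simp]
    field_simp

theorem isWeakSolutionNPME_npmeProfile (hα : 0 < α) (hα2 : α ≤ 2) (hm : 1 < m) {a b : ℝ}
    (ha : 0 < a) (hab : a < b) :
    IsWeakSolutionNPME α m a b (npmeProfile d α m) (fun x => npmeProfile d α m x a) := by
  have hk := npmeK_pos (d := d) hα hm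
  have hc := npmeSpeed_pos (d := d) hα hm
  have hβ := npmeBeta_pos (d := d) hα hm
  have hν : 0 < α / (2 * (m - 1)) := div_pos hα (by linarith)
  have hpos : ∀ t ∈ Ioo a b, 0 < t := fun t ht => ha.trans ht.1
  obtain ⟨G, hGm, hGb, hGf, hGi⟩ := exists_fractionalGradient_ballPower d hα hα2
  have hW : ContinuousOn (fun p : EucSpace d × ℝ => npmeProfile d α m p.1 p.2)
      (univ ×ˢ Icc a b) := continuousOn_ballProfile_selfSimilar hν hc ha
  have hmeas : MeasurableSet ((univ : Set (EucSpace d)) ×ˢ Ioo a b) :=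
    MeasurableSet.univ.prod measurableSet_Ioo
  have hsub : (univ : Set (EucSpace d)) ×ˢ Ioo a b ⊆ univ ×ˢ Icc a b :=
    prod_mono_right Ioo_subset_Icc_self
  set g : EucSpace d → ℝ → EucSpace d := fun x t =>
    (npmeK d α m / t) • G (npmeSpeed d α m * t ^ npmeBeta d α m) x with hg
  have hgm : Measurable (fun p : EucSpace d × ℝ => g p.1 p.2) := by
    have h : Measurable (fun p : EucSpace d × ℝ =>
        G (npmeSpeed d α m * p.2 ^ npmeBeta d α m) p.1) :=
      hGm.comp (f := fun p : EucSpace d × ℝ => (npmeSpeed d α m * p.2 ^ npmeBeta d α m, p.1))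
        (by fun_prop)
    exact (by fun_prop : Measurable fun p : EucSpace d × ℝ => npmeK d α m / p.2).smul h
  -- Inside the ball the gradient is linear and k κ = β. Outside, no information on the nonlocal
  -- gradient is needed, since it is multiplied by w = 0.
  have hflux : ∀ x, ∀ t ∈ Ioo a b, |npmeProfile d α m x t| • g x t =
      -(npmeProfile d α m x t • (npmeBeta d α m / t) • x) := by
    intro x t ht
    rw [abs_of_nonneg (npmeProfile_nonneg (hpos t ht) x)]
    rcases lt_or_ge ‖x‖ (npmeSpeed d α m * t ^ npmeBeta d α m) with h | h
    · simp only [hg]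
      rw [hGi _ _ h, ← npmeK_mul_contractionRate hα]
      simp only [smul_smul, ← neg_smul]
      congr 1
      ring
    · rw [show npmeProfile d α m x t = 0 from ballProfile_eq_zero hν
        (mul_pos hc (Real.rpow_pos_of_pos (hpos t ht) _)) h]
      simp
  refine ⟨?_, g, ?_, ?_, ?_, fun φ hφ => ?_⟩
  · refine (integrableOn_univ_prod_Icc (R := npmeSpeed d α m * b ^ npmeBeta d α m) hW
      fun x hx t ht => ?_).mono_set hsub
    exact ballProfile_selfSimilar_eq_zero hν hc hβ (ha.trans_le ht.1) ht.2 hx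
  · refine (ae_restrict_iff' measurableSet_Ioo).2 (Filter.Eventually.of_forall fun t ht => ?_)
    have h := (hGf (npmeSpeed d α m * t ^ npmeBeta d α m)
      (mul_pos hc (Real.rpow_pos_of_pos (hpos t ht) _)).le).const_mul (npmeK d α m / t)
    simp_rw [npmeProfile_rpow hα hm (hpos t ht)]
    exact h
  -- Since a > 0, the factor k/t is at most k/a, and the radii stay below c b^β; so the bound
  -- uniform in ρ controls `g` on a ball times the whole time interval.
  · rintro ⟨x, t⟩ ⟨_, ht⟩
    obtain ⟨B, hB⟩ := hGb (‖x‖ + 1) (npmeSpeed d α m * b ^ npmeBeta d α m)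
    refine ⟨Metric.ball x 1 ×ˢ Ioo a b, ?_, ?_⟩
    · rw [nhdsWithin_prod_eq, nhdsWithin_univ]
      exact Filter.prod_mem_prod (Metric.ball_mem_nhds x one_pos) self_mem_nhdsWithin
    · refine Measure.integrableOn_of_bounded (M := npmeK d α m / a * B) ?_
        hgm.aestronglyMeasurable ((ae_restrict_iff' (measurableSet_ball.prod
          measurableSet_Ioo)).2 (Filter.Eventually.of_forall ?_))
      · rw [Measure.volume_eq_prod, Measure.prod_prod]
        exact (ENNReal.mul_lt_top measure_ball_lt_top measure_Ioo_lt_top).ne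
      · rintro ⟨y, s⟩ ⟨hy, hs⟩
        have hs0 := hpos s hs
        have hy' : ‖y‖ ≤ ‖x‖ + 1 := by
          have := norm_le_norm_add_norm_sub x y
          rw [Metric.mem_ball, dist_eq_norm] at hy
          rw [norm_sub_rev] at hy
          linarith [norm_sub_rev x y]
        simp only [hg]
        rw [norm_smul, Real.norm_of_nonneg (by positivity)]
        have h1 := hB _ (mul_pos hc (Real.rpow_pos_of_pos hs0 _)).le
          (mul_le_mul_of_nonneg_left (Real.rpow_le_rpow hs0.le hs.2.le hβ.le) hc.le) y hy'
        gcongr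
        exact hs.1.le
  · have h1 : ContinuousOn (fun p : EucSpace d × ℝ =>
        -(npmeProfile d α m p.1 p.2 • (npmeBeta d α m / p.2) • p.1)) (univ ×ˢ Ioo a b) :=
      ((hW.mono hsub).smul (ContinuousOn.smul (continuousOn_const.div continuousOn_snd
        fun p hp => (hpos _ hp.2).ne') continuousOn_fst)).neg
    refine (h1.locallyIntegrableOn hmeas).congr ?_
    exact (ae_restrict_iff' hmeas).2 (Filter.Eventually.of_forall fun p hp =>
      (hflux p.1 p.2 hp.2).symm)
  · obtain ⟨t1, t2⟩ := hφ.transport_identity hν hc hβ ha hab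
    have heq : ∀ p ∈ (univ : Set (EucSpace d)) ×ˢ Ioo a b,
        ballProfile (p.2 ^ (-(d * npmeBeta d α m))) (α / (2 * (m - 1)))
          (npmeSpeed d α m * p.2 ^ npmeBeta d α m) p.1 *
          fderivWithin ℝ φ (univ ×ˢ Icc a b) p ((npmeBeta d α m / p.2) • p.1, (1 : ℝ)) =
        npmeProfile d α m p.1 p.2 * deriv (fun s => φ (p.1, s)) p.2 -
          |npmeProfile d α m p.1 p.2| *
            inner ℝ (g p.1 p.2) (gradient (fun y => φ (y, p.2)) p.1) := by
      intro p hp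
      rw [← real_inner_smul_left, hflux _ _ hp.2, inner_neg_left, sub_neg_eq_add,
        real_inner_smul_left, hφ.inner_gradient_eq hp.2, hφ.deriv_eq hp.2, ← mul_add,
        ← map_add]
      simp [npmeProfile]
    refine ⟨(integrableOn_congr_fun heq hmeas).1 t1, ?_, ?_⟩
    · have hcont : Continuous (fun x => φ (x, a)) := by
        rw [← continuousOn_univ]
        exact hφ.contDiff_closure.continuousOn.comp (f := fun x => (x, a)) (by fun_prop)
          fun x _ => ⟨mem_univ _, left_mem_Icc.2 hab.le⟩
      have hWa : Continuous (fun x => npmeProfile d α m x a) := continuous_ballProfile hν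
      exact (hWa.mul hcont).integrable_of_hasCompactSupport (HasCompactSupport.mul_right
        (hasCompactSupport_ballProfile hν (mul_pos hc (Real.rpow_pos_of_pos ha _))))
    · rw [← setIntegral_congr_fun hmeas heq]
      exact t2

/-- Agreement is asked only on the open time interval, because the identification of C⁻¹ u with
`npmeProfile` is available only for t > 0. -/
theorem IsWeakSolutionNPME.congr {d : ℕ} {α m a b : ℝ} {u v : EucSpace d → ℝ → ℝ}
    {u₀ : EucSpace d → ℝ} (h : IsWeakSolutionNPME α m a b u u₀)
    (huv : ∀ x, ∀ t ∈ Ioo a b, u x t = v x t) : IsWeakSolutionNPME α m a b v u₀ := by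
  have hmeas : MeasurableSet ((univ : Set (EucSpace d)) ×ˢ Ioo a b) :=
    MeasurableSet.univ.prod measurableSet_Ioo
  obtain ⟨h1, g, h2, h3, h4, h5⟩ := h
  refine ⟨(integrableOn_congr_fun (fun p hp => huv p.1 p.2 hp.2) hmeas).1 h1, g, ?_, h3, ?_,
    fun φ hφ => ?_⟩
  · filter_upwards [h2, ae_restrict_mem measurableSet_Ioo] with t ht htm
    simp_rw [← huv _ t htm]
    exact ht
  · exact h4.congr ((ae_restrict_iff' hmeas).2 (Filter.Eventually.of_forall fun p hp => by
      simp only [huv p.1 p.2 hp.2]))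
  · obtain ⟨t1, t2, t3⟩ := h5 φ hφ
    have heq : ∀ p ∈ (univ : Set (EucSpace d)) ×ˢ Ioo a b,
        u p.1 p.2 * deriv (fun s => φ (p.1, s)) p.2 -
          |u p.1 p.2| * inner ℝ (g p.1 p.2) (gradient (fun y => φ (y, p.2)) p.1) =
        v p.1 p.2 * deriv (fun s => φ (p.1, s)) p.2 -
          |v p.1 p.2| * inner ℝ (g p.1 p.2) (gradient (fun y => φ (y, p.2)) p.1) := by
      intro p hp
      rw [huv p.1 p.2 hp.2]
    refine ⟨(integrableOn_congr_fun heq hmeas).1 t1, t2, ?_⟩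
    rw [← setIntegral_congr_fun hmeas heq]
    exact t3

end SelfSimilar

theorem proposition2 {Ω : Type*} [MeasurableSpace Ω] (d n : ℕ) (hn : 1 ≤ n)
    (α m : ℝ) (hα₀ : 0 < α) (hα₂ : α ≤ 2)
    -- `f s` is the density of the renewal times when there are `n` changes of direction in `[0, s]`
    (f : ℝ → (Fin n → ℝ) → ℝ)
    (hlink :
      (d = 1 ∧ f = uniformRenewalDensity n ∧
        ((Odd n ∧ 3 ≤ n ∧ m = α / ((n : ℝ) - 1) + 1) ∨
          (Even n ∧ 4 ≤ n ∧ m = α / ((n : ℝ) - 2) + 1))) ∨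
      (2 ≤ d ∧ f = dirichletRenewalDensity n ((d : ℝ) - 1) ∧
        (d : ℝ) > 2 / n + 1 ∧ m = α / (n * ((d : ℝ) - 1) - 2) + 1) ∨
      (3 ≤ d ∧ f = dirichletRenewalDensity n ((d : ℝ) / 2 - 1) ∧
        (d : ℝ) > 2 / n + 2 ∧ m = α / (n * ((d : ℝ) - 2) - 2) + 1))
    (F : RandomFlight d n Ω)
    (Y : ℝ≥0 → Ω → EucSpace d)
    (hY : Y = fun t : ℝ≥0 => F.position (npmeSpeed d α m) ((t : ℝ) ^ npmeBeta d α m)) :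
    1 < m ∧
    -- `Y` is adapted to the time-changed history, and progressively measurable
    (∃ G : Filtration ℝ≥0 ‹MeasurableSpace Ω›,
      (∀ t : ℝ≥0, G t = F.history (t ^ npmeBeta d α m)) ∧
      Adapted G Y ∧ IsProgressive G Y) ∧
    -- the law of `Y t`, given `n` changes of direction up to the time `t ^ β`, has density `u(·, t)`
    (∀ (t : ℝ≥0), 0 < t → ∀ (P : Measure Ω) [IsProbabilityMeasure P],
      F.IsIsotropic P → F.HasRenewalDensity (f ((t : ℝ) ^ npmeBeta d α m)) P →
      P.map (Y t) = volume.withDensity (fun x => ENNReal.ofReal (npmeDensity d α m x t))) ∧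
    -- up to its normalizing constant, `u` is a weak solution of the nonlocal equation
    (∀ a b : ℝ, 0 < a → a < b →
      IsWeakSolutionNPME α m a b
        (fun x t => (npmeC d α m)⁻¹ * npmeDensity d α m x t)
        (fun x => (npmeC d α m)⁻¹ * npmeDensity d α m x a)) := by
  obtain ⟨hd, hm, hlaw⟩ := RandomFlight.map_position_of_link d n hn α m hα₀ f hlink F
  have : NeZero d := ⟨hd⟩
  subst hY
  refine ⟨hm, F.exists_filtration_isProgressive _ _ (npmeBeta_pos hα₀ hm),
    fun t ht P _ hiso hren => hlaw t ht P hiso hren, fun a b ha hab => ?_⟩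
  simp_rw [inv_npmeC_mul_npmeDensity hα₀ hm ha]
  exact (isWeakSolutionNPME_npmeProfile hα₀ hα₂ hm ha hab).congr fun x t ht =>
    (inv_npmeC_mul_npmeDensity hα₀ hm (ha.trans ht.1) x).symm
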